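/- **Setting.** Let $\mathcal S$ be a measurable state space with a $\sigma$-finite reference measure $ds$, $\mathcal W$ a context space with a probability law $q$, $\mathcal A$ a finite action set with $K\ge1$ elements, $H\ge 1$ a horizon, $s_1\in\mathcal S$ a fixed initial state. For $h\in[H]=\{1,\dots,H\}$ let $\phi_h,\psi_h:\mathcal S\times\mathcal A\to\mathbb R^d$ be known features and $\mu_h:\mathcal S\times\mathcal W\to\mathbb R^d$, $\eta_h:\mathcal W\to\mathbb R^d$ unknown weights (all measurable). In the MDP $\mathcal M(w)$ of the context $w$, $P_h(s'|s,a,w)=\langle\phi_h(s,a),\mu_h(s',w)\rangle$ is a probability density in $s'$ and the deterministic reward is $r_h(s,a,w)=\langle\psi_h(s,a),\eta_h(w)\rangle\in[0,1]$. Moreover $\|\phi_h(s,a)\|_2\le1$, $\|\psi_h(s,a)\|_2\le 1$, $\|\eta_h(w)\|_2\le\sqrt d$, and $\|\int\mu_h(s,w)g(s)\,ds\|_2\le\sqrt d$ for every $w$ and measurable $g:\mathcal S\to[0,1]$. A policy is a family $\pi=(\pi_h(\cdot|s))_{h\in[H]}$ of distributions on $\mathcal A$; $V^{\pi}_{\mathcal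 M(w)}=\sum_{h=1}^H\mathbb E[r_h(s_h,a_h,w)]$ is its value from $s_1$ under $\mathcal M(w)$, and $V^{\pi^*_w}_{\mathcal M(w)}=\sup_\pi V^\pi_{\mathcal M(w)}$. **Assumptions.** (i) $\Psi_2,\Psi_3$ are finite classes of measurable functions $\mathcal S\times\mathcal W\to\mathbb R^d$ and $\mathcal W\to\mathbb R^d$ with $\mu_h\in\Psi_2$ and $\eta_h\in\Psi_3$ for all $h\in[H]$, and for each $\mu\in\Psi_2$ and $h\in[H]$ the function $\langle\phi_h(s,a),\mu(\cdot,w)\rangle$ is a probability density for all $s,a,w$. (ii) There are $0<p_{\min}\le p_{\max}<\infty$ such that for every context $w$, every policy $\pi$ and every step $2\le h\le H$, the state $s_h$ under $(P_w,\pi)$ has a density with values in $[p_{\min},p_{\max}]$. Put $C=\sqrt{p_{\max}/p_{\min}}$. **Algorithm.** Fix $N\ge1$, $\delta\in(0,1)$, $\widetilde\gamma_1,\widetilde\gamma_2>0$ and put $\widetilde\lambda_n=\widetilde\gamma_1d\log(2nH/\delta)$, $\widetilde\xi_n=\widetilde\gamma_2d\log(2nH/\delta)$. In episode $n\in[N]$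 the policies $(\pi^n_w)_{w\in\mathcal W}$ are determined by the data $(w_\tau,(s^\tau_h,a^\tau_h,\bar s^\tau_{h+1})_{h\in[H]})_{\tau<n}$. For $n=1$ they are arbitrary. For $n\ge2$ and each $h$ choose $$\widetilde\mu^n_h\in\operatorname*{argmax}_{\mu\in\Psi_2}\sum_{\tau<n}\log\langle\phi_h(s_h^\tau,a_h^\tau),\mu(\bar s_{h+1}^\tau,w_\tau)\rangle,\qquad \widetilde\eta^n_h\in\operatorname*{argmin}_{\eta\in\Psi_3}\sum_{\tau<n}\big(\langle\psi_h(s_h^\tau,a_h^\tau),\eta(w_\tau)\rangle-r_h(s_h^\tau,a_h^\tau,w_\tau)\big)^2$$ ($\log 0=-\infty$); put $\widetilde\Sigma^n_h=\sum_{\tau<n}\phi_h\phi_h^\top(s_h^\tau,a_h^\tau)+\widetilde\lambda_nI$, $\widetilde\Lambda^n_h=\sum_{\tau<n}\psi_h\psi_h^\top(s_h^\tau,a_h^\tau)+\widetilde\xi_nI$, $$\widetilde b^n_h(s,a)=\min\Big\{\tfrac{25CH\sqrt{dN}}{2\sqrt K}\,\phi_h(s,a)^\top(\widetilde\Sigma^n_h)^{-1}\phi_h(s,a),\,H\Big\},\qquad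 \widetilde c^n_h(s,a)=\min\Big\{\tfrac{25C\sqrt{dN}}{2\sqrt K}\,\psi_h(s,a)^\top(\widetilde\Lambda^n_h)^{-1}\psi_h(s,a),\,1\Big\},$$ and $\widetilde r^n_h(s,a,w)=\max\{0,\min\{1,\langle\widetilde\eta^n_h(w),\psi_h(s,a)\rangle\}\}+\widetilde b^n_h(s,a)+\widetilde c^n_h(s,a)$. For a policy $\pi$ define $\overline{\overline V}{}^{\pi}_{H+1}=0$ and, for $h=H,\dots,1$, $$\overline{\overline V}{}^{\pi}_{h}(s)=\mathbb E_{a\sim\pi_h(\cdot|s)}\min\Big\{3H,\ \widetilde r^n_h(s,a,w)+\int\overline{\overline V}{}^{\pi}_{h+1}(s')\langle\phi_h(s,a),\widetilde\mu^n_h(s',w)\rangle\,ds'\Big\};$$ $\pi^n_w$ is a maximizer of $\pi\mapsto\overline{\overline V}{}^{\pi}_1(s_1)$ (chosen measurably in the data, the context and the state). Then $w_n\sim q$ is drawn independently of the past, and for each $h\in[H]$ a rollout in $\mathcal M(w_n)$ collects $(s_h^n,a_h^n,\bar s_{h+1}^n)$: $s_h^n$ has the law of the step-$h$ state under $(P_{w_n},\pi^n_{w_n})$,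 $a_h^n$ is uniform on $\mathcal A$ and independent of $s_h^n$, and $\bar s_{h+1}^n\sim P_h(\cdot|s_h^n,a_h^n,w_n)$, conditionally on the past and $w_n$. **Theorem.** There is an absolute constant $\gamma_0>0$ such that for all $\widetilde\gamma_1,\widetilde\gamma_2\ge\gamma_0$ the following holds in this setting for every $\delta\in(0,1)$ and $N\ge1$. With probability at least $1-3\delta/2$, $$\frac1N\sum_{n=1}^N\mathbb E_{w\sim q}\Big[V^{\pi^*_w}_{\mathcal M(w)}-V^{\pi^n_w}_{\mathcal M(w)}\Big]\le 912\,CH^2\sqrt{\frac{d^3K}{N}}\log\Big(1+\frac{N}{\widetilde\lambda d}\Big)+\frac{H^2}{C}\sqrt{\frac{K}{dN}}\Big(2\widetilde\xi_Nd+C^2\log\frac{2HN|\Psi_3|}{\delta}+4\widetilde\lambda_Nd+8C^2\log\frac{2HN|\Psi_2|}{\delta}\Big),$$ where $\widetilde\lambda=\min\{\widetilde\lambda_1,\widetilde\xi_1\}$ and all the expectations over $w$ exist. Moreover there is a constant $c>0$ depending only on $\widetilde\gamma_1,\widetilde\gamma_2$ such that, for every $\varepsilon>0$, with $X=\frac{H^4d^3K}{\varepsilon^2}\cdot\frac{p_{\max}}{p_{\min}}$,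 the average sub-optimality gap on the left is less than $\varepsilon$ with probability at least $1-3\delta/2$ as soon as $$N\ \ge\ c\,X\,\Big(\log\frac{|\Psi_2||\Psi_3|}{\delta^2}+\log(2+X)\Big)^2;$$ that is, $O\big(\frac{H^4d^3K\log^2(|\Psi_2||\Psi_3|/\delta^2)}{\varepsilon^2}\cdot\frac{p_{\max}}{p_{\min}}\big)$ episodes suffice, up to factors logarithmic in $X$. -/

import Mathlib

noncomputable section

open MeasureTheory ProbabilityTheory

namespace ContextualMDP

/-- The Euclidean space `ℝ^d`. -/
abbrev Vec (d : ℕ) : Type := EuclideanSpace ℝ (Fin d)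

/-- A (Markov, randomized, nonstationary) policy over the horizon `H`. The steps `1, …, H` are
indexed by `Fin H`, that is by `0, …, H - 1`. -/
structure Policy (S A : Type*) [MeasurableSpace S] [MeasurableSpace A] (H : ℕ) where
  act : Fin H → Kernel S A
  markov : ∀ h, IsMarkovKernel (act h)

/-- For every context `w`, the function `s' ↦ ⟨f(s,a), m(s',w)⟩` is a probability density with
respect to the reference measure `ν` on states, for all `(s,a)`. -/
structure IsTransitionWeight {S W A : Type*} [MeasurableSpace S] [MeasurableSpace W] {d : ℕ}
    (ν : Measure S) (f : S → A → Vec d) (m : S → W → Vec d) : Prop where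
  measurable : Measurable fun x : S × W => m x.1 x.2
  nonneg : ∀ s a s' w, 0 ≤ inner ℝ (f s a) (m s' w)
  lintegral_eq_one : ∀ s a w, ∫⁻ s', ENNReal.ofReal (inner ℝ (f s a) (m s' w)) ∂ν = 1

/-- A contextual MDP with common features and context-varying linear weights. The measure `ν` is
the reference measure `ds` on the state space. -/
structure LinearCMDP (S W A : Type*) [MeasurableSpace S] [MeasurableSpace W] [MeasurableSpace A]
    (ν : Measure S) (H d : ℕ) where
  /-- the fixed initial state -/
  s₁ : S
  /-- transition features -/
  φ : Fin H → S → A → Vec d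
  /-- transition weights -/
  μ : Fin H → S → W → Vec d
  /-- reward features -/
  ψ : Fin H → S → A → Vec d
  /-- reward weights -/
  η : Fin H → W → Vec d
  measurable_φ : ∀ h, Measurable fun x : S × A => φ h x.1 x.2
  measurable_ψ : ∀ h, Measurable fun x : S × A => ψ h x.1 x.2
  measurable_η : ∀ h, Measurable (η h)
  transition : ∀ h, IsTransitionWeight ν (φ h) (μ h)
  reward_mem : ∀ h s a w, inner ℝ (ψ h s a) (η h w) ∈ Set.Icc (0 : ℝ) 1
  norm_φ_le : ∀ h s a, ‖φ h s a‖ ≤ 1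
  norm_ψ_le : ∀ h s a, ‖ψ h s a‖ ≤ 1
  integrable_μ : ∀ h w, Integrable (fun s => μ h s w) ν
  norm_integral_μ_le : ∀ h w (g : S → ℝ), Measurable g → (∀ s, g s ∈ Set.Icc (0 : ℝ) 1) →
    ‖∫ s, g s • μ h s w ∂ν‖ ≤ √d
  norm_η_le : ∀ h w, ‖η h w‖ ≤ √d

section Model

variable {S W A : Type*} [MeasurableSpace S] [MeasurableSpace W] [MeasurableSpace A]
  {ν : Measure S} {H d : ℕ}

/-- The deterministic reward `r_h(s,a,w)`. -/
def LinearCMDP.reward (M : LinearCMDP S W A ν H d) (h : Fin H) (s : S) (a : A) (w : W) : ℝ :=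
  inner ℝ (M.ψ h s a) (M.η h w)

/-- The transition kernel `P_h(· | s,a,w)` of the context `w`. -/
def LinearCMDP.trans [SigmaFinite ν] (M : LinearCMDP S W A ν H d) (w : W) (h : Fin H) :
    Kernel (S × A) S :=
  Kernel.withDensity (Kernel.const (S × A) ν)
    fun x s' => ENNReal.ofReal (inner ℝ (M.φ h x.1 x.2) (M.μ h s' w))

/-- The law of the state reached in the MDP of context `w` under the policy `π`: index `0` is the
initial state, and index `j` is the state after `j` transitions. -/
def LinearCMDP.stateLaw [SigmaFinite ν] (M : LinearCMDP S W A ν H d) (w : W) (π : Policy S A H) :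
    Fin (H + 1) → Measure S :=
  Fin.induction (Measure.dirac M.s₁) fun h m => (m ⊗ₘ π.act h).bind (M.trans w h)

/-- The value `V^π_{M(w)}` of the policy `π` in the MDP of context `w`, from the initial state. -/
def LinearCMDP.value [SigmaFinite ν] (M : LinearCMDP S W A ν H d) (w : W) (π : Policy S A H) : ℝ :=
  ∑ h : Fin H, ∫ x, M.reward h x.1 x.2 w ∂(M.stateLaw w π h.castSucc ⊗ₘ π.act h)

/-- The optimal value of the MDP of context `w`. -/
def LinearCMDP.optValue [SigmaFinite ν] (M : LinearCMDP S W A ν H d) (w : W) : ℝ :=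
  ⨆ π : Policy S A H, M.value w π

/-- For every context, every policy and every step after the first one, the state has a density
with values in `[pmin, pmax]`. (At the first step the state is the fixed initial one.) -/
def LinearCMDP.BoundedStateDensity [SigmaFinite ν] (M : LinearCMDP S W A ν H d)
    (pmin pmax : ℝ) : Prop :=
  ∀ (w : W) (π : Policy S A H) (h : Fin H), 0 < (h : ℕ) →
    ∃ p : S → ℝ, Measurable p ∧ (∀ s, p s ∈ Set.Icc pmin pmax) ∧
      M.stateLaw w π h.castSucc = ν.withDensity fun s => ENNReal.ofReal (p s)

/-- Realizable finite model classes: the true weights at every step belong to them, and every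
member of the first class defines transition kernels. -/
structure LinearCMDP.Realizable (M : LinearCMDP S W A ν H d)
    (Ψ₂ : Finset (S → W → Vec d)) (Ψ₃ : Finset (W → Vec d)) : Prop where
  μ_mem : ∀ h, M.μ h ∈ Ψ₂
  η_mem : ∀ h, M.η h ∈ Ψ₃
  transition : ∀ m ∈ Ψ₂, ∀ h, IsTransitionWeight ν (M.φ h) m
  measurable : ∀ e ∈ Ψ₃, Measurable e

/-- The law of the tuple `((s_h, a_h), s_{h+1})` obtained in the MDP of context `w` by rolling into
`s_h` with the policy `π` and then taking a uniformly distributed action. -/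
def LinearCMDP.rollout [SigmaFinite ν] (M : LinearCMDP S W A ν H d) (w : W) (π : Policy S A H)
    (h : Fin H) : Measure ((S × A) × S) :=
  ((M.stateLaw w π h.castSucc).prod (uniformOn (Set.univ : Set A))) ⊗ₘ M.trans w h

end Model

/-- The data of one episode: its context and, for every step `h`, the tuple
`((s_h, a_h), s_{h+1})`. The observed reward is the function `r_h(s_h, a_h, w)` of it. -/
abbrev Episode (S W A : Type*) (H : ℕ) : Type _ := W × (Fin H → (S × A) × S)

/-- The data of `n` episodes. -/
abbrev Hist (S W A : Type*) (H n : ℕ) : Type _ := Fin n → Episode S W A H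

/-- The regularizer `γ d log (2 n H / δ)`. -/
def regularizer (γ δ : ℝ) (d H n : ℕ) : ℝ := γ * d * Real.log (2 * n * H / δ)

/-- The regularized Gram matrix of the features `f` at the observed state-action pairs. -/
def gram {S A : Type*} {d n : ℕ} (f : S → A → Vec d) (x : Fin n → S × A) (lam : ℝ) :
    Matrix (Fin d) (Fin d) ℝ :=
  (∑ τ, Matrix.vecMulVec (f (x τ).1 (x τ).2).ofLp (f (x τ).1 (x τ).2).ofLp) +
    lam • (1 : Matrix (Fin d) (Fin d) ℝ)

/-- The squared norm `‖v‖²` with respect to the inverse of the matrix `G`. -/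
def sqNormInv {d : ℕ} (G : Matrix (Fin d) (Fin d) ℝ) (v : Vec d) : ℝ :=
  v.ofLp ⬝ᵥ (G⁻¹.mulVec v.ofLp)

section Algorithm

variable {S W A : Type*} [MeasurableSpace S] [MeasurableSpace W] [MeasurableSpace A]
  {ν : Measure S} {H d : ℕ}

/-- The log-likelihood of the weights `m` at step `h` on the data `D`, with `log 0 = -∞`. -/
def LinearCMDP.logLikelihood (M : LinearCMDP S W A ν H d) {n : ℕ} (D : Hist S W A H n)
    (h : Fin H) (m : S → W → Vec d) : EReal :=
  ∑ τ, ENNReal.log (ENNReal.ofReal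
    (inner ℝ (M.φ h ((D τ).2 h).1.1 ((D τ).2 h).1.2) (m ((D τ).2 h).2 (D τ).1)))

/-- The squared loss of the reward weights `e` at step `h` on the data `D`. -/
def LinearCMDP.squaredLoss (M : LinearCMDP S W A ν H d) {n : ℕ} (D : Hist S W A H n)
    (h : Fin H) (e : W → Vec d) : ℝ :=
  ∑ τ, (inner ℝ (M.ψ h ((D τ).2 h).1.1 ((D τ).2 h).1.2) (e (D τ).1) -
    M.reward h ((D τ).2 h).1.1 ((D τ).2 h).1.2 (D τ).1) ^ 2

/-- The bonus for the transition estimate, in an episode preceded by `n` episodes with data `D`;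
`N` is the total number of episodes. -/
def LinearCMDP.bonusTrans [Fintype A] (M : LinearCMDP S W A ν H d) (C γ₁ δ : ℝ) (N : ℕ) {n : ℕ}
    (D : Hist S W A H n) (h : Fin H) (s : S) (a : A) : ℝ :=
  min (25 / (2 * √(Fintype.card A)) * C * H * √(d * N) *
    sqNormInv (gram (M.φ h) (fun τ => ((D τ).2 h).1) (regularizer γ₁ δ d H (n + 1))) (M.φ h s a)) H

/-- The bonus for the reward estimate, in an episode preceded by `n` episodes with data `D`. -/
def LinearCMDP.bonusReward [Fintype A] (M : LinearCMDP S W A ν H d) (C γ₂ δ : ℝ) (N : ℕ) {n : ℕ}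
    (D : Hist S W A H n) (h : Fin H) (s : S) (a : A) : ℝ :=
  min (25 / (2 * √(Fintype.card A)) * C * √(d * N) *
    sqNormInv (gram (M.ψ h) (fun τ => ((D τ).2 h).1) (regularizer γ₂ δ d H (n + 1))) (M.ψ h s a)) 1

/-- The optimistic reward at the context `w`: the reward predicted by the estimated weights `e`,
truncated to `[0,1]`, plus the two bonuses. -/
def LinearCMDP.optimisticReward [Fintype A] (M : LinearCMDP S W A ν H d) (C γ₁ γ₂ δ : ℝ) (N : ℕ)
    {n : ℕ} (D : Hist S W A H n) (e : Fin H → W → Vec d) (w : W) (h : Fin H) (s : S) (a : A) : ℝ :=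
  max 0 (min 1 (inner ℝ (e h w) (M.ψ h s a))) + M.bonusTrans C γ₁ δ N D h s a +
    M.bonusReward C γ₂ δ N D h s a

/-- The value functions, truncated at `3H`, of the policy `π` for the reward `r` and the transition
densities `⟨φ_h(s,a), m_h(s',w)⟩`, by backward recursion; index `0` is the first step and the last
index `H` is the step after the horizon. -/
def LinearCMDP.truncValue (M : LinearCMDP S W A ν H d) (m : Fin H → S → W → Vec d)
    (r : Fin H → S → A → ℝ) (w : W) (π : Policy S A H) : Fin (H + 1) → S → ℝ :=
  Fin.reverseInduction (motive := fun _ => S → ℝ) (fun _ => 0) fun h V s =>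
    ∫ a, min (3 * (H : ℝ))
      (r h s a + ∫ s', V s' * inner ℝ (M.φ h s a) (m h s' w) ∂ν) ∂(π.act h s)

/-- An instance of the learning algorithm, run for `N` episodes: in the episode that follows the
data `D` of `n` episodes it estimates the weights by maximum likelihood and by least squares over
the model classes, and its policy for each context maximizes the truncated value function of the
estimated optimistic model. The policy of the first episode (`n = 0`) and the choice among several
maximizers are arbitrary. -/
structure Algorithm [Fintype A] (M : LinearCMDP S W A ν H d) (Ψ₂ : Finset (S → W → Vec d))
    (Ψ₃ : Finset (W → Vec d)) (C γ₁ γ₂ δ : ℝ) (N : ℕ) where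
  estTrans : ∀ n, Hist S W A H n → Fin H → S → W → Vec d
  estReward : ∀ n, Hist S W A H n → Fin H → W → Vec d
  policy : ∀ n, Hist S W A H n → W → Policy S A H
  measurable_policy : ∀ n h (a : A),
    Measurable fun x : Hist S W A H n × W × S => (policy n x.1 x.2.1).act h x.2.2 {a}
  estTrans_mem : ∀ n D h, 0 < n → n < N → estTrans n D h ∈ Ψ₂
  estTrans_max : ∀ n D h, 0 < n → n < N → ∀ m ∈ Ψ₂,
    M.logLikelihood D h m ≤ M.logLikelihood D h (estTrans n D h)
  estReward_mem : ∀ n D h, 0 < n → n < N → estReward n D h ∈ Ψ₃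
  estReward_min : ∀ n D h, 0 < n → n < N → ∀ e ∈ Ψ₃,
    M.squaredLoss D h (estReward n D h) ≤ M.squaredLoss D h e
  policy_max : ∀ n D w, 0 < n → n < N → ∀ π : Policy S A H,
    M.truncValue (estTrans n D)
        (M.optimisticReward C γ₁ γ₂ δ N D (estReward n D) w) w π 0 M.s₁ ≤
      M.truncValue (estTrans n D)
        (M.optimisticReward C γ₁ γ₂ δ N D (estReward n D) w) w (policy n D w) 0 M.s₁

/-- The data of the first `n` episodes, as a function of the random outcome. -/
def history {Ω : Type*} (ctx : ℕ → Ω → W) (smp : ℕ → Fin H → Ω → (S × A) × S) (n : ℕ) (ω : Ω) :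
    Hist S W A H n :=
  fun τ => (ctx τ ω, fun h => smp τ h ω)

/-- `ctx` and `smp` are the random contexts and tuples in a run of the algorithm: conditionally on
the data of the previous episodes, the context of an episode has law `q`; conditionally on these
data and on the context, the tuple collected for step `h` has the law of the rollout with the
current policy. The joint law, over `h`, of the rollouts within one episode is left free. -/
structure Algorithm.IsRun [Fintype A] [SigmaFinite ν] {M : LinearCMDP S W A ν H d}
    {Ψ₂ : Finset (S → W → Vec d)} {Ψ₃ : Finset (W → Vec d)} {C γ₁ γ₂ δ : ℝ} {N : ℕ}
    (alg : Algorithm M Ψ₂ Ψ₃ C γ₁ γ₂ δ N) (q : Measure W) {Ω : Type*} [MeasurableSpace Ω]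
    (Pr : Measure Ω) (ctx : ℕ → Ω → W) (smp : ℕ → Fin H → Ω → (S × A) × S) : Prop where
  measurable_ctx : ∀ n, Measurable (ctx n)
  measurable_smp : ∀ n h, Measurable (smp n h)
  law : ∀ n < N, ∀ (h : Fin H) (f : Hist S W A H n × W × ((S × A) × S) → ENNReal), Measurable f →
    ∫⁻ ω, f (history ctx smp n ω, ctx n ω, smp n h ω) ∂Pr =
      ∫⁻ ω, ∫⁻ w, ∫⁻ x, f (history ctx smp n ω, w, x)
        ∂(M.rollout w (alg.policy n (history ctx smp n ω) w) h) ∂q ∂Pr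

/-- The average, over the `N` episodes, of the expected sub-optimality gap of the policies that the
algorithm computes from the random data. -/
def Algorithm.avgGap [Fintype A] [SigmaFinite ν] {M : LinearCMDP S W A ν H d}
    {Ψ₂ : Finset (S → W → Vec d)} {Ψ₃ : Finset (W → Vec d)} {C γ₁ γ₂ δ : ℝ} {N : ℕ}
    (alg : Algorithm M Ψ₂ Ψ₃ C γ₁ γ₂ δ N) (q : Measure W) {Ω : Type*}
    (ctx : ℕ → Ω → W) (smp : ℕ → Fin H → Ω → (S × A) × S) (ω : Ω) : ℝ :=
  1 / (N : ℝ) * ∑ n ∈ Finset.range N,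
    ∫ w, (M.optValue w - M.value w (alg.policy n (history ctx smp n ω) w)) ∂q

end Algorithm

/-- The bound on the average sub-optimality gap; `k₂` and `k₃` are the sizes of the two model
classes and `K` is the number of actions. -/
def gapBound (C γ₁ γ₂ δ : ℝ) (H d K N k₂ k₃ : ℕ) : ℝ :=
  912 * C * (H : ℝ) ^ 2 * √((d : ℝ) ^ 3 * K / N) *
      Real.log (1 + N / (min (regularizer γ₁ δ d H 1) (regularizer γ₂ δ d H 1) * d)) +
    (H : ℝ) ^ 2 / C * √(K / (d * N)) *
      (2 * regularizer γ₂ δ d H N * d + C ^ 2 * Real.log (2 * H * N * k₃ / δ) +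
        4 * regularizer γ₁ δ d H N * d + 8 * C ^ 2 * Real.log (2 * H * N * k₂ / δ))

/-- The leading factor `(H^4 d^3 K / ε^2) (pmax / pmin)` of the number of episodes. -/
def episodeScale (pmin pmax ε : ℝ) (H d K : ℕ) : ℝ :=
  (H : ℝ) ^ 4 * (d : ℝ) ^ 3 * K / ε ^ 2 * (pmax / pmin)

end ContextualMDP

end

noncomputable section

open MeasureTheory ProbabilityTheory
open scoped ENNReal

set_option linter.unusedSectionVars false

/-! Write `C² = pmax / pmin` and `K` for the number of actions. The gap of an episode is controlled
by a simulation argument, a change of measure and three applications of one exponential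
supermartingale inequality.

Simulation. The played policy maximizes the truncated value of the estimated model. The true value
of any policy is at most its truncated optimistic value plus its expected model errors
(`toGo_le_truncToGo_add`), and the truncated value is at most the true value plus model errors and
bonuses (`truncToGo_le_toGo_add`). So the gap is at most the model errors under the optimal policy,
plus the model errors and the bonuses under the played one. The bonuses are not used to create
optimism: in the first inequality only their nonnegativity matters, and in the second one they are a
cost.

Change of measure. In a fixed context the density bounds make the state laws of any two policies
comparable up to the factor `C²`, and a uniform action costs a factor `K`. Hence an expected squared
error under any policy is at most `C² K / n` times its sum over the `n` past rollouts
(`lintegral_expect_le_average`). The inequality `x ≤ a x² / 2 + 1 / (2a)`, with `a` proportional to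
`√n`, turns this into an error of order `1 / √n`, and summation over the episodes gives order `√N`.

Concentration. If the conditional mean of `g + F` is at most one, then `∏ g · exp (∑ E[F | past])`
has mean at most one, and Markov's inequality bounds `∑ E[F | past]` wherever `∏ g` is bounded below
(`measure_expProcess_ge_le`). For the rewards, `F` is the squared error and `g = 1 - F`; the
observations are noiseless, so a least squares minimizer fits them exactly and `∏ g = 1`. For the
transitions, `g` is the square root of the likelihood ratio and `F` is one eighth of the squared
`L¹` distance, admissible by Hellinger's inequality; maximum likelihood gives `∏ g ≥ 1`. Union
bounds over the finite classes make both uniform. For the bonuses, `g = exp (-λ U)` and `F = λ U /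
2` with `U` the squared feature norm: expected norms are then bounded by realized ones, whose sum is
logarithmic by the elliptical potential lemma (`sum_sqNormInv_le`).

Arithmetic. If `N` is at most the smaller initial regularizer, the claimed bound exceeds the trivial
bound `H`; otherwise `d log (1 + N / (λ d)) ≥ 1/2` absorbs the terms without a logarithm. The count
of episodes follows by inverting the bound. -/

namespace ContextualMDP

/-! ### Transition kernels, state laws and the reward-to-go as extended nonnegative integrals -/

section Model

variable {S W A : Type*} [MeasurableSpace S] [MeasurableSpace W] [MeasurableSpace A]
  {ν : Measure S} {H d : ℕ}

/-- The transition density `⟨φ_h(s,a), m(s',w)⟩` of the weights `m`, as an extended nonnegative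
real. -/
def LinearCMDP.density (M : LinearCMDP S W A ν H d) (h : Fin H) (m : S → W → Vec d) (w : W)
    (s : S) (a : A) (s' : S) : ℝ≥0∞ :=
  ENNReal.ofReal (inner ℝ (M.φ h s a) (m s' w))

theorem LinearCMDP.measurable_density (M : LinearCMDP S W A ν H d) (h : Fin H)
    {m : S → W → Vec d} (hm : Measurable fun x : S × W => m x.1 x.2) :
    Measurable fun x : W × (S × A) × S => M.density h m x.1 x.2.1.1 x.2.1.2 x.2.2 := by
  have h1 : Measurable fun x : W × (S × A) × S => M.φ h x.2.1.1 x.2.1.2 :=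
    (M.measurable_φ h).comp (measurable_snd.fst)
  have h2 : Measurable fun x : W × (S × A) × S => m x.2.2 x.1 :=
    hm.comp (measurable_snd.snd.prodMk measurable_fst)
  exact (h1.inner h2).ennreal_ofReal

theorem LinearCMDP.measurable_density_right (M : LinearCMDP S W A ν H d) (h : Fin H)
    {m : S → W → Vec d} (hm : Measurable fun x : S × W => m x.1 x.2) (w : W) (s : S) (a : A) :
    Measurable (M.density h m w s a) :=
  ((M.measurable_density h hm).comp
    (measurable_const.prodMk (measurable_const.prodMk measurable_id) :
      Measurable fun s' : S => (w, (s, a), s')) :)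

theorem LinearCMDP.lintegral_density (M : LinearCMDP S W A ν H d) (h : Fin H)
    {m : S → W → Vec d} (hm : IsTransitionWeight ν (M.φ h) m) (w : W) (s : S) (a : A) :
    ∫⁻ s', M.density h m w s a s' ∂ν = 1 :=
  hm.lintegral_eq_one s a w

theorem LinearCMDP.reward_nonneg (M : LinearCMDP S W A ν H d) (h : Fin H) (s : S) (a : A) (w : W) :
    0 ≤ M.reward h s a w := (M.reward_mem h s a w).1

theorem LinearCMDP.reward_le_one (M : LinearCMDP S W A ν H d) (h : Fin H) (s : S) (a : A) (w : W) :
    M.reward h s a w ≤ 1 := (M.reward_mem h s a w).2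

theorem LinearCMDP.measurable_reward (M : LinearCMDP S W A ν H d) (h : Fin H) :
    Measurable fun x : W × (S × A) => M.reward h x.2.1 x.2.2 x.1 := by
  have h1 : Measurable fun x : W × (S × A) => M.ψ h x.2.1 x.2.2 :=
    (M.measurable_ψ h).comp measurable_snd
  have h2 : Measurable fun x : W × (S × A) => M.η h x.1 := (M.measurable_η h).comp measurable_fst
  exact h1.inner h2

variable [SigmaFinite ν]

theorem LinearCMDP.lintegral_trans (M : LinearCMDP S W A ν H d) (w : W) (h : Fin H) (x : S × A)
    {g : S → ℝ≥0∞} (hg : Measurable g) :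
    ∫⁻ s', g s' ∂(M.trans w h x) = ∫⁻ s', M.density h (M.μ h) w x.1 x.2 s' * g s' ∂ν := by
  have hm : Measurable (Function.uncurry fun (x : S × A) s' =>
      ENNReal.ofReal (inner ℝ (M.φ h x.1 x.2) (M.μ h s' w))) :=
    ((M.measurable_density h (M.transition h).measurable).comp
      (measurable_const.prodMk measurable_id : Measurable fun y : (S × A) × S => (w, y)) :)
  rw [LinearCMDP.trans, Kernel.lintegral_withDensity _ hm _ hg]
  rfl

instance LinearCMDP.isMarkovKernel_trans (M : LinearCMDP S W A ν H d) (w : W) (h : Fin H) :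
    IsMarkovKernel (M.trans w h) where
  isProbabilityMeasure x := by
    constructor
    have := M.lintegral_trans w h x (g := fun _ => 1) measurable_const
    simpa [M.lintegral_density h (M.transition h)] using this

theorem LinearCMDP.stateLaw_zero (M : LinearCMDP S W A ν H d) (w : W) (π : Policy S A H) :
    M.stateLaw w π 0 = Measure.dirac M.s₁ := rfl

theorem LinearCMDP.stateLaw_succ (M : LinearCMDP S W A ν H d) (w : W) (π : Policy S A H)
    (h : Fin H) :
    M.stateLaw w π h.succ = (M.stateLaw w π h.castSucc ⊗ₘ π.act h).bind (M.trans w h) := by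
  simp [LinearCMDP.stateLaw, Fin.induction_succ]

instance LinearCMDP.isProbabilityMeasure_stateLaw (M : LinearCMDP S W A ν H d) (w : W)
    (π : Policy S A H) (k : Fin (H + 1)) : IsProbabilityMeasure (M.stateLaw w π k) := by
  induction k using Fin.induction with
  | zero => rw [M.stateLaw_zero]; infer_instance
  | succ h ih =>
    have := π.markov h
    rw [M.stateLaw_succ]
    infer_instance

/-- The expectation over the action of the policy. -/
def Policy.expect [Fintype A] (π : Policy S A H) (h : Fin H) (s : S) (g : A → ℝ≥0∞) : ℝ≥0∞ :=
  ∑ a, g a * π.act h s {a}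

/-- The expectation over the next state for the weights `m`. -/
def LinearCMDP.nextExpect (M : LinearCMDP S W A ν H d) (h : Fin H) (m : S → W → Vec d) (w : W)
    (g : S → ℝ≥0∞) (s : S) (a : A) : ℝ≥0∞ :=
  ∫⁻ s', M.density h m w s a s' * g s' ∂ν

theorem LinearCMDP.measurable_nextExpect {Y : Type*} [MeasurableSpace Y]
    (M : LinearCMDP S W A ν H d) (h : Fin H) {m : S → W → Vec d}
    (hm : Measurable fun x : S × W => m x.1 x.2) {w : Y → W} (hw : Measurable w)
    {g : Y → S → ℝ≥0∞} (hg : Measurable fun x : Y × S => g x.1 x.2) :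
    Measurable fun x : Y × (S × A) => M.nextExpect h m (w x.1) (g x.1) x.2.1 x.2.2 := by
  have h1 : Measurable fun z : (Y × (S × A)) × S =>
      M.density h m (w z.1.1) z.1.2.1 z.1.2.2 z.2 * g z.1.1 z.2 := by
    refine Measurable.mul ?_ ?_
    · exact ((M.measurable_density h hm).comp
        ((hw.comp measurable_fst.fst).prodMk (measurable_fst.snd.prodMk measurable_snd) :
          Measurable fun z : (Y × (S × A)) × S => (w z.1.1, z.1.2, z.2)) :)
    · exact (hg.comp (measurable_fst.fst.prodMk measurable_snd :
        Measurable fun z : (Y × (S × A)) × S => (z.1.1, z.2)) :)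
  exact (Measurable.lintegral_prod_right' (ν := ν) h1 :)

variable [Fintype A] [MeasurableSingletonClass A]

theorem Policy.sum_act (π : Policy S A H) (h : Fin H) (s : S) : ∑ a, π.act h s {a} = 1 := by
  have := π.markov h
  simp

theorem Policy.act_le_one (π : Policy S A H) (h : Fin H) (s : S) (a : A) :
    π.act h s {a} ≤ 1 := by
  have := π.markov h
  exact prob_le_one

theorem Policy.expect_le_sum (π : Policy S A H) (h : Fin H) (s : S) (g : A → ℝ≥0∞) :
    π.expect h s g ≤ ∑ a, g a :=
  Finset.sum_le_sum fun a _ => mul_le_of_le_one_right zero_le (π.act_le_one h s a)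

theorem Policy.expect_mono (π : Policy S A H) (h : Fin H) (s : S) {f g : A → ℝ≥0∞}
    (hfg : ∀ a, f a ≤ g a) : π.expect h s f ≤ π.expect h s g :=
  Finset.sum_le_sum fun a _ => mul_le_mul_left (hfg a) _

theorem Policy.expect_add (π : Policy S A H) (h : Fin H) (s : S) (f g : A → ℝ≥0∞) :
    π.expect h s (fun a => f a + g a) = π.expect h s f + π.expect h s g := by
  simp [Policy.expect, add_mul, Finset.sum_add_distrib]

theorem Policy.expect_const (π : Policy S A H) (h : Fin H) (s : S) (c : ℝ≥0∞) :
    π.expect h s (fun _ => c) = c := by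
  simp [Policy.expect, ← Finset.mul_sum, π.sum_act]

theorem Policy.measurable_expect (π : Policy S A H) (h : Fin H) {g : S → A → ℝ≥0∞}
    (hg : ∀ a, Measurable fun s => g s a) : Measurable fun s => π.expect h s (g s) :=
  Finset.measurable_sum _ fun a _ =>
    (hg a).mul ((π.act h).measurable_coe (measurableSet_singleton a))

theorem LinearCMDP.lintegral_stateLaw_compProd (M : LinearCMDP S W A ν H d) (w : W)
    (π : Policy S A H) (h : Fin H) {g : S × A → ℝ≥0∞} (hg : Measurable g) :
    ∫⁻ x, g x ∂(M.stateLaw w π h.castSucc ⊗ₘ π.act h) =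
      ∫⁻ s, π.expect h s (fun a => g (s, a)) ∂(M.stateLaw w π h.castSucc) := by
  have := π.markov h
  rw [Measure.lintegral_compProd hg]
  simp only [lintegral_fintype, Policy.expect]

theorem LinearCMDP.lintegral_stateLaw_succ (M : LinearCMDP S W A ν H d) (w : W)
    (π : Policy S A H) (h : Fin H) {g : S → ℝ≥0∞} (hg : Measurable g) :
    ∫⁻ s, g s ∂(M.stateLaw w π h.succ) =
      ∫⁻ s, π.expect h s (M.nextExpect h (M.μ h) w g s) ∂(M.stateLaw w π h.castSucc) := by
  have hm : Measurable fun x : S × A => M.nextExpect h (M.μ h) w g x.1 x.2 :=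
    ((M.measurable_nextExpect h (M.transition h).measurable
      (measurable_const : Measurable fun _ : Unit => w) (g := fun _ => g)
      (hg.comp measurable_snd)).comp (measurable_const.prodMk measurable_id :
        Measurable fun x : S × A => ((), x)) :)
  rw [M.stateLaw_succ, Measure.lintegral_bind (M.trans w h).measurable.aemeasurable
    hg.aemeasurable]
  simp only [M.lintegral_trans w h _ hg]
  exact M.lintegral_stateLaw_compProd w π h hm

/-- The expectations over the state reached under a policy that depends measurably on a parameter
depend measurably on this parameter. -/
theorem LinearCMDP.measurable_lintegral_stateLaw {Y : Type*} [MeasurableSpace Y]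
    (M : LinearCMDP S W A ν H d) {w : Y → W} (hw : Measurable w) {π : Y → Policy S A H}
    (hπ : ∀ h a, Measurable fun x : Y × S => (π x.1).act h x.2 {a}) (k : Fin (H + 1)) :
    ∀ {g : Y → S → ℝ≥0∞}, (Measurable fun x : Y × S => g x.1 x.2) →
      Measurable fun y => ∫⁻ s, g y s ∂(M.stateLaw (w y) (π y) k) := by
  induction k using Fin.induction with
  | zero =>
    intro g hg
    have : ∀ y, Measurable (g y) := fun y => hg.comp measurable_prodMk_left
    simp only [M.stateLaw_zero, lintegral_dirac' _ (this _)]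
    exact hg.comp measurable_prodMk_right
  | succ h ih =>
    intro g hg
    have : ∀ y, Measurable (g y) := fun y => hg.comp measurable_prodMk_left
    simp only [M.lintegral_stateLaw_succ _ _ h (this _)]
    -- The integrand is quantified inside the induction: one transition is traded for the one-step
    -- expectation of `g` under the law at the preceding step.
    refine ih (g := fun y s => (π y).expect h s (M.nextExpect h (M.μ h) (w y) (g y) s)) ?_
    refine Finset.measurable_sum _ fun a _ => Measurable.mul ?_ (hπ h a)
    exact ((M.measurable_nextExpect h (M.transition h).measurable hw hg).comp
      (measurable_fst.prodMk (measurable_snd.prodMk measurable_const) :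
        Measurable fun x : Y × S => (x.1, (x.2, a))) :)

/-- The total expected reward of the policy `π` for the nonnegative reward functions `g`. -/
def LinearCMDP.total (M : LinearCMDP S W A ν H d) (w : W) (π : Policy S A H)
    (g : Fin H → S → A → ℝ≥0∞) : ℝ≥0∞ :=
  ∑ h : Fin H, ∫⁻ s, π.expect h s (g h s) ∂(M.stateLaw w π h.castSucc)

/-- The reward-to-go of the policy `π` for the nonnegative reward functions `g`. -/
def LinearCMDP.toGo (M : LinearCMDP S W A ν H d) (w : W) (π : Policy S A H)
    (g : Fin H → S → A → ℝ≥0∞) : Fin (H + 1) → S → ℝ≥0∞ :=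
  Fin.reverseInduction (motive := fun _ => S → ℝ≥0∞) (fun _ => 0) fun h V s =>
    π.expect h s fun a => g h s a + M.nextExpect h (M.μ h) w V s a

theorem LinearCMDP.toGo_last (M : LinearCMDP S W A ν H d) (w : W) (π : Policy S A H)
    (g : Fin H → S → A → ℝ≥0∞) (s : S) : M.toGo w π g (Fin.last H) s = 0 := by
  simp [LinearCMDP.toGo]

theorem LinearCMDP.toGo_castSucc (M : LinearCMDP S W A ν H d) (w : W) (π : Policy S A H)
    (g : Fin H → S → A → ℝ≥0∞) (h : Fin H) (s : S) :
    M.toGo w π g h.castSucc s =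
      π.expect h s fun a => g h s a + M.nextExpect h (M.μ h) w (M.toGo w π g h.succ) s a := by
  simp [LinearCMDP.toGo]

theorem LinearCMDP.measurable_nextExpect_left (M : LinearCMDP S W A ν H d) (h : Fin H)
    {m : S → W → Vec d} (hm : Measurable fun x : S × W => m x.1 x.2) (w : W) {g : S → ℝ≥0∞}
    (hg : Measurable g) (a : A) : Measurable fun s => M.nextExpect h m w g s a :=
  ((M.measurable_nextExpect h hm (measurable_const : Measurable fun _ : Unit => w)
    (g := fun _ => g) (hg.comp measurable_snd)).comp
    (measurable_const.prodMk (measurable_id.prodMk measurable_const) :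
      Measurable fun s : S => ((), (s, a))) :)

theorem LinearCMDP.measurable_toGo (M : LinearCMDP S W A ν H d) (w : W) (π : Policy S A H)
    {g : Fin H → S → A → ℝ≥0∞} (hg : ∀ h a, Measurable fun s => g h s a) (k : Fin (H + 1)) :
    Measurable (M.toGo w π g k) := by
  induction k using Fin.reverseInduction with
  | last => simpa only [funext (M.toGo_last w π g)] using measurable_const
  | cast h ih =>
    simp only [funext (M.toGo_castSucc w π g h)]
    exact π.measurable_expect h fun a =>
      (hg h a).add (M.measurable_nextExpect_left h (M.transition h).measurable w ih a)

/-- Telescoping written with sums only, because subtraction in `ℝ≥0∞` is truncated. -/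
theorem sum_add_last_of_telescope {H : ℕ} (a : Fin (H + 1) → ℝ≥0∞) (u : Fin H → ℝ≥0∞)
    (hau : ∀ h : Fin H, a h.castSucc = u h + a h.succ) : a 0 = ∑ h, u h + a (Fin.last H) := by
  induction H with
  | zero => simp
  | succ H ih =>
    have h1 := ih (fun k => a k.succ) (fun h => u h.succ) (fun h => hau h.succ)
    rw [Fin.sum_univ_succ]
    exact (hau 0).trans ((congrArg (u 0 + ·) h1).trans (add_assoc _ _ _).symm)

/-- The total expected reward is the reward-to-go from the initial state. -/
theorem LinearCMDP.toGo_zero (M : LinearCMDP S W A ν H d) (w : W) (π : Policy S A H)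
    {g : Fin H → S → A → ℝ≥0∞} (hg : ∀ h a, Measurable fun s => g h s a) :
    M.toGo w π g 0 M.s₁ = M.total w π g := by
  have h1 := sum_add_last_of_telescope
    (fun k => ∫⁻ s, M.toGo w π g k s ∂(M.stateLaw w π k))
    (fun h => ∫⁻ s, π.expect h s (g h s) ∂(M.stateLaw w π h.castSucc)) (fun h => by
      simp only [M.toGo_castSucc, Policy.expect_add,
        M.lintegral_stateLaw_succ w π h (M.measurable_toGo w π hg h.succ)]
      exact lintegral_add_left (π.measurable_expect h (hg h)) _)
  simpa [LinearCMDP.total, M.stateLaw_zero, lintegral_dirac' _ (M.measurable_toGo w π hg 0),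
    M.toGo_last] using h1

/-- The reward as an extended nonnegative real. -/
def LinearCMDP.ereward (M : LinearCMDP S W A ν H d) (w : W) (h : Fin H) (s : S) (a : A) : ℝ≥0∞ :=
  ENNReal.ofReal (M.reward h s a w)

theorem LinearCMDP.ereward_le_one (M : LinearCMDP S W A ν H d) (w : W) (h : Fin H) (s : S)
    (a : A) : M.ereward w h s a ≤ 1 := by
  simpa [LinearCMDP.ereward] using M.reward_le_one h s a w

theorem LinearCMDP.measurable_ereward (M : LinearCMDP S W A ν H d) (w : W) (h : Fin H) (a : A) :
    Measurable fun s => M.ereward w h s a :=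
  ((M.measurable_reward h).comp (measurable_const.prodMk (measurable_id.prodMk measurable_const) :
    Measurable fun s : S => (w, (s, a)))).ennreal_ofReal

theorem LinearCMDP.value_nonneg (M : LinearCMDP S W A ν H d) (w : W) (π : Policy S A H) :
    0 ≤ M.value w π :=
  Finset.sum_nonneg fun _ _ => integral_nonneg fun _ => M.reward_nonneg _ _ _ _

theorem LinearCMDP.ofReal_value (M : LinearCMDP S W A ν H d) (w : W) (π : Policy S A H) :
    ENNReal.ofReal (M.value w π) = M.total w π (M.ereward w) := by
  rw [LinearCMDP.value, ENNReal.ofReal_sum_of_nonneg fun _ _ =>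
    integral_nonneg fun _ => M.reward_nonneg _ _ _ _]
  refine Finset.sum_congr rfl fun h _ => ?_
  have := π.markov h
  have hm : Measurable fun x : S × A => M.reward h x.1 x.2 w :=
    (M.measurable_reward h).comp (measurable_const.prodMk measurable_id :
      Measurable fun x : S × A => (w, x))
  have hintegr : Integrable (fun x : S × A => M.reward h x.1 x.2 w)
      (M.stateLaw w π h.castSucc ⊗ₘ π.act h) :=
    Integrable.of_bound hm.aestronglyMeasurable 1 (Filter.Eventually.of_forall fun x => by
      rw [Real.norm_of_nonneg (M.reward_nonneg _ _ _ _)]; exact M.reward_le_one _ _ _ _)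
  rw [ofReal_integral_eq_lintegral_ofReal hintegr
    (Filter.Eventually.of_forall fun x => M.reward_nonneg _ _ _ _),
    M.lintegral_stateLaw_compProd w π h hm.ennreal_ofReal]
  rfl

theorem LinearCMDP.nextExpect_mono (M : LinearCMDP S W A ν H d) (h : Fin H) (m : S → W → Vec d)
    (w : W) {f g : S → ℝ≥0∞} (hfg : ∀ s, f s ≤ g s) (s : S) (a : A) :
    M.nextExpect h m w f s a ≤ M.nextExpect h m w g s a :=
  lintegral_mono fun s' => mul_le_mul_right (hfg s') _

theorem LinearCMDP.nextExpect_const (M : LinearCMDP S W A ν H d) (h : Fin H) {m : S → W → Vec d}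
    (hm : IsTransitionWeight ν (M.φ h) m) (w : W) (c : ℝ≥0∞) (s : S) (a : A) :
    M.nextExpect h m w (fun _ => c) s a = c := by
  rw [LinearCMDP.nextExpect,
    lintegral_mul_const _ (M.measurable_density_right h hm.measurable w s a),
    M.lintegral_density h hm, one_mul]

theorem LinearCMDP.nextExpect_add (M : LinearCMDP S W A ν H d) (h : Fin H) {m : S → W → Vec d}
    (hm : IsTransitionWeight ν (M.φ h) m) (w : W) {f : S → ℝ≥0∞} (hf : Measurable f)
    (g : S → ℝ≥0∞) (s : S) (a : A) :
    M.nextExpect h m w (fun s => f s + g s) s a =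
      M.nextExpect h m w f s a + M.nextExpect h m w g s a := by
  simp only [LinearCMDP.nextExpect, mul_add]
  exact lintegral_add_left ((M.measurable_density_right h hm.measurable w s a).mul hf) _

/-- The reward-to-go of rewards bounded by one is at most the number of remaining steps. -/
theorem LinearCMDP.toGo_le (M : LinearCMDP S W A ν H d) (w : W) (π : Policy S A H)
    {g : Fin H → S → A → ℝ≥0∞} (hg : ∀ h s a, g h s a ≤ 1) (k : Fin (H + 1)) (s : S) :
    M.toGo w π g k s ≤ ((H - k : ℕ) : ℝ≥0∞) := by
  induction k using Fin.reverseInduction generalizing s with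
  | last => simp [M.toGo_last]
  | cast h ih =>
    rw [M.toGo_castSucc]
    have h2 : ((H - (h.castSucc : ℕ) : ℕ) : ℝ≥0∞) = 1 + ((H - (h.succ : ℕ) : ℕ) : ℝ≥0∞) := by
      have h3 : H - (h.castSucc : ℕ) = 1 + (H - (h.succ : ℕ)) := by
        have := h.isLt
        simp only [Fin.val_castSucc, Fin.val_succ]
        omega
      rw [h3, Nat.cast_add, Nat.cast_one]
    rw [h2, ← π.expect_const h s (1 + ((H - (h.succ : ℕ) : ℕ) : ℝ≥0∞))]
    refine π.expect_mono h s fun a => add_le_add (hg h s a) ?_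
    refine (M.nextExpect_mono h _ w ih s a).trans_eq ?_
    exact M.nextExpect_const h (M.transition h) w _ s a

theorem LinearCMDP.value_le (M : LinearCMDP S W A ν H d) (w : W) (π : Policy S A H) :
    M.value w π ≤ H := by
  have h1 := M.toGo_le w π (M.ereward_le_one w) 0 M.s₁
  rw [M.toGo_zero w π (M.measurable_ereward w), ← M.ofReal_value] at h1
  simpa using (ENNReal.ofReal_le_natCast).1 (by simpa using h1)

theorem LinearCMDP.bddAbove_value (M : LinearCMDP S W A ν H d) (w : W) :
    BddAbove (Set.range (M.value w)) :=
  ⟨H, by rintro _ ⟨π, rfl⟩; exact M.value_le w π⟩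

end Model

/-! ### Bellman recursion, attainment of the optimal value and its measurability in the context -/

section OptimalValue

variable {S W A : Type*} [MeasurableSpace S] [MeasurableSpace W] [MeasurableSpace A]
  {ν : Measure S} {H d : ℕ} [SigmaFinite ν] [Fintype A] [MeasurableSingletonClass A]

/-- Ties are broken by the least index in an enumeration of the finite set `A`; the set where a
given index is a maximizer is measurable, hence so is the least such index. -/
theorem exists_measurable_argmax [Nonempty A] {Q : S → A → ℝ≥0∞}
    (hQ : ∀ a, Measurable fun s => Q s a) :
    ∃ α : S → A, Measurable α ∧ ∀ s, Q s (α s) = ⨆ a, Q s a := by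
  classical
  obtain ⟨e, he⟩ := exists_surjective_nat A
  have hp : ∀ s, ∃ k, Q s (e k) = ⨆ a, Q s a := fun s => by
    obtain ⟨a, ha⟩ := exists_eq_ciSup_of_finite (f := Q s)
    obtain ⟨k, rfl⟩ := he a
    exact ⟨k, ha⟩
  refine ⟨fun s => e (Nat.find (hp s)), ?_, fun s => Nat.find_spec (hp s)⟩
  refine (measurable_from_nat : Measurable e).comp (measurable_find hp fun k => ?_)
  exact measurableSet_eq_fun (hQ _) (Measurable.iSup hQ)

/-- The optimal reward-to-go, by the Bellman recursion. -/
def LinearCMDP.optToGo (M : LinearCMDP S W A ν H d) (w : W) : Fin (H + 1) → S → ℝ≥0∞ :=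
  Fin.reverseInduction (motive := fun _ => S → ℝ≥0∞) (fun _ => 0) fun h V s =>
    ⨆ a, (M.ereward w h s a + M.nextExpect h (M.μ h) w V s a)

theorem LinearCMDP.optToGo_last (M : LinearCMDP S W A ν H d) (w : W) (s : S) :
    M.optToGo w (Fin.last H) s = 0 := by
  simp [LinearCMDP.optToGo]

theorem LinearCMDP.optToGo_castSucc (M : LinearCMDP S W A ν H d) (w : W) (h : Fin H) (s : S) :
    M.optToGo w h.castSucc s =
      ⨆ a, (M.ereward w h s a + M.nextExpect h (M.μ h) w (M.optToGo w h.succ) s a) := by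
  simp [LinearCMDP.optToGo]

theorem LinearCMDP.measurable_optToGo (M : LinearCMDP S W A ν H d) (k : Fin (H + 1)) :
    Measurable fun x : W × S => M.optToGo x.1 k x.2 := by
  induction k using Fin.reverseInduction with
  | last => simpa only [M.optToGo_last] using measurable_const
  | cast h ih =>
    simp only [M.optToGo_castSucc]
    refine Measurable.iSup fun a => ?_
    have hpair : Measurable fun x : W × S => (x.1, (x.2, a)) :=
      measurable_fst.prodMk (measurable_snd.prodMk measurable_const)
    exact (((M.measurable_reward h).comp hpair).ennreal_ofReal.add
      ((M.measurable_nextExpect h (M.transition h).measurable measurable_id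
        (g := fun w => M.optToGo w h.succ) ih).comp hpair) :)

theorem LinearCMDP.toGo_le_optToGo (M : LinearCMDP S W A ν H d) (w : W) (π : Policy S A H)
    (k : Fin (H + 1)) (s : S) : M.toGo w π (M.ereward w) k s ≤ M.optToGo w k s := by
  induction k using Fin.reverseInduction generalizing s with
  | last => simp [M.toGo_last]
  | cast h ih =>
    rw [M.toGo_castSucc, M.optToGo_castSucc]
    refine (π.expect_mono h s fun a => ?_).trans_eq (π.expect_const h s _)
    exact (add_le_add le_rfl (M.nextExpect_mono h _ w ih s a)).trans
      (le_iSup (fun a => M.ereward w h s a +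
        M.nextExpect h (M.μ h) w (M.optToGo w h.succ) s a) a)

/-- The deterministic policy that is greedy for the Bellman recursion attains every supremum in it.
This provides the comparison policy in the gap bound. -/
theorem LinearCMDP.exists_toGo_eq_optToGo [Nonempty A] (M : LinearCMDP S W A ν H d) (w : W) :
    ∃ π : Policy S A H, ∀ k s, M.toGo w π (M.ereward w) k s = M.optToGo w k s := by
  have hQ : ∀ (h : Fin H) (a : A), Measurable fun s =>
      M.ereward w h s a + M.nextExpect h (M.μ h) w (M.optToGo w h.succ) s a := fun h a =>
    (M.measurable_ereward w h a).add (M.measurable_nextExpect_left h (M.transition h).measurable w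
      ((M.measurable_optToGo h.succ).comp measurable_prodMk_left) a)
  choose α hα hmax using fun h => exists_measurable_argmax (hQ h)
  let π : Policy S A H := ⟨fun h => Kernel.deterministic (α h) (hα h), fun h => inferInstance⟩
  have hπ : ∀ h s (g : A → ℝ≥0∞), π.expect h s g = g (α h s) := fun h s g => by
    have : Measurable g := measurable_of_finite g
    rw [Policy.expect, ← lintegral_fintype, Kernel.deterministic_apply, lintegral_dirac]
  refine ⟨π, fun k => ?_⟩
  induction k using Fin.reverseInduction with
  | last => simp [M.toGo_last, M.optToGo_last]
  | cast h ih =>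
    intro s
    rw [M.toGo_castSucc, M.optToGo_castSucc, hπ, funext ih, ← hmax]

/-- The optimal value is a supremum over an uncountable family of policies, from which measurability
in the context cannot be read off. The Bellman recursion involves only finite suprema and integrals,
so it is jointly measurable. -/
theorem LinearCMDP.ofReal_optValue [Nonempty A] (M : LinearCMDP S W A ν H d) (w : W) :
    ENNReal.ofReal (M.optValue w) = M.optToGo w 0 M.s₁ := by
  have hval : ∀ π, ENNReal.ofReal (M.value w π) = M.toGo w π (M.ereward w) 0 M.s₁ := fun π => by
    rw [M.ofReal_value, M.toGo_zero w π (M.measurable_ereward w)]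
  obtain ⟨π, hπ⟩ := M.exists_toGo_eq_optToGo w
  have : Nonempty (Policy S A H) := ⟨π⟩
  rw [← hπ, ← hval]
  congr 1
  refine le_antisymm (ciSup_le fun π' => ?_) (le_ciSup (M.bddAbove_value w) π)
  have := M.toGo_le_optToGo w π' 0 M.s₁
  rw [← hπ, ← hval, ← hval] at this
  exact (ENNReal.ofReal_le_ofReal_iff (M.value_nonneg w π)).1 this

theorem LinearCMDP.value_le_optValue (M : LinearCMDP S W A ν H d) (w : W) (π : Policy S A H) :
    M.value w π ≤ M.optValue w :=
  le_ciSup (M.bddAbove_value w) π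

theorem LinearCMDP.optValue_nonneg (M : LinearCMDP S W A ν H d) (w : W) :
    0 ≤ M.optValue w :=
  Real.iSup_nonneg fun π => M.value_nonneg w π

theorem LinearCMDP.optValue_le (M : LinearCMDP S W A ν H d) (w : W) : M.optValue w ≤ H :=
  Real.iSup_le (fun π => M.value_le w π) (Nat.cast_nonneg H)

theorem LinearCMDP.measurable_optValue [Nonempty A] (M : LinearCMDP S W A ν H d) :
    Measurable M.optValue := by
  have h1 : M.optValue = fun w => (M.optToGo w 0 M.s₁).toReal := funext fun w => by
    rw [← M.ofReal_optValue, ENNReal.toReal_ofReal (M.optValue_nonneg w)]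
  rw [h1]
  exact ((M.measurable_optToGo 0).comp measurable_prodMk_right).ennreal_toReal

theorem LinearCMDP.measurable_value (M : LinearCMDP S W A ν H d) {π : W → Policy S A H}
    (hπ : ∀ h a, Measurable fun x : W × S => (π x.1).act h x.2 {a}) :
    Measurable fun w => M.value w (π w) := by
  have h1 : (fun w => M.value w (π w)) = fun w => (M.total w (π w) (M.ereward w)).toReal :=
    funext fun w => by rw [← M.ofReal_value, ENNReal.toReal_ofReal (M.value_nonneg w _)]
  rw [h1]
  refine (Finset.measurable_sum _ fun h _ => ?_).ennreal_toReal
  refine M.measurable_lintegral_stateLaw measurable_id hπ h.castSucc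
    (g := fun w s => (π w).expect h s (M.ereward w h s)) ?_
  refine Finset.measurable_sum _ fun a _ => Measurable.mul ?_ (hπ h a)
  exact ((M.measurable_reward h).comp
    (measurable_fst.prodMk (measurable_snd.prodMk measurable_const) :
      Measurable fun x : W × S => (x.1, (x.2, a)))).ennreal_ofReal

theorem LinearCMDP.integrable_gap [Nonempty A] (M : LinearCMDP S W A ν H d) (q : Measure W)
    [IsFiniteMeasure q] {π : W → Policy S A H}
    (hπ : ∀ h a, Measurable fun x : W × S => (π x.1).act h x.2 {a}) :
    Integrable (fun w => M.optValue w - M.value w (π w)) q := by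
  refine Integrable.of_bound (M.measurable_optValue.sub
    (M.measurable_value hπ)).aestronglyMeasurable H (Filter.Eventually.of_forall fun w => ?_)
  rw [Real.norm_of_nonneg (sub_nonneg.2 (M.value_le_optValue w _))]
  linarith [M.optValue_le w, M.value_nonneg w (π w)]

end OptimalValue

/-! ### Comparison of the truncated optimistic model with the true one -/

section Simulation

variable {S W A : Type*} [MeasurableSpace S] [MeasurableSpace W] [MeasurableSpace A]
  {ν : Measure S} {H d : ℕ} [SigmaFinite ν] [Fintype A] [MeasurableSingletonClass A]

/-- The truncated value functions as extended nonnegative reals. -/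
def LinearCMDP.truncToGo (M : LinearCMDP S W A ν H d) (m : Fin H → S → W → Vec d)
    (r : Fin H → S → A → ℝ) (w : W) (π : Policy S A H) : Fin (H + 1) → S → ℝ≥0∞ :=
  Fin.reverseInduction (motive := fun _ => S → ℝ≥0∞) (fun _ => 0) fun h V s =>
    π.expect h s fun a => min (3 * (H : ℝ≥0∞))
      (ENNReal.ofReal (r h s a) + M.nextExpect h (m h) w V s a)

theorem LinearCMDP.truncToGo_last (M : LinearCMDP S W A ν H d) (m : Fin H → S → W → Vec d)
    (r : Fin H → S → A → ℝ) (w : W) (π : Policy S A H) (s : S) :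
    M.truncToGo m r w π (Fin.last H) s = 0 := by
  simp [LinearCMDP.truncToGo]

theorem LinearCMDP.truncToGo_castSucc (M : LinearCMDP S W A ν H d) (m : Fin H → S → W → Vec d)
    (r : Fin H → S → A → ℝ) (w : W) (π : Policy S A H) (h : Fin H) (s : S) :
    M.truncToGo m r w π h.castSucc s =
      π.expect h s fun a => min (3 * (H : ℝ≥0∞))
        (ENNReal.ofReal (r h s a) + M.nextExpect h (m h) w (M.truncToGo m r w π h.succ) s a) := by
  simp [LinearCMDP.truncToGo]

theorem LinearCMDP.truncToGo_le (M : LinearCMDP S W A ν H d) (m : Fin H → S → W → Vec d)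
    (r : Fin H → S → A → ℝ) (w : W) (π : Policy S A H) (k : Fin (H + 1)) (s : S) :
    M.truncToGo m r w π k s ≤ 3 * (H : ℝ≥0∞) := by
  induction k using Fin.reverseInduction with
  | last => simp [M.truncToGo_last]
  | cast h ih =>
    rw [M.truncToGo_castSucc]
    exact (π.expect_mono h s fun a => min_le_left _ _).trans_eq (π.expect_const h s _)

theorem LinearCMDP.truncToGo_ne_top (M : LinearCMDP S W A ν H d) (m : Fin H → S → W → Vec d)
    (r : Fin H → S → A → ℝ) (w : W) (π : Policy S A H) (k : Fin (H + 1)) (s : S) :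
    M.truncToGo m r w π k s ≠ ∞ :=
  ne_top_of_le_ne_top (ENNReal.mul_ne_top (by simp) (by simp)) (M.truncToGo_le m r w π k s)

theorem LinearCMDP.measurable_truncToGo (M : LinearCMDP S W A ν H d)
    {m : Fin H → S → W → Vec d} (hm : ∀ h, IsTransitionWeight ν (M.φ h) (m h))
    {r : Fin H → S → A → ℝ} (hr : ∀ h a, Measurable fun s => r h s a) (w : W) (π : Policy S A H)
    (k : Fin (H + 1)) : Measurable (M.truncToGo m r w π k) := by
  induction k using Fin.reverseInduction with
  | last => simpa only [funext (M.truncToGo_last m r w π)] using measurable_const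
  | cast h ih =>
    simp only [funext (M.truncToGo_castSucc m r w π h)]
    exact π.measurable_expect h fun a => measurable_const.min
      ((hr h a).ennreal_ofReal.add (M.measurable_nextExpect_left h (hm h).measurable w ih a))

/-- The algorithm maximizes values defined by Bochner integrals, whereas the comparison is carried
out in `ℝ≥0∞`. The truncation at `3H` keeps every value finite, so that passing to real numbers
commutes with sums and minima. -/
theorem LinearCMDP.truncValue_eq_toReal (M : LinearCMDP S W A ν H d)
    {m : Fin H → S → W → Vec d} (hm : ∀ h, IsTransitionWeight ν (M.φ h) (m h))
    {r : Fin H → S → A → ℝ} (hr : ∀ h a, Measurable fun s => r h s a)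
    (hr0 : ∀ h s a, 0 ≤ r h s a) (w : W) (π : Policy S A H) (k : Fin (H + 1)) (s : S) :
    M.truncValue m r w π k s = (M.truncToGo m r w π k s).toReal := by
  induction k using Fin.reverseInduction generalizing s with
  | last => simp [M.truncToGo_last, LinearCMDP.truncValue]
  | cast h ih =>
    have := π.markov h
    have h3 : (3 * (H : ℝ≥0∞)) ≠ ∞ := ENNReal.mul_ne_top (by simp) (by simp)
    have hnext : ∀ a, ∫ s', M.truncValue m r w π h.succ s' *
        inner ℝ (M.φ h s a) (m h s' w) ∂ν =
        (M.nextExpect h (m h) w (M.truncToGo m r w π h.succ) s a).toReal := fun a => by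
      have hmeas : Measurable fun s' =>
          M.density h (m h) w s a s' * M.truncToGo m r w π h.succ s' :=
        (M.measurable_density_right h (hm h).measurable w s a).mul
          (M.measurable_truncToGo hm hr w π h.succ)
      rw [LinearCMDP.nextExpect, ← integral_toReal hmeas.aemeasurable
        (Filter.Eventually.of_forall fun s' => ENNReal.mul_lt_top ENNReal.ofReal_lt_top
          (M.truncToGo_ne_top m r w π h.succ s').lt_top)]
      refine integral_congr_ae (Filter.Eventually.of_forall fun s' => ?_)
      simp only [ih s', ENNReal.toReal_mul, LinearCMDP.density,
        ENNReal.toReal_ofReal ((hm h).nonneg s a s' w)]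
      ring
    have hfin : ∀ a, M.nextExpect h (m h) w (M.truncToGo m r w π h.succ) s a ≠ ∞ := fun a =>
      ne_top_of_le_ne_top h3 ((M.nextExpect_mono h (m h) w
        (M.truncToGo_le m r w π h.succ) s a).trans_eq (M.nextExpect_const h (hm h) w _ s a))
    have hstep : M.truncValue m r w π h.castSucc s = ∫ a, min (3 * (H : ℝ))
      (r h s a + ∫ s', M.truncValue m r w π h.succ s' * inner ℝ (M.φ h s a) (m h s' w) ∂ν)
        ∂(π.act h s) := by
      simp [LinearCMDP.truncValue]
    rw [hstep, M.truncToGo_castSucc, Policy.expect, integral_fintype .of_finite,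
      ENNReal.toReal_sum fun a _ => ENNReal.mul_ne_top
        (ne_top_of_le_ne_top h3 (min_le_left _ _)) (measure_ne_top _ _)]
    refine Finset.sum_congr rfl fun a _ => ?_
    rw [hnext, ENNReal.toReal_mul, ENNReal.toReal_min h3
      (ENNReal.add_ne_top.2 ⟨ENNReal.ofReal_ne_top, hfin a⟩),
      ENNReal.toReal_add ENNReal.ofReal_ne_top (hfin a), ENNReal.toReal_ofReal (hr0 h s a),
      smul_eq_mul, mul_comm]
    simp [Measure.real]

/-- The `L¹` distance between the estimated and the true transition densities. -/
def LinearCMDP.l1Dist (M : LinearCMDP S W A ν H d) (h : Fin H) (m : S → W → Vec d) (w : W)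
    (s : S) (a : A) : ℝ≥0∞ :=
  ∫⁻ s', (M.density h (M.μ h) w s a s' - M.density h m w s a s') +
    (M.density h m w s a s' - M.density h (M.μ h) w s a s') ∂ν

theorem LinearCMDP.measurable_l1Dist (M : LinearCMDP S W A ν H d) (h : Fin H)
    {m : S → W → Vec d} (hm : Measurable fun x : S × W => m x.1 x.2) :
    Measurable fun x : W × (S × A) => M.l1Dist h m x.1 x.2.1 x.2.2 := by
  have hassoc : Measurable fun z : (W × (S × A)) × S => (z.1.1, z.1.2, z.2) :=
    measurable_fst.fst.prodMk (measurable_fst.snd.prodMk measurable_snd)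
  have h1 := (M.measurable_density h hm).comp hassoc
  have h2 := (M.measurable_density h (M.transition h).measurable).comp hassoc
  exact (Measurable.lintegral_prod_right' (ν := ν) ((h2.sub h1).add (h1.sub h2)) :)

/-- Pointwise `p₁ ≤ p₂ + (p₁ - p₂)` with truncated subtraction, and the bound `g ≤ c` is applied to
the excess only. The two directions used below follow since each one-sided excess is part of the
`L¹` distance. -/
theorem LinearCMDP.nextExpect_le_add (M : LinearCMDP S W A ν H d) (h : Fin H)
    {m₁ m₂ : S → W → Vec d} (hm₁ : Measurable fun x : S × W => m₁ x.1 x.2)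
    (hm₂ : Measurable fun x : S × W => m₂ x.1 x.2) (w : W)
    {g : S → ℝ≥0∞} (hg : Measurable g) {c : ℝ≥0∞} (hc : ∀ s, g s ≤ c) (s : S) (a : A) :
    M.nextExpect h m₁ w g s a ≤ M.nextExpect h m₂ w g s a +
      c * ∫⁻ s', (M.density h m₁ w s a s' - M.density h m₂ w s a s') ∂ν := by
  have h1 := M.measurable_density_right h hm₁ w s a
  have h2 := M.measurable_density_right h hm₂ w s a
  have h3 : Measurable fun s' => M.density h m₁ w s a s' - M.density h m₂ w s a s' := h1.sub h2
  have h4 : Measurable fun s' => M.density h m₂ w s a s' * g s' := h2.mul hg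
  rw [← lintegral_const_mul _ h3, LinearCMDP.nextExpect, LinearCMDP.nextExpect,
    ← lintegral_add_left h4]
  refine lintegral_mono fun s' => ?_
  calc M.density h m₁ w s a s' * g s'
      ≤ (M.density h m₂ w s a s' + (M.density h m₁ w s a s' - M.density h m₂ w s a s')) * g s' :=
        mul_le_mul_left le_add_tsub _
    _ ≤ _ := by
        rw [add_mul, mul_comm c]
        exact add_le_add le_rfl (mul_le_mul_right (hc s') _)

theorem LinearCMDP.nextExpect_true_le (M : LinearCMDP S W A ν H d) (h : Fin H)
    {m : S → W → Vec d} (hm : Measurable fun x : S × W => m x.1 x.2) (w : W)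
    {g : S → ℝ≥0∞} (hg : Measurable g) {c : ℝ≥0∞} (hc : ∀ s, g s ≤ c) (s : S) (a : A) :
    M.nextExpect h (M.μ h) w g s a ≤ M.nextExpect h m w g s a + c * M.l1Dist h m w s a :=
  (M.nextExpect_le_add h (M.transition h).measurable hm w hg hc s a).trans
    (add_le_add le_rfl (mul_le_mul_right (lintegral_mono fun _ => le_self_add) _))

theorem LinearCMDP.nextExpect_le_true (M : LinearCMDP S W A ν H d) (h : Fin H)
    {m : S → W → Vec d} (hm : Measurable fun x : S × W => m x.1 x.2) (w : W)
    {g : S → ℝ≥0∞} (hg : Measurable g) {c : ℝ≥0∞} (hc : ∀ s, g s ≤ c) (s : S) (a : A) :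
    M.nextExpect h m w g s a ≤ M.nextExpect h (M.μ h) w g s a + c * M.l1Dist h m w s a :=
  (M.nextExpect_le_add h hm (M.transition h).measurable w hg hc s a).trans
    (add_le_add le_rfl (mul_le_mul_right (lintegral_mono fun _ => le_add_self) _))

/-- The one-step error of the estimated model with transition weights `m` and rewards `r`. -/
def LinearCMDP.stepError (M : LinearCMDP S W A ν H d) (m : Fin H → S → W → Vec d)
    (r : Fin H → S → A → ℝ) (w : W) (h : Fin H) (s : S) (a : A) : ℝ≥0∞ :=
  ENNReal.ofReal |M.reward h s a w - r h s a| + 3 * (H : ℝ≥0∞) * M.l1Dist h (m h) w s a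

theorem LinearCMDP.measurable_stepError (M : LinearCMDP S W A ν H d)
    {m : Fin H → S → W → Vec d} (hm : ∀ h, IsTransitionWeight ν (M.φ h) (m h))
    {r : Fin H → S → A → ℝ} (hr : ∀ h a, Measurable fun s => r h s a) (w : W) (h : Fin H)
    (a : A) : Measurable fun s => M.stepError m r w h s a := by
  have hpair : Measurable fun s : S => (w, (s, a)) :=
    measurable_const.prodMk (measurable_id.prodMk measurable_const)
  have h1 : Measurable fun s => M.reward h s a w := ((M.measurable_reward h).comp hpair :)
  have h2 : Measurable fun s => |M.reward h s a w - r h s a| := (h1.sub (hr h a)).abs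
  have h3 : Measurable fun s => M.l1Dist h (m h) w s a :=
    ((M.measurable_l1Dist h (hm h).measurable).comp hpair :)
  exact h2.ennreal_ofReal.add (h3.const_mul _)

/-- The true value is at most the truncated optimistic one plus the errors of the model. -/
theorem LinearCMDP.toGo_le_truncToGo_add (M : LinearCMDP S W A ν H d)
    {m : Fin H → S → W → Vec d} (hm : ∀ h, IsTransitionWeight ν (M.φ h) (m h))
    {r β : Fin H → S → A → ℝ} (hr : ∀ h a, Measurable fun s => r h s a)
    (hβ : ∀ h a, Measurable fun s => β h s a)
    (hr0 : ∀ h s a, 0 ≤ r h s a) (hβ0 : ∀ h s a, 0 ≤ β h s a) (w : W) (π : Policy S A H)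
    (k : Fin (H + 1)) (s : S) :
    M.toGo w π (M.ereward w) k s ≤ M.truncToGo m (fun h s a => r h s a + β h s a) w π k s +
      M.toGo w π (M.stepError m r w) k s := by
  have hrβ : ∀ (h : Fin H) (a : A), Measurable fun s => r h s a + β h s a :=
    fun h a => (hr h a).add (hβ h a)
  induction k using Fin.reverseInduction generalizing s with
  | last => simp [M.toGo_last]
  | cast h ih =>
    set T := M.truncToGo m (fun h s a => r h s a + β h s a) w π h.succ with hT
    have hTm : Measurable T := M.measurable_truncToGo hm hrβ w π h.succ
    rw [M.toGo_castSucc, M.truncToGo_castSucc, M.toGo_castSucc, ← Policy.expect_add]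
    refine π.expect_mono h s fun a => ?_
    -- This covers the case of an active truncation: the true reward-to-go is at most the number of
    -- remaining steps, which is below `3H`, and no error needs to be paid.
    have hA : M.ereward w h s a + M.nextExpect h (M.μ h) w (M.toGo w π (M.ereward w) h.succ) s a
        ≤ 3 * (H : ℝ≥0∞) := by
      have h1 : M.nextExpect h (M.μ h) w (M.toGo w π (M.ereward w) h.succ) s a ≤
          ((H - (h.succ : ℕ) : ℕ) : ℝ≥0∞) :=
        (M.nextExpect_mono h _ w (M.toGo_le w π (M.ereward_le_one w) h.succ) s a).trans_eq
          (M.nextExpect_const h (M.transition h) w _ s a)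
      refine (add_le_add (M.ereward_le_one w h s a) h1).trans ?_
      have h2 : 1 + (H - (h.succ : ℕ)) ≤ 3 * H := by
        have := h.isLt
        simp only [Fin.val_succ]
        omega
      exact_mod_cast h2
    -- Without truncation, one step pays the reward error and the `L¹` error times `3H`. The
    -- induction hypothesis is applied under the true transition, so the later errors stay weighted
    -- by the true state law; only the truncated value is moved to the estimated transition.
    have hB : M.ereward w h s a + M.nextExpect h (M.μ h) w (M.toGo w π (M.ereward w) h.succ) s a
        ≤ (ENNReal.ofReal (r h s a + β h s a) + M.nextExpect h (m h) w T s a) +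
          (M.stepError m r w h s a +
            M.nextExpect h (M.μ h) w (M.toGo w π (M.stepError m r w) h.succ) s a) := by
      have h1 : M.ereward w h s a ≤ ENNReal.ofReal (r h s a + β h s a) +
          ENNReal.ofReal |M.reward h s a w - r h s a| := by
        rw [← ENNReal.ofReal_add (add_nonneg (hr0 h s a) (hβ0 h s a)) (abs_nonneg _)]
        refine ENNReal.ofReal_le_ofReal ?_
        linarith [le_abs_self (M.reward h s a w - r h s a), hβ0 h s a]
      have h2 := (M.nextExpect_mono h (M.μ h) w ih s a).trans_eq
        (M.nextExpect_add h (M.transition h) w hTm _ s a)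
      have h3 := M.nextExpect_true_le h (hm h).measurable w hTm
        (M.truncToGo_le m (fun h s a => r h s a + β h s a) w π h.succ) s a
      refine (add_le_add h1 (h2.trans (add_le_add h3 le_rfl))).trans_eq ?_
      rw [LinearCMDP.stepError]
      ring
    rcases min_choice (3 * (H : ℝ≥0∞)) (ENNReal.ofReal (r h s a + β h s a) +
      M.nextExpect h (m h) w T s a) with h1 | h1
    · rw [h1]
      exact hA.trans le_self_add
    · rw [h1]
      exact hB

/-- The truncated optimistic value is at most the true one plus the errors of the model and the
bonuses. -/
theorem LinearCMDP.truncToGo_le_toGo_add (M : LinearCMDP S W A ν H d)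
    {m : Fin H → S → W → Vec d} (hm : ∀ h, IsTransitionWeight ν (M.φ h) (m h))
    {r β : Fin H → S → A → ℝ} (hr : ∀ h a, Measurable fun s => r h s a)
    (hβ : ∀ h a, Measurable fun s => β h s a)
    (hβ0 : ∀ h s a, 0 ≤ β h s a) (w : W) (π : Policy S A H)
    (k : Fin (H + 1)) (s : S) :
    M.truncToGo m (fun h s a => r h s a + β h s a) w π k s ≤ M.toGo w π (M.ereward w) k s +
      M.toGo w π (fun h s a => M.stepError m r w h s a + ENNReal.ofReal (β h s a)) k s := by
  have hrβ : ∀ (h : Fin H) (a : A), Measurable fun s => r h s a + β h s a :=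
    fun h a => (hr h a).add (hβ h a)
  induction k using Fin.reverseInduction generalizing s with
  | last => simp [M.truncToGo_last]
  | cast h ih =>
    set T := M.truncToGo m (fun h s a => r h s a + β h s a) w π h.succ with hT
    have hTm : Measurable T := M.measurable_truncToGo hm hrβ w π h.succ
    rw [M.toGo_castSucc, M.truncToGo_castSucc, M.toGo_castSucc, ← Policy.expect_add]
    -- In this direction the truncation is dropped from the recursion, but it still provides the
    -- bound `3H` used in `h3`. The estimated transition is replaced by the true one before the
    -- induction hypothesis is applied, so the errors again propagate under the true law.
    refine π.expect_mono h s fun a => (min_le_right _ _).trans ?_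
    have h1 : ENNReal.ofReal (r h s a + β h s a) ≤ M.ereward w h s a +
        ENNReal.ofReal |M.reward h s a w - r h s a| + ENNReal.ofReal (β h s a) := by
      rw [LinearCMDP.ereward, ← ENNReal.ofReal_add (M.reward_nonneg h s a w) (abs_nonneg _),
        ← ENNReal.ofReal_add (add_nonneg (M.reward_nonneg h s a w) (abs_nonneg _)) (hβ0 h s a)]
      refine ENNReal.ofReal_le_ofReal ?_
      linarith [neg_abs_le (M.reward h s a w - r h s a), hβ0 h s a]
    have h2 := (M.nextExpect_mono h (M.μ h) w ih s a).trans_eq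
      (M.nextExpect_add h (M.transition h) w
        (M.measurable_toGo w π (M.measurable_ereward w) h.succ) _ s a)
    have h3 := M.nextExpect_le_true h (hm h).measurable w hTm
      (M.truncToGo_le m (fun h s a => r h s a + β h s a) w π h.succ) s a
    refine (add_le_add h1 (h3.trans (add_le_add h2 le_rfl))).trans_eq ?_
    rw [LinearCMDP.stepError]
    ring

/-- A policy that is better than `π` in the optimistic truncated model is not much worse than `π`
in the true one. -/
theorem LinearCMDP.value_le_of_truncValue_le (M : LinearCMDP S W A ν H d)
    {m : Fin H → S → W → Vec d} (hm : ∀ h, IsTransitionWeight ν (M.φ h) (m h))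
    {r β : Fin H → S → A → ℝ} (hr : ∀ h a, Measurable fun s => r h s a)
    (hβ : ∀ h a, Measurable fun s => β h s a)
    (hr0 : ∀ h s a, 0 ≤ r h s a) (hβ0 : ∀ h s a, 0 ≤ β h s a) (w : W) {π π' : Policy S A H}
    (hππ' : M.truncValue m (fun h s a => r h s a + β h s a) w π 0 M.s₁ ≤
      M.truncValue m (fun h s a => r h s a + β h s a) w π' 0 M.s₁) :
    ENNReal.ofReal (M.value w π) ≤ ENNReal.ofReal (M.value w π') +
      (M.total w π (M.stepError m r w) +
        M.total w π' fun h s a => M.stepError m r w h s a + ENNReal.ofReal (β h s a)) := by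
  have hrβ : ∀ (h : Fin H) (a : A), Measurable fun s => r h s a + β h s a :=
    fun h a => (hr h a).add (hβ h a)
  have hrβ0 : ∀ h s a, 0 ≤ r h s a + β h s a := fun h s a => add_nonneg (hr0 h s a) (hβ0 h s a)
  rw [M.truncValue_eq_toReal hm hrβ hrβ0, M.truncValue_eq_toReal hm hrβ hrβ0,
    ENNReal.toReal_le_toReal (M.truncToGo_ne_top _ _ _ _ _ _) (M.truncToGo_ne_top _ _ _ _ _ _)]
    at hππ'
  have he := M.measurable_stepError hm hr w
  have h1 := M.toGo_le_truncToGo_add hm hr hβ hr0 hβ0 w π 0 M.s₁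
  have h2 := M.truncToGo_le_toGo_add hm hr hβ hβ0 w π' 0 M.s₁
  rw [M.toGo_zero w π (M.measurable_ereward w), M.toGo_zero w π he, ← M.ofReal_value] at h1
  rw [M.toGo_zero w π' (M.measurable_ereward w), M.toGo_zero w π'
    (g := fun h s a => M.stepError m r w h s a + ENNReal.ofReal (β h s a))
    (fun h a => (he h a).add (hβ h a).ennreal_ofReal), ← M.ofReal_value] at h2
  refine (h1.trans (add_le_add (hππ'.trans h2) le_rfl)).trans_eq ?_
  ring

end Simulation

/-! ### Change of measure between policies -/

section Coverage

variable {S W A : Type*} [MeasurableSpace S] [MeasurableSpace W] [MeasurableSpace A]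
  {ν : Measure S} {H d : ℕ} [SigmaFinite ν] [Fintype A] [MeasurableSingletonClass A]

theorem lintegral_uniformOn_univ (g : A → ℝ≥0∞) :
    ∫⁻ a, g a ∂(uniformOn (Set.univ : Set A)) = (Fintype.card A : ℝ≥0∞)⁻¹ * ∑ a, g a := by
  rw [lintegral_fintype, Finset.mul_sum]
  refine Finset.sum_congr rfl fun a _ => ?_
  rw [uniformOn_univ, Measure.count_singleton, mul_comm, one_div]

variable [Nonempty A]

theorem LinearCMDP.lintegral_rollout (M : LinearCMDP S W A ν H d) (w : W) (π : Policy S A H)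
    (h : Fin H) {g : (S × A) × S → ℝ≥0∞} (hg : Measurable g) :
    ∫⁻ x, g x ∂(M.rollout w π h) = ∫⁻ s, (Fintype.card A : ℝ≥0∞)⁻¹ * ∑ a, ∫⁻ s',
      M.density h (M.μ h) w s a s' * g ((s, a), s') ∂ν ∂(M.stateLaw w π h.castSucc) := by
  have : IsProbabilityMeasure (uniformOn (Set.univ : Set A)) :=
    isProbabilityMeasure_uniformOn Set.finite_univ Set.univ_nonempty
  have hm : Measurable fun x : S × A => ∫⁻ s', g (x, s') ∂(M.trans w h x) :=
    hg.lintegral_kernel_prod_right'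
  rw [LinearCMDP.rollout, Measure.lintegral_compProd hg, lintegral_prod _ hm.aemeasurable]
  simp only [lintegral_uniformOn_univ]
  refine lintegral_congr fun s => ?_
  congr 1
  refine Finset.sum_congr rfl fun a _ => ?_
  rw [M.lintegral_trans w h (s, a) (g := fun s' => g ((s, a), s'))
    (hg.comp measurable_prodMk_left)]

theorem LinearCMDP.lintegral_rollout_fst (M : LinearCMDP S W A ν H d) (w : W) (π : Policy S A H)
    (h : Fin H) {g : S × A → ℝ≥0∞} (hg : Measurable g) :
    ∫⁻ x, g x.1 ∂(M.rollout w π h) =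
      ∫⁻ s, (Fintype.card A : ℝ≥0∞)⁻¹ * ∑ a, g (s, a) ∂(M.stateLaw w π h.castSucc) := by
  rw [M.lintegral_rollout w π h (g := fun x => g x.1) (hg.comp measurable_fst)]
  refine lintegral_congr fun s => ?_
  congr 1
  refine Finset.sum_congr rfl fun a _ => ?_
  dsimp only
  rw [lintegral_mul_const _ (M.measurable_density_right h (M.transition h).measurable w s a),
    M.lintegral_density h (M.transition h), one_mul]

theorem LinearCMDP.measurable_lintegral_rollout {Y : Type*} [MeasurableSpace Y]
    (M : LinearCMDP S W A ν H d) {w : Y → W} (hw : Measurable w) {π : Y → Policy S A H}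
    (hπ : ∀ h a, Measurable fun x : Y × S => (π x.1).act h x.2 {a}) (h : Fin H)
    {g : Y → (S × A) × S → ℝ≥0∞} (hg : Measurable fun x : Y × (S × A) × S => g x.1 x.2) :
    Measurable fun y => ∫⁻ x, g y x ∂(M.rollout (w y) (π y) h) := by
  have : ∀ y, Measurable (g y) := fun y => hg.comp measurable_prodMk_left
  simp only [M.lintegral_rollout _ _ h (this _)]
  refine M.measurable_lintegral_stateLaw hw hπ h.castSucc (g := fun y s =>
    (Fintype.card A : ℝ≥0∞)⁻¹ * ∑ a, ∫⁻ s',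
      M.density h (M.μ h) (w y) s a s' * g y ((s, a), s') ∂ν) ?_
  refine Measurable.const_mul (Finset.measurable_sum _ fun a _ => ?_) _
  have h1 : Measurable fun z : (Y × S) × S =>
      M.density h (M.μ h) (w z.1.1) z.1.2 a z.2 * g z.1.1 ((z.1.2, a), z.2) := by
    have hm := (M.measurable_density h (M.transition h).measurable).comp
      ((hw.comp measurable_fst.fst).prodMk
        ((measurable_fst.snd.prodMk measurable_const).prodMk measurable_snd) :
        Measurable fun z : (Y × S) × S => (w z.1.1, (z.1.2, a), z.2))
    have hm' := hg.comp (measurable_fst.fst.prodMk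
        ((measurable_fst.snd.prodMk measurable_const).prodMk measurable_snd) :
        Measurable fun z : (Y × S) × S => (z.1.1, (z.1.2, a), z.2))
    exact (hm.mul hm' :)
  exact (Measurable.lintegral_prod_right' (ν := ν) h1 :)

theorem LinearCMDP.isProbabilityMeasure_rollout (M : LinearCMDP S W A ν H d) (w : W)
    (π : Policy S A H) (h : Fin H) : IsProbabilityMeasure (M.rollout w π h) := by
  have : IsProbabilityMeasure (uniformOn (Set.univ : Set A)) :=
    isProbabilityMeasure_uniformOn Set.finite_univ Set.univ_nonempty
  rw [LinearCMDP.rollout]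
  infer_instance

/-- Under the density bounds, the state laws of any two policies dominate each other. -/
theorem LinearCMDP.BoundedStateDensity.lintegral_stateLaw_le {M : LinearCMDP S W A ν H d}
    {pmin pmax : ℝ} (hM : M.BoundedStateDensity pmin pmax) (hmin : 0 < pmin)
    (hle : pmin ≤ pmax) (w : W) (π π' : Policy S A H) (h : Fin H) {g : S → ℝ≥0∞}
    (hg : Measurable g) :
    ∫⁻ s, g s ∂(M.stateLaw w π h.castSucc) ≤
      ENNReal.ofReal (pmax / pmin) * ∫⁻ s, g s ∂(M.stateLaw w π' h.castSucc) := by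
  -- At the first step the density assumption says nothing, but both laws are the Dirac mass at the
  -- initial state and the ratio of the bounds is at least one.
  rcases Nat.eq_zero_or_pos (h : ℕ) with h0 | h0
  · have h1 : h.castSucc = 0 := Fin.ext h0
    rw [h1, M.stateLaw_zero, M.stateLaw_zero]
    refine le_mul_of_one_le_left zero_le ?_
    rw [ENNReal.one_le_ofReal]
    exact (one_le_div hmin).2 hle
  · obtain ⟨p, hp, hpm, hpe⟩ := hM w π h h0
    obtain ⟨p', hp', hpm', hpe'⟩ := hM w π' h h0
    rw [hpe, hpe', lintegral_withDensity_eq_lintegral_mul _ hp.ennreal_ofReal hg,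
      lintegral_withDensity_eq_lintegral_mul _ hp'.ennreal_ofReal hg,
      ← lintegral_const_mul _ (hp'.ennreal_ofReal.mul hg)]
    refine lintegral_mono fun s => ?_
    simp only [Pi.mul_apply]
    rw [← mul_assoc, ← ENNReal.ofReal_mul (div_nonneg (hmin.le.trans hle) hmin.le)]
    refine mul_le_mul_left (ENNReal.ofReal_le_ofReal ?_) _
    calc p s ≤ pmax := (hpm s).2
      _ = pmax / pmin * pmin := by field_simp
      _ ≤ pmax / pmin * p' s :=
        mul_le_mul_of_nonneg_left (hpm' s).1 (div_nonneg (hmin.le.trans hle) hmin.le)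

/-- An action probability is at most one, which is `K` times the uniform probability. The states on
both sides follow the same policy, so no density ratio is lost. This version serves the bonuses,
which are charged only along the policy being played. -/
theorem LinearCMDP.lintegral_expect_le_rollout (M : LinearCMDP S W A ν H d) (w : W)
    (π : Policy S A H) (h : Fin H) {g : S × A → ℝ≥0∞} (hg : Measurable g) :
    ∫⁻ s, π.expect h s (fun a => g (s, a)) ∂(M.stateLaw w π h.castSucc) ≤
      (Fintype.card A : ℝ≥0∞) * ∫⁻ x, g x.1 ∂(M.rollout w π h) := by
  have hm : Measurable fun s => ∑ a, g (s, a) :=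
    Finset.measurable_sum _ fun a _ => hg.comp measurable_prodMk_right
  rw [M.lintegral_rollout_fst w π h hg, lintegral_const_mul _ hm, ← mul_assoc,
    ENNReal.mul_inv_cancel (by simp) (by simp), one_mul]
  exact lintegral_mono fun s => π.expect_le_sum h s _

/-- Under the density bounds, the expectation of a nonnegative function under any policy is at most
`(pmax / pmin) K` times its expectation in a rollout with any other policy. -/
theorem LinearCMDP.BoundedStateDensity.lintegral_expect_le {M : LinearCMDP S W A ν H d}
    {pmin pmax : ℝ} (hM : M.BoundedStateDensity pmin pmax) (hmin : 0 < pmin)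
    (hle : pmin ≤ pmax) (w : W) (π π' : Policy S A H) (h : Fin H) {g : S × A → ℝ≥0∞}
    (hg : Measurable g) :
    ∫⁻ s, π.expect h s (fun a => g (s, a)) ∂(M.stateLaw w π h.castSucc) ≤
      ENNReal.ofReal (pmax / pmin) * (Fintype.card A : ℝ≥0∞) *
        ∫⁻ x, g x.1 ∂(M.rollout w π' h) := by
  have hm : Measurable fun s => ∑ a, g (s, a) :=
    Finset.measurable_sum _ fun a _ => hg.comp measurable_prodMk_right
  have h1 : (Fintype.card A : ℝ≥0∞) * ∫⁻ x, g x.1 ∂(M.rollout w π' h) =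
      ∫⁻ s, ∑ a, g (s, a) ∂(M.stateLaw w π' h.castSucc) := by
    rw [M.lintegral_rollout_fst w π' h hg, lintegral_const_mul _ hm, ← mul_assoc,
      ENNReal.mul_inv_cancel (by simp) (by simp), one_mul]
  rw [mul_assoc, h1]
  exact (lintegral_mono fun s => π.expect_le_sum h s _).trans
    (hM.lintegral_stateLaw_le hmin hle w π π' h hm)

end Coverage

/-! ### Log-determinants and the elliptical potential lemma -/

section EllipticalPotential

open Matrix

variable {d : ℕ}

theorem posSemidef_vecMulVec_self (v : Fin d → ℝ) : (vecMulVec v v).PosSemidef := by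
  simpa using posSemidef_vecMulVec_self_star v

theorem posDef_smul_one {lam : ℝ} (hlam : 0 < lam) :
    (lam • (1 : Matrix (Fin d) (Fin d) ℝ)).PosDef :=
  PosDef.one.smul hlam

theorem sqNormInv_nonneg {G : Matrix (Fin d) (Fin d) ℝ} (hG : G.PosDef) (v : Vec d) :
    0 ≤ sqNormInv G v := by
  have := hG.inv.posSemidef.dotProduct_mulVec_nonneg v.ofLp
  simpa [sqNormInv] using this

/-- With `y = G⁻¹ v` and `z = G'⁻¹ v`, the difference `v·z - v·y` equals `(z - y)·G'(z - y) + y·(G -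
G')y`, a sum of two nonnegative terms. -/
theorem sqNormInv_antitone {G G' : Matrix (Fin d) (Fin d) ℝ} (hG : G.PosDef) (hG' : G'.PosDef)
    (hGG' : (G - G').PosSemidef) (v : Vec d) : sqNormInv G v ≤ sqNormInv G' v := by
  have hu : IsUnit G.det := hG.det_pos.ne'.isUnit
  have hu' : IsUnit G'.det := hG'.det_pos.ne'.isUnit
  set y := G⁻¹ *ᵥ v.ofLp with hy
  set z := G'⁻¹ *ᵥ v.ofLp with hz
  have hGy : G *ᵥ y = v.ofLp := by rw [hy, mulVec_mulVec, mul_nonsing_inv _ hu, one_mulVec]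
  have hGz : G' *ᵥ z = v.ofLp := by rw [hz, mulVec_mulVec, mul_nonsing_inv _ hu', one_mulVec]
  have h1 := hG'.posSemidef.dotProduct_mulVec_nonneg (z - y)
  have h2 := hGG'.dotProduct_mulVec_nonneg y
  have hsymm : z ⬝ᵥ G' *ᵥ y = v.ofLp ⬝ᵥ y := by
    rw [dotProduct_mulVec, ← mulVec_transpose]
    have : G'ᵀ = G' := by simpa using hG'.1.eq
    rw [this, hGz]
  simp only [star_trivial, mulVec_sub, sub_dotProduct, dotProduct_sub, sub_mulVec, hGz, hGy,
    hsymm] at h1 h2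
  change v.ofLp ⬝ᵥ y ≤ v.ofLp ⬝ᵥ z
  rw [dotProduct_comm z, dotProduct_comm y v.ofLp] at h1
  rw [dotProduct_comm y v.ofLp] at h2
  linarith

theorem sqNormInv_smul_one {lam : ℝ} (hlam : 0 < lam) (v : Vec d) :
    sqNormInv (lam • (1 : Matrix (Fin d) (Fin d) ℝ)) v = ‖v‖ ^ 2 / lam := by
  have h1 : (lam • (1 : Matrix (Fin d) (Fin d) ℝ))⁻¹ = lam⁻¹ • 1 := by
    apply inv_eq_left_inv
    simp [smul_smul, hlam.ne']
  rw [sqNormInv, h1, smul_mulVec, one_mulVec, dotProduct_smul, EuclideanSpace.real_norm_sq_eq,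
    dotProduct]
  simp [div_eq_inv_mul, sq]

theorem posDef_sum_add_smul_one {ι : Type*} (s : Finset ι) (x : ι → Vec d) {lam : ℝ}
    (hlam : 0 < lam) :
    ((∑ τ ∈ s, vecMulVec (x τ).ofLp (x τ).ofLp) +
      lam • (1 : Matrix (Fin d) (Fin d) ℝ)).PosDef :=
  (posDef_smul_one hlam).posSemidef_add
    (posSemidef_sum _ fun _ _ => posSemidef_vecMulVec_self _)

theorem sqNormInv_sum_add_smul_one_le {ι : Type*} (s : Finset ι) (x : ι → Vec d) {lam : ℝ}
    (hlam : 0 < lam) (v : Vec d) :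
    sqNormInv ((∑ τ ∈ s, vecMulVec (x τ).ofLp (x τ).ofLp) +
      lam • (1 : Matrix (Fin d) (Fin d) ℝ)) v ≤ ‖v‖ ^ 2 / lam := by
  rw [← sqNormInv_smul_one hlam]
  refine sqNormInv_antitone (posDef_sum_add_smul_one s x hlam) (posDef_smul_one hlam) ?_ v
  rw [add_sub_cancel_right]
  exact posSemidef_sum _ fun _ _ => posSemidef_vecMulVec_self _

/-- The matrix determinant lemma for a rank-one update; through it the squared norms become
increments of log-determinants. -/
theorem det_add_vecMulVec_self {G : Matrix (Fin d) (Fin d) ℝ} (hG : IsUnit G.det) (v : Vec d) :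
    (G + vecMulVec v.ofLp v.ofLp).det = G.det * (1 + sqNormInv G v) := by
  have h1 := det_add_replicateCol_mul_replicateRow (ι := Unit) hG v.ofLp v.ofLp
  rw [← vecMulVec_eq Unit] at h1
  rw [h1]
  congr 2
  rw [det_unique]
  simp [sqNormInv, Matrix.mul_assoc, Matrix.mul_apply, dotProduct, mulVec, Finset.mul_sum]

/-- The inequality of arithmetic and geometric means for the eigenvalues, obtained from the tangent
of the logarithm at `m`: `log x ≤ log m + x / m - 1`. -/
theorem log_det_le {G : Matrix (Fin d) (Fin d) ℝ} (hG : G.PosDef) {m : ℝ} (hm : 0 < m)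
    (htr : G.trace ≤ d * m) : Real.log G.det ≤ d * Real.log m := by
  have hpos := hG.eigenvalues_pos
  have hdet : G.det = ∏ i, hG.1.eigenvalues i := by
    simpa using hG.1.det_eq_prod_eigenvalues
  have htrace : G.trace = ∑ i, hG.1.eigenvalues i := by
    simpa using hG.1.trace_eq_sum_eigenvalues
  rw [hdet, Real.log_prod fun i _ => (hpos i).ne']
  have h1 : ∀ i, Real.log (hG.1.eigenvalues i) ≤
      Real.log m + (hG.1.eigenvalues i / m - 1) := fun i => by
    have := Real.log_le_sub_one_of_pos (div_pos (hpos i) hm)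
    rw [Real.log_div (hpos i).ne' hm.ne'] at this
    linarith
  refine (Finset.sum_le_sum fun i _ => h1 i).trans ?_
  rw [Finset.sum_add_distrib, Finset.sum_sub_distrib, ← Finset.sum_div, ← htrace]
  have : G.trace / m ≤ d := (div_le_iff₀ hm).2 htr
  simp
  linarith

/-- The elliptical potential lemma. -/
theorem sum_sqNormInv_le (hd : 0 < d) (x : ℕ → Vec d) (hx : ∀ n, ‖x n‖ ≤ 1) {lam : ℝ}
    (hlam : 1 ≤ lam) (N : ℕ) :
    ∑ n ∈ Finset.range N, sqNormInv ((∑ τ ∈ Finset.range n,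
      vecMulVec (x τ).ofLp (x τ).ofLp) + lam • (1 : Matrix (Fin d) (Fin d) ℝ)) (x n) ≤
      2 * d * Real.log (1 + N / (lam * d)) := by
  have hlam0 : 0 < lam := zero_lt_one.trans_le hlam
  have hd0 : (0 : ℝ) < d := Nat.cast_pos.2 hd
  set G : ℕ → Matrix (Fin d) (Fin d) ℝ := fun n => (∑ τ ∈ Finset.range n,
      vecMulVec (x τ).ofLp (x τ).ofLp) + lam • (1 : Matrix (Fin d) (Fin d) ℝ) with hGdef
  have hG : ∀ n, (G n).PosDef := fun n => posDef_sum_add_smul_one _ x hlam0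
  -- This is `x / 2 ≤ log (1 + x)` for `0 ≤ x ≤ 1`. The assumption `1 ≤ lam` is what makes the
  -- squared norm at most one.
  have hstep : ∀ n, sqNormInv (G n) (x n) ≤
      2 * (Real.log (G (n + 1)).det - Real.log (G n).det) := fun n => by
    have h0 := sqNormInv_nonneg (hG n) (x n)
    have h1 : sqNormInv (G n) (x n) ≤ 1 := by
      refine (sqNormInv_sum_add_smul_one_le _ x hlam0 (x n)).trans ?_
      rw [div_le_one hlam0]
      exact (pow_le_one₀ (norm_nonneg _) (hx n)).trans hlam
    have h2 : G (n + 1) = G n + vecMulVec (x n).ofLp (x n).ofLp := by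
      simp only [hGdef, Finset.sum_range_succ]
      abel
    rw [h2, det_add_vecMulVec_self (hG n).det_pos.ne'.isUnit,
      Real.log_mul (hG n).det_pos.ne' (by positivity)]
    have h3 := Real.one_sub_inv_le_log_of_pos (show 0 < 1 + sqNormInv (G n) (x n) by positivity)
    have h4 : sqNormInv (G n) (x n) / 2 ≤ 1 - (1 + sqNormInv (G n) (x n))⁻¹ := by
      have : 1 - (1 + sqNormInv (G n) (x n))⁻¹ =
          sqNormInv (G n) (x n) / (1 + sqNormInv (G n) (x n)) := by
        field_simp
        ring
      rw [this]
      exact div_le_div_of_nonneg_left h0 (by positivity) (by linarith)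
    linarith
  refine (Finset.sum_le_sum fun n _ => hstep n).trans ?_
  rw [← Finset.mul_sum, Finset.sum_range_sub (fun n => Real.log (G n).det)]
  have hG0 : Real.log (G 0).det = d * Real.log lam := by
    simp [hGdef]
  -- Each rank-one term has trace at most one, and `lam • 1` has trace `d * lam`.
  have htr : (G N).trace ≤ d * (lam + N / d) := by
    have h1 : ∀ τ, (vecMulVec (x τ).ofLp (x τ).ofLp).trace ≤ 1 := fun τ => by
      have : (vecMulVec (x τ).ofLp (x τ).ofLp).trace = ‖x τ‖ ^ 2 := by
        rw [EuclideanSpace.real_norm_sq_eq]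
        simp [trace, vecMulVec_apply, sq]
      rw [this]
      exact pow_le_one₀ (norm_nonneg _) (hx τ)
    have h2 := Finset.sum_le_sum (s := Finset.range N) fun τ _ => h1 τ
    simp only [hGdef, trace_add, trace_sum, trace_smul, trace_one, Fintype.card_fin]
    rw [mul_add, mul_div_cancel₀ _ hd0.ne']
    simp at h2
    simp
    linarith
  have hm : 0 < lam + N / d := by positivity
  have h1 := log_det_le (hG N) hm htr
  have h2 : Real.log (lam + N / d) = Real.log lam + Real.log (1 + N / (lam * d)) := by
    rw [← Real.log_mul hlam0.ne' (by positivity)]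
    congr 1
    field_simp
  rw [h2] at h1
  rw [hG0]
  nlinarith

/-- The inverse is the adjugate divided by the determinant, so its entries are measurable functions
of the entries of the matrix. -/
theorem measurable_sqNormInv {Y : Type*} [MeasurableSpace Y] {G : Y → Matrix (Fin d) (Fin d) ℝ}
    (hG : ∀ i j, Measurable fun y => G y i j) {v : Y → Vec d} (hv : Measurable v) :
    Measurable fun y => sqNormInv (G y) (v y) := by
  have hcoord : ∀ i, Measurable fun y => v y i := fun i =>
    (measurable_pi_apply i).comp ((WithLp.measurable_ofLp 2 _).comp hv)
  have hdet : ∀ B : Y → Matrix (Fin d) (Fin d) ℝ, (∀ i j, Measurable fun y => B y i j) →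
      Measurable fun y => (B y).det := fun B hB => by
    simp only [det_apply]
    refine Finset.measurable_sum _ fun σ _ => Measurable.const_smul ?_ _
    exact Finset.measurable_prod _ fun i _ => hB _ _
  have hinv : ∀ i j, Measurable fun y => (G y)⁻¹ i j := fun i j => by
    simp only [inv_def, Matrix.smul_apply, Ring.inverse_eq_inv', smul_eq_mul, adjugate_apply]
    refine (hdet G hG).inv.mul (hdet _ fun k l => ?_)
    by_cases hk : k = j
    · subst hk
      simp
    · simpa [updateRow_ne hk] using hG k l
  simp only [sqNormInv, dotProduct, mulVec]
  refine Finset.measurable_sum _ fun i _ => (hcoord i).mul ?_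
  exact Finset.measurable_sum _ fun j _ => (hinv i j).mul (hcoord j)

end EllipticalPotential

/-! ### The exponential supermartingale inequality along a run -/

section Concentration

variable {S W A : Type*} [MeasurableSpace S] [MeasurableSpace W] [MeasurableSpace A]
  {ν : Measure S} {H d : ℕ} [SigmaFinite ν] [Fintype A] [MeasurableSingletonClass A] [Nonempty A]
  {M : LinearCMDP S W A ν H d} {Ψ₂ : Finset (S → W → Vec d)} {Ψ₃ : Finset (W → Vec d)}
  {C γ₁ γ₂ δ : ℝ} {N : ℕ}

/-- The conditional expectation, given the data `D` of `n` episodes, of a function of the context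
and of the tuple for step `h` in the next episode. -/
def Algorithm.condMean (alg : Algorithm M Ψ₂ Ψ₃ C γ₁ γ₂ δ N) (q : Measure W) (h : Fin H) (n : ℕ)
    (D : Hist S W A H n) (F : W → (S × A) × S → ℝ≥0∞) : ℝ≥0∞ :=
  ∫⁻ w, ∫⁻ x, F w x ∂(M.rollout w (alg.policy n D w) h) ∂q

theorem Algorithm.measurable_policy_pair (alg : Algorithm M Ψ₂ Ψ₃ C γ₁ γ₂ δ N) (n : ℕ)
    (h : Fin H) (a : A) : Measurable fun x : (Hist S W A H n × W) × S =>
      (alg.policy n x.1.1 x.1.2).act h x.2 {a} :=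
  ((alg.measurable_policy n h a).comp
    (measurable_fst.fst.prodMk (measurable_fst.snd.prodMk measurable_snd) :
      Measurable fun x : (Hist S W A H n × W) × S => (x.1.1, x.1.2, x.2)) :)

theorem Algorithm.measurable_policy_context (alg : Algorithm M Ψ₂ Ψ₃ C γ₁ γ₂ δ N) (n : ℕ)
    (D : Hist S W A H n) (h : Fin H) (a : A) : Measurable fun x : W × S =>
      (alg.policy n D x.1).act h x.2 {a} :=
  ((alg.measurable_policy n h a).comp (measurable_const.prodMk measurable_id :
      Measurable fun x : W × S => (D, x)) :)

theorem Algorithm.measurable_lintegral_rollout (alg : Algorithm M Ψ₂ Ψ₃ C γ₁ γ₂ δ N) (n : ℕ)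
    (h : Fin H) {F : Hist S W A H n → W → (S × A) × S → ℝ≥0∞}
    (hF : Measurable fun x : (Hist S W A H n × W) × (S × A) × S => F x.1.1 x.1.2 x.2) :
    Measurable fun y : Hist S W A H n × W =>
      ∫⁻ x, F y.1 y.2 x ∂(M.rollout y.2 (alg.policy n y.1 y.2) h) :=
  M.measurable_lintegral_rollout (Y := Hist S W A H n × W) (w := Prod.snd) measurable_snd
    (π := fun y => alg.policy n y.1 y.2) (alg.measurable_policy_pair n) h
    (g := fun y => F y.1 y.2) hF

theorem Algorithm.measurable_lintegral_rollout_context (alg : Algorithm M Ψ₂ Ψ₃ C γ₁ γ₂ δ N)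
    (n : ℕ) (D : Hist S W A H n) (h : Fin H) {F : W → (S × A) × S → ℝ≥0∞}
    (hF : Measurable fun x : W × (S × A) × S => F x.1 x.2) :
    Measurable fun w => ∫⁻ x, F w x ∂(M.rollout w (alg.policy n D w) h) :=
  M.measurable_lintegral_rollout (w := id) measurable_id
    (π := alg.policy n D) (alg.measurable_policy_context n D) h hF

theorem Algorithm.measurable_condMean (alg : Algorithm M Ψ₂ Ψ₃ C γ₁ γ₂ δ N) (q : Measure W)
    [SFinite q] (h : Fin H) (n : ℕ) {F : Hist S W A H n → W → (S × A) × S → ℝ≥0∞}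
    (hF : Measurable fun x : (Hist S W A H n × W) × (S × A) × S => F x.1.1 x.1.2 x.2) :
    Measurable fun D => alg.condMean q h n D (F D) :=
  (Measurable.lintegral_prod_right' (ν := q) (alg.measurable_lintegral_rollout n h hF) :)

theorem Algorithm.condMean_add (alg : Algorithm M Ψ₂ Ψ₃ C γ₁ γ₂ δ N) (q : Measure W) (h : Fin H)
    (n : ℕ) (D : Hist S W A H n) {F : W → (S × A) × S → ℝ≥0∞}
    (hF : Measurable fun x : W × (S × A) × S => F x.1 x.2) (G : W → (S × A) × S → ℝ≥0∞) :
    alg.condMean q h n D (fun w x => F w x + G w x) =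
      alg.condMean q h n D F + alg.condMean q h n D G := by
  have hFw : ∀ w, Measurable (F w) := fun w => hF.comp measurable_prodMk_left
  simp only [Algorithm.condMean, lintegral_add_left (hFw _)]
  exact lintegral_add_left (alg.measurable_lintegral_rollout_context n D h hF) _

theorem Algorithm.condMean_const_mul (alg : Algorithm M Ψ₂ Ψ₃ C γ₁ γ₂ δ N) (q : Measure W)
    (h : Fin H) (n : ℕ) (D : Hist S W A H n) (c : ℝ≥0∞) {F : W → (S × A) × S → ℝ≥0∞}
    (hF : Measurable fun x : W × (S × A) × S => F x.1 x.2) :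
    alg.condMean q h n D (fun w x => c * F w x) = c * alg.condMean q h n D F := by
  have hFw : ∀ w, Measurable (F w) := fun w => hF.comp measurable_prodMk_left
  simp only [Algorithm.condMean, lintegral_const_mul c (hFw _)]
  exact lintegral_const_mul c (alg.measurable_lintegral_rollout_context n D h hF)

theorem Algorithm.condMean_le_one (alg : Algorithm M Ψ₂ Ψ₃ C γ₁ γ₂ δ N) (q : Measure W)
    [IsProbabilityMeasure q] (h : Fin H) (n : ℕ) (D : Hist S W A H n)
    {F : W → (S × A) × S → ℝ≥0∞} (hF : ∀ w x, F w x ≤ 1) : alg.condMean q h n D F ≤ 1 := by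
  have h1 : ∀ w, ∫⁻ x, F w x ∂(M.rollout w (alg.policy n D w) h) ≤ 1 := fun w => by
    have := M.isProbabilityMeasure_rollout w (alg.policy n D w) h
    exact (lintegral_mono (hF w)).trans (by simp)
  exact (lintegral_mono h1).trans (by simp)

/-- The exponential supermartingale built from the factors `g` and the compensators `F`, as a
function of the data. -/
def Algorithm.expProcess (alg : Algorithm M Ψ₂ Ψ₃ C γ₁ γ₂ δ N) (q : Measure W) (h : Fin H)
    (g F : ∀ n, Hist S W A H n → W → (S × A) × S → ℝ≥0∞) : ∀ n, Hist S W A H n → ℝ≥0∞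
  | 0, _ => 1
  | n + 1, D => alg.expProcess q h g F n (Fin.init D) *
      (ENNReal.ofReal (Real.exp (alg.condMean q h n (Fin.init D) (F n (Fin.init D))).toReal) *
        g n (Fin.init D) (D (Fin.last n)).1 ((D (Fin.last n)).2 h))

theorem measurable_finInit {X : Type*} [MeasurableSpace X] (n : ℕ) :
    Measurable fun D : Fin (n + 1) → X => (Fin.init D : Fin n → X) :=
  measurable_pi_lambda _ fun i => measurable_pi_apply i.castSucc

theorem Algorithm.measurable_expProcess (alg : Algorithm M Ψ₂ Ψ₃ C γ₁ γ₂ δ N) (q : Measure W)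
    [SFinite q] (h : Fin H) {g F : ∀ n, Hist S W A H n → W → (S × A) × S → ℝ≥0∞}
    (hg : ∀ n, Measurable fun x : (Hist S W A H n × W) × (S × A) × S => g n x.1.1 x.1.2 x.2)
    (hF : ∀ n, Measurable fun x : (Hist S W A H n × W) × (S × A) × S => F n x.1.1 x.1.2 x.2)
    (n : ℕ) : Measurable (alg.expProcess q h g F n) := by
  induction n with
  | zero => exact measurable_const
  | succ n ih =>
    have h1 : Measurable fun D : Hist S W A H (n + 1) => (Fin.init D : Hist S W A H n) :=
      measurable_finInit n
    have h2 : Measurable fun D : Hist S W A H n =>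
        ENNReal.ofReal (Real.exp (alg.condMean q h n D (F n D)).toReal) :=
      (Real.measurable_exp.comp
        (alg.measurable_condMean q h n (hF n)).ennreal_toReal).ennreal_ofReal
    have hlast : Measurable fun D : Hist S W A H (n + 1) => D (Fin.last n) :=
      measurable_pi_apply _
    have h3 : Measurable fun D : Hist S W A H (n + 1) =>
        (((Fin.init D : Hist S W A H n), (D (Fin.last n)).1), (D (Fin.last n)).2 h) :=
      (h1.prodMk hlast.fst).prodMk ((measurable_pi_apply h).comp hlast.snd)
    exact ((ih.comp h1).mul ((h2.comp h1).mul ((hg n).comp h3)) :)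

theorem Algorithm.expProcess_history (alg : Algorithm M Ψ₂ Ψ₃ C γ₁ γ₂ δ N) (q : Measure W)
    (h : Fin H) (g F : ∀ n, Hist S W A H n → W → (S × A) × S → ℝ≥0∞) {Ω : Type*}
    (ctx : ℕ → Ω → W) (smp : ℕ → Fin H → Ω → (S × A) × S) (ω : Ω) (n : ℕ) :
    alg.expProcess q h g F n (history ctx smp n ω) =
      ENNReal.ofReal (Real.exp (∑ τ ∈ Finset.range n, (alg.condMean q h τ (history ctx smp τ ω)
        (F τ (history ctx smp τ ω))).toReal)) *
      ∏ τ ∈ Finset.range n, g τ (history ctx smp τ ω) (ctx τ ω) (smp τ h ω) := by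
  induction n with
  | zero => simp [Algorithm.expProcess]
  | succ n ih =>
    have h1 : alg.expProcess q h g F (n + 1) (history ctx smp (n + 1) ω) =
        alg.expProcess q h g F n (history ctx smp n ω) *
        (ENNReal.ofReal (Real.exp (alg.condMean q h n (history ctx smp n ω)
          (F n (history ctx smp n ω))).toReal) *
          g n (history ctx smp n ω) (ctx n ω) (smp n h ω)) := rfl
    rw [h1, ih, Finset.sum_range_succ, Finset.prod_range_succ, Real.exp_add,
      ENNReal.ofReal_mul (Real.exp_pos _).le]
    ring

variable {q : Measure W} [IsProbabilityMeasure q] {Ω : Type*} [MeasurableSpace Ω]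
  {Pr : Measure Ω} [IsProbabilityMeasure Pr] {ctx : ℕ → Ω → W}
  {smp : ℕ → Fin H → Ω → (S × A) × S} {alg : Algorithm M Ψ₂ Ψ₃ C γ₁ γ₂ δ N}

theorem Algorithm.IsRun.measurable_history (hrun : alg.IsRun q Pr ctx smp) (n : ℕ) :
    Measurable (history ctx smp n) :=
  measurable_pi_lambda _ fun τ => (hrun.measurable_ctx τ).prodMk
    (measurable_pi_lambda _ fun h => hrun.measurable_smp τ h)

/-- The reason is `a ≤ 1 - c ≤ exp (-c)`. It is the one-step estimate behind the supermartingale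
property. -/
theorem exp_mul_le_one_of_add_le_one {a c : ℝ≥0∞} (h : a + c ≤ 1) :
    ENNReal.ofReal (Real.exp c.toReal) * a ≤ 1 := by
  have hc : c ≠ ∞ := ne_top_of_le_ne_top ENNReal.one_ne_top (le_add_self.trans h)
  have h1 : a ≤ ENNReal.ofReal (Real.exp (-c.toReal)) := by
    have h2 : a ≤ ENNReal.ofReal (1 - c.toReal) := by
      rw [ENNReal.ofReal_sub _ ENNReal.toReal_nonneg, ENNReal.ofReal_one, ENNReal.ofReal_toReal hc]
      exact ENNReal.le_sub_of_add_le_right hc h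
    exact h2.trans (ENNReal.ofReal_le_ofReal (Real.one_sub_le_exp_neg _))
  refine (mul_le_mul_right h1 _).trans ?_
  rw [← ENNReal.ofReal_mul (Real.exp_pos _).le, ← Real.exp_add]
  simp

/-- The law of the run replaces the newest factor by its conditional mean, while the earlier factors
and the compensator are functions of the past and come out of the integral. The newest factor reads
only the tuple of one fixed step `h`, so the unspecified joint law of the rollouts within an episode
does not matter. -/
theorem Algorithm.IsRun.lintegral_expProcess_le (hrun : alg.IsRun q Pr ctx smp) (h : Fin H)
    {g F : ∀ n, Hist S W A H n → W → (S × A) × S → ℝ≥0∞}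
    (hg : ∀ n, Measurable fun x : (Hist S W A H n × W) × (S × A) × S => g n x.1.1 x.1.2 x.2)
    (hF : ∀ n, Measurable fun x : (Hist S W A H n × W) × (S × A) × S => F n x.1.1 x.1.2 x.2)
    (hgF : ∀ n < N, ∀ D, alg.condMean q h n D (fun w x => g n D w x + F n D w x) ≤ 1)
    (n : ℕ) (hn : n ≤ N) :
    ∫⁻ ω, alg.expProcess q h g F n (history ctx smp n ω) ∂Pr ≤ 1 := by
  induction n with
  | zero => simp [Algorithm.expProcess]
  | succ n ih =>
    have hZ := alg.measurable_expProcess q h hg hF n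
    have hE : Measurable fun D : Hist S W A H n =>
        ENNReal.ofReal (Real.exp (alg.condMean q h n D (F n D)).toReal) :=
      (Real.measurable_exp.comp
        (alg.measurable_condMean q h n (hF n)).ennreal_toReal).ennreal_ofReal
    have hassoc : Measurable fun x : Hist S W A H n × W × (S × A) × S =>
        ((x.1, x.2.1), x.2.2) :=
      (measurable_fst.prodMk measurable_snd.fst).prodMk measurable_snd.snd
    have hfm : Measurable fun x : Hist S W A H n × W × (S × A) × S =>
        alg.expProcess q h g F n x.1 *
          (ENNReal.ofReal (Real.exp (alg.condMean q h n x.1 (F n x.1)).toReal) *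
            g n x.1 x.2.1 x.2.2) :=
      ((hZ.comp measurable_fst).mul ((hE.comp measurable_fst).mul ((hg n).comp hassoc)) :)
    have hlaw := hrun.law n hn h _ hfm
    have hgD : ∀ D, Measurable fun x : W × (S × A) × S => g n D x.1 x.2 := fun D =>
      ((hg n).comp ((measurable_const.prodMk measurable_fst).prodMk measurable_snd :
        Measurable fun x : W × (S × A) × S => ((D, x.1), x.2)) :)
    refine (hlaw.trans_le (lintegral_mono fun ω => ?_)).trans (ih (Nat.le_of_succ_le hn))
    have h1 := alg.condMean_const_mul q h n (history ctx smp n ω)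
      (alg.expProcess q h g F n (history ctx smp n ω) *
        ENNReal.ofReal (Real.exp (alg.condMean q h n (history ctx smp n ω)
          (F n (history ctx smp n ω))).toReal)) (hgD (history ctx smp n ω))
    simp only [Algorithm.condMean, mul_assoc] at h1 ⊢
    rw [h1]
    refine mul_le_of_le_one_right zero_le (exp_mul_le_one_of_add_le_one ?_)
    refine le_trans (le_of_eq ?_) (hgF n hn (history ctx smp n ω))
    exact (alg.condMean_add q h n (history ctx smp n ω) (hgD _) _).symm

/-- The deviation inequality for exponential supermartingales. -/
theorem Algorithm.IsRun.measure_expProcess_ge_le (hrun : alg.IsRun q Pr ctx smp) (h : Fin H)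
    {g F : ∀ n, Hist S W A H n → W → (S × A) × S → ℝ≥0∞}
    (hg : ∀ n, Measurable fun x : (Hist S W A H n × W) × (S × A) × S => g n x.1.1 x.1.2 x.2)
    (hF : ∀ n, Measurable fun x : (Hist S W A H n × W) × (S × A) × S => F n x.1.1 x.1.2 x.2)
    (hgF : ∀ n < N, ∀ D, alg.condMean q h n D (fun w x => g n D w x + F n D w x) ≤ 1)
    (n : ℕ) (hn : n ≤ N) {p : ℝ} (hp : 0 < p) :
    Pr {ω | ENNReal.ofReal p⁻¹ ≤ ENNReal.ofReal (Real.exp (∑ τ ∈ Finset.range n,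
        (alg.condMean q h τ (history ctx smp τ ω) (F τ (history ctx smp τ ω))).toReal)) *
      ∏ τ ∈ Finset.range n, g τ (history ctx smp τ ω) (ctx τ ω) (smp τ h ω)} ≤
      ENNReal.ofReal p := by
  -- Markov's inequality at the level `1 / p`.
  have h1 := mul_meas_ge_le_lintegral₀ (μ := Pr) ((alg.measurable_expProcess q h hg hF n).comp
    (hrun.measurable_history n)).aemeasurable (ENNReal.ofReal p⁻¹)
  have h2 := h1.trans (hrun.lintegral_expProcess_le h hg hF hgF n hn)
  simp only [Function.comp_apply, alg.expProcess_history q h g F ctx smp] at h2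
  rw [ENNReal.ofReal_inv_of_pos hp, mul_comm, ← div_eq_mul_inv] at h2
  rw [ENNReal.ofReal_inv_of_pos hp]
  simpa using (ENNReal.div_le_iff (by simpa using hp) ENNReal.ofReal_ne_top).1 h2

end Concentration

/-! ### The `L¹` distance and the Hellinger affinity -/

section Hellinger

variable {S : Type*} [MeasurableSpace S] {ν : Measure S}

/-- For `a = x²` and `b = y²` this is `|x - y| (x + y) ≤ t (x - y)² / 2 + (x + y)² / (2t)`. The free
parameter `t` lets the integrated inequality replace Cauchy–Schwarz. -/
theorem abs_sub_le_sqrt_mul {a b t : ℝ} (ha : 0 ≤ a) (hb : 0 ≤ b) (ht : 0 < t) :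
    |a - b| ≤ t / 2 * (a + b - 2 * √(a * b)) + 1 / (2 * t) * (a + b + 2 * √(a * b)) := by
  obtain ⟨x, hx, rfl⟩ : ∃ x, 0 ≤ x ∧ a = x ^ 2 := ⟨√a, Real.sqrt_nonneg a, (Real.sq_sqrt ha).symm⟩
  obtain ⟨y, hy, rfl⟩ : ∃ y, 0 ≤ y ∧ b = y ^ 2 := ⟨√b, Real.sqrt_nonneg b, (Real.sq_sqrt hb).symm⟩
  have h1 : √(x ^ 2 * y ^ 2) = x * y := by rw [← mul_pow, Real.sqrt_sq (mul_nonneg hx hy)]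
  have h2 : |x ^ 2 - y ^ 2| = |x - y| * (x + y) := by
    rw [← abs_of_nonneg (add_nonneg hx hy), ← abs_mul]
    congr 1
    ring
  have h3 : t / 2 * (x ^ 2 + y ^ 2 - 2 * (x * y)) + 1 / (2 * t) * (x ^ 2 + y ^ 2 + 2 * (x * y)) -
      |x - y| * (x + y) = (t * |x - y| - (x + y)) ^ 2 / (2 * t) := by
    have h4 : |x - y| ^ 2 = (x - y) ^ 2 := sq_abs _
    field_simp
    linear_combination -(t ^ 2) * h4
  rw [h1, h2]
  have : 0 ≤ (t * |x - y| - (x + y)) ^ 2 / (2 * t) := by positivity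
  linarith

/-- The `L¹` distance of two probability densities is controlled by their Hellinger affinity. -/
theorem sq_integral_abs_sub_le {a b : S → ℝ} (ha : ∀ s, 0 ≤ a s) (hb : ∀ s, 0 ≤ b s)
    (hai : Integrable a ν) (hbi : Integrable b ν) (ha1 : ∫ s, a s ∂ν = 1) (hb1 : ∫ s, b s ∂ν = 1) :
    Integrable (fun s => √(a s * b s)) ν ∧
      ∫ s, √(a s * b s) ∂ν + (∫ s, |a s - b s| ∂ν) ^ 2 / 8 ≤ 1 := by
  have hle : ∀ s, √(a s * b s) ≤ (a s + b s) / 2 := fun s => by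
    rw [Real.sqrt_le_left (by linarith [ha s, hb s])]
    nlinarith [sq_nonneg (a s - b s)]
  have hsi : Integrable (fun s => √(a s * b s)) ν := by
    refine Integrable.mono' ((hai.add hbi).div_const 2)
      (hai.aestronglyMeasurable.aemeasurable.mul
        hbi.aestronglyMeasurable.aemeasurable).sqrt.aestronglyMeasurable
      (Filter.Eventually.of_forall fun s => ?_)
    rw [Real.norm_of_nonneg (Real.sqrt_nonneg _)]
    exact hle s
  refine ⟨hsi, ?_⟩
  set B := ∫ s, √(a s * b s) ∂ν with hB
  set f := ∫ s, |a s - b s| ∂ν with hf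
  have hB1 : B ≤ 1 := by
    have h1 := integral_mono hsi ((hai.add hbi).div_const 2) hle
    have h2 : ∫ s, (a + b) s / 2 ∂ν = 1 := by
      rw [integral_div, integral_add' hai hbi, ha1, hb1]
      norm_num
    exact h1.trans_eq h2
  have hf0 : 0 ≤ f := integral_nonneg fun s => abs_nonneg _
  rcases hf0.eq_or_lt with h0 | h0
  · rw [← h0]
    linarith
  have hbound : ∀ t : ℝ, 0 < t → f ≤ t / 2 * (2 - 2 * B) + 1 / (2 * t) * (2 + 2 * B) := by
    intro t ht
    have hab : Integrable (fun s => a s + b s) ν := hai.add hbi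
    have h2s : Integrable (fun s => 2 * √(a s * b s)) ν := hsi.const_mul 2
    have hm : Integrable (fun s => t / 2 * (a s + b s - 2 * √(a s * b s))) ν :=
      (hab.sub h2s).const_mul _
    have hp : Integrable (fun s => 1 / (2 * t) * (a s + b s + 2 * √(a s * b s))) ν :=
      (hab.add h2s).const_mul _
    have h1 := integral_mono (hai.sub hbi).abs (hm.add hp)
      fun s => abs_sub_le_sqrt_mul (ha s) (hb s) ht
    refine h1.trans_eq ?_
    rw [integral_add' hm hp, integral_const_mul, integral_const_mul, integral_sub hab h2s,
      integral_add hab h2s, integral_add hai hbi, integral_const_mul, ha1, hb1]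
    ring
  -- Multiplied by `f`, this choice gives `f² ≤ 4 (1 - B) + f² (1 + B) / 4`. Since `B ≤ 1`, the last
  -- term is at most `f² / 2`, whence `f² / 8 ≤ 1 - B`.
  have h1 := hbound (4 / f) (by positivity)
  have h2 : f * f ≤ f * (4 / f / 2 * (2 - 2 * B) + 1 / (2 * (4 / f)) * (2 + 2 * B)) :=
    mul_le_mul_of_nonneg_left h1 hf0
  have h3 : f * (4 / f / 2 * (2 - 2 * B) + 1 / (2 * (4 / f)) * (2 + 2 * B)) =
      4 * (1 - B) + f ^ 2 / 4 * (1 + B) := by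
    field_simp
  rw [h3] at h2
  nlinarith [sq_nonneg f]

theorem ofReal_tsub_add_tsub (a b : ℝ) (ha : 0 ≤ a) (hb : 0 ≤ b) :
    (ENNReal.ofReal a - ENNReal.ofReal b) + (ENNReal.ofReal b - ENNReal.ofReal a) =
      ENNReal.ofReal |a - b| := by
  rw [← ENNReal.ofReal_sub _ hb, ← ENNReal.ofReal_sub _ ha]
  rcases le_total a b with h | h
  · rw [ENNReal.ofReal_of_nonpos (sub_nonpos.2 h), zero_add, abs_of_nonpos (sub_nonpos.2 h),
      neg_sub]
  · rw [ENNReal.ofReal_of_nonpos (sub_nonpos.2 h), add_zero, abs_of_nonneg (sub_nonneg.2 h)]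

/-- For `a = 0` the quotient may be infinite, but the convention `0 * ∞ = 0` removes it: points of
zero true density contribute nothing to the affinity. -/
theorem ofReal_mul_sqrt_div (a b : ℝ) (ha : 0 ≤ a) (hb : 0 ≤ b) :
    ENNReal.ofReal a * (ENNReal.ofReal b / ENNReal.ofReal a) ^ (1 / 2 : ℝ) =
      ENNReal.ofReal √(a * b) := by
  rcases ha.eq_or_lt with h0 | h0
  · simp [← h0]
  · rw [← ENNReal.ofReal_div_of_pos h0, ENNReal.ofReal_rpow_of_nonneg (by positivity) (by norm_num),
      ← ENNReal.ofReal_mul ha, ← Real.sqrt_eq_rpow]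
    congr 1
    rw [Real.sqrt_div hb, Real.sqrt_mul ha]
    have h1 : √a * √a = a := Real.mul_self_sqrt ha
    have h2 : √a ≠ 0 := (Real.sqrt_pos.2 h0).ne'
    field_simp
    linear_combination (-√b) * h1

/-- The form needed for maximum likelihood: the first integral is the mean, under the density `a`,
of the square root of the likelihood ratio. -/
theorem lintegral_hellinger_le {a b : S → ℝ} (ha : ∀ s, 0 ≤ a s) (hb : ∀ s, 0 ≤ b s)
    (ham : Measurable a) (hbm : Measurable b) (ha1 : ∫⁻ s, ENNReal.ofReal (a s) ∂ν = 1)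
    (hb1 : ∫⁻ s, ENNReal.ofReal (b s) ∂ν = 1) :
    ∫⁻ s, ENNReal.ofReal (a s) *
        (ENNReal.ofReal (b s) / ENNReal.ofReal (a s)) ^ (1 / 2 : ℝ) ∂ν +
      (∫⁻ s, (ENNReal.ofReal (a s) - ENNReal.ofReal (b s)) +
        (ENNReal.ofReal (b s) - ENNReal.ofReal (a s)) ∂ν) ^ 2 / 8 ≤ 1 := by
  have hintegr : ∀ {c : S → ℝ}, (∀ s, 0 ≤ c s) → Measurable c →
      ∫⁻ s, ENNReal.ofReal (c s) ∂ν = 1 → Integrable c ν ∧ ∫ s, c s ∂ν = 1 := by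
    intro c hc hcm hc1
    refine ⟨⟨hcm.aestronglyMeasurable, ?_⟩, ?_⟩
    · rw [hasFiniteIntegral_iff_ofReal (Filter.Eventually.of_forall hc), hc1]
      exact ENNReal.one_lt_top
    · rw [integral_eq_lintegral_of_nonneg_ae (Filter.Eventually.of_forall hc)
        hcm.aestronglyMeasurable, hc1, ENNReal.toReal_one]
  obtain ⟨hai, ha2⟩ := hintegr ha ham ha1
  obtain ⟨hbi, hb2⟩ := hintegr hb hbm hb1
  obtain ⟨hsi, hle⟩ := sq_integral_abs_sub_le ha hb hai hbi ha2 hb2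
  simp only [fun s => ofReal_tsub_add_tsub (a s) (b s) (ha s) (hb s),
    fun s => ofReal_mul_sqrt_div (a s) (b s) (ha s) (hb s)]
  have habs : Integrable (fun s => |a s - b s|) ν := (hai.sub hbi).abs
  rw [← ofReal_integral_eq_lintegral_ofReal hsi
      (Filter.Eventually.of_forall fun s => Real.sqrt_nonneg _),
    ← ofReal_integral_eq_lintegral_ofReal habs
      (Filter.Eventually.of_forall fun s => abs_nonneg _),
    ← ENNReal.ofReal_pow (integral_nonneg fun s => abs_nonneg _)]
  have h8 : (8 : ℝ≥0∞) = ENNReal.ofReal 8 := by simp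
  rw [h8, ← ENNReal.ofReal_div_of_pos (by norm_num),
    ← ENNReal.ofReal_add (integral_nonneg fun s => Real.sqrt_nonneg _) (by positivity)]
  exact ENNReal.ofReal_le_one.2 hle

end Hellinger

/-! ### Accuracy of least squares and maximum likelihood on the past rollouts -/

section Estimation

variable {S W A : Type*} [MeasurableSpace S] [MeasurableSpace W] [MeasurableSpace A]
  {ν : Measure S} {H d : ℕ} [SigmaFinite ν] [Fintype A] [MeasurableSingletonClass A]

theorem LinearCMDP.density_ne_top (M : LinearCMDP S W A ν H d) (h : Fin H) (m : S → W → Vec d)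
    (w : W) (s : S) (a : A) (s' : S) : M.density h m w s a s' ≠ ∞ :=
  ENNReal.ofReal_ne_top

/-- One eighth of the squared `L¹` error of the transition weights `m`. -/
def LinearCMDP.transErr (M : LinearCMDP S W A ν H d) (h : Fin H) (m : S → W → Vec d) (w : W)
    (y : S × A) : ℝ≥0∞ :=
  M.l1Dist h m w y.1 y.2 ^ 2 / 8

/-- The reward predicted by the weights `e`, truncated to `[0,1]`. -/
def LinearCMDP.clipReward (M : LinearCMDP S W A ν H d) (e : W → Vec d) (w : W) (h : Fin H)
    (s : S) (a : A) : ℝ :=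
  max 0 (min 1 (inner ℝ (e w) (M.ψ h s a)))

/-- The squared error of the truncated reward predicted by the weights `e`. -/
def LinearCMDP.rewardErr (M : LinearCMDP S W A ν H d) (h : Fin H) (e : W → Vec d) (w : W)
    (y : S × A) : ℝ≥0∞ :=
  ENNReal.ofReal ((M.reward h y.1 y.2 w - M.clipReward e w h y.1 y.2) ^ 2)

theorem LinearCMDP.measurable_transErr (M : LinearCMDP S W A ν H d) (h : Fin H)
    {m : S → W → Vec d} (hm : Measurable fun x : S × W => m x.1 x.2) :
    Measurable fun x : W × (S × A) => M.transErr h m x.1 x.2 :=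
  ((M.measurable_l1Dist h hm).pow_const 2).div_const 8

theorem LinearCMDP.clipReward_nonneg (M : LinearCMDP S W A ν H d) (e : W → Vec d) (w : W)
    (h : Fin H) (s : S) (a : A) : 0 ≤ M.clipReward e w h s a := le_max_left _ _

theorem LinearCMDP.clipReward_le_one (M : LinearCMDP S W A ν H d) (e : W → Vec d) (w : W)
    (h : Fin H) (s : S) (a : A) : M.clipReward e w h s a ≤ 1 :=
  max_le zero_le_one (min_le_left _ _)

theorem LinearCMDP.measurable_clipReward (M : LinearCMDP S W A ν H d) (h : Fin H)
    {e : W → Vec d} (he : Measurable e) :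
    Measurable fun x : W × (S × A) => M.clipReward e x.1 h x.2.1 x.2.2 := by
  have h1 : Measurable fun x : W × (S × A) => M.ψ h x.2.1 x.2.2 :=
    (M.measurable_ψ h).comp measurable_snd
  have h2 : Measurable fun x : W × (S × A) => e x.1 := he.comp measurable_fst
  exact measurable_const.max (measurable_const.min (h2.inner h1))

theorem LinearCMDP.measurable_rewardErr (M : LinearCMDP S W A ν H d) (h : Fin H)
    {e : W → Vec d} (he : Measurable e) :
    Measurable fun x : W × (S × A) => M.rewardErr h e x.1 x.2 :=
  (((M.measurable_reward h).sub (M.measurable_clipReward h he)).pow_const 2).ennreal_ofReal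

theorem LinearCMDP.rewardErr_le_one (M : LinearCMDP S W A ν H d) (h : Fin H) (e : W → Vec d)
    (w : W) (y : S × A) : M.rewardErr h e w y ≤ 1 := by
  rw [LinearCMDP.rewardErr, ENNReal.ofReal_le_one, sq_le_one_iff_abs_le_one, abs_le]
  constructor <;> linarith [M.reward_nonneg h y.1 y.2 w, M.reward_le_one h y.1 y.2 w,
    M.clipReward_nonneg e w h y.1 y.2, M.clipReward_le_one e w h y.1 y.2]

theorem measure_le_card_mul {Ω ι : Type*} [MeasurableSpace Ω] (Pr : Measure Ω) (s : Finset ι)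
    {B : ι → Set Ω} {p : ℝ} (hB : ∀ i ∈ s, Pr (B i) ≤ ENNReal.ofReal p) {E : Set Ω}
    (hE : E ⊆ ⋃ i ∈ s, B i) : Pr E ≤ ENNReal.ofReal (s.card * p) := by
  refine (measure_mono hE).trans ((measure_biUnion_finset_le s B).trans ?_)
  refine (Finset.sum_le_sum hB).trans_eq ?_
  rw [Finset.sum_const, nsmul_eq_mul, ENNReal.ofReal_mul (Nat.cast_nonneg _),
    ENNReal.ofReal_natCast]

variable [Nonempty A]
  {M : LinearCMDP S W A ν H d} {Ψ₂ : Finset (S → W → Vec d)} {Ψ₃ : Finset (W → Vec d)}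
  {C γ₁ γ₂ δ : ℝ} {N : ℕ}
  {q : Measure W} [IsProbabilityMeasure q] {Ω : Type*} [MeasurableSpace Ω]
  {Pr : Measure Ω} [IsProbabilityMeasure Pr] {ctx : ℕ → Ω → W}
  {smp : ℕ → Fin H → Ω → (S × A) × S} {alg : Algorithm M Ψ₂ Ψ₃ C γ₁ γ₂ δ N}

/-- Functions of the context and the tuple, as functions that do not depend on the data. -/
theorem measurable_const_hist {n : ℕ} {F : W → (S × A) × S → ℝ≥0∞}
    (hF : Measurable fun x : W × (S × A) × S => F x.1 x.2) :
    Measurable fun x : (Hist S W A H n × W) × (S × A) × S => F x.1.2 x.2 :=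
  (hF.comp (measurable_fst.snd.prodMk measurable_snd :
    Measurable fun x : (Hist S W A H n × W) × (S × A) × S => (x.1.2, x.2)) :)

theorem measurable_fst_pair {F : W → S × A → ℝ≥0∞}
    (hF : Measurable fun x : W × (S × A) => F x.1 x.2) :
    Measurable fun x : W × (S × A) × S => F x.1 x.2.1 :=
  (hF.comp (measurable_fst.prodMk measurable_snd.fst :
    Measurable fun x : W × (S × A) × S => (x.1, x.2.1)) :)

/-- With high probability the least squares estimates are accurate on the past rollouts. -/
theorem Algorithm.IsRun.measure_rewardErr_le (hrun : alg.IsRun q Pr ctx smp)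
    (hreal : M.Realizable Ψ₂ Ψ₃) (hH : 1 ≤ H) (hN : 1 ≤ N) (hδ : 0 < δ) :
    Pr {ω | ∃ n, 0 < n ∧ n < N ∧ ∃ h, Real.log (2 * H * N * Ψ₃.card / δ) <
      ∑ τ ∈ Finset.range n, (alg.condMean q h τ (history ctx smp τ ω) (fun w x =>
        M.rewardErr h (alg.estReward n (history ctx smp n ω) h) w x.1)).toReal} ≤
      ENNReal.ofReal (δ / 2) := by
  have hcard : 0 < Ψ₃.card := Finset.card_pos.2 ⟨_, hreal.η_mem ⟨0, hH⟩⟩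
  have hH0 : (0 : ℝ) < H := Nat.cast_pos.2 hH
  have hN0 : (0 : ℝ) < N := Nat.cast_pos.2 hN
  have hk0 : (0 : ℝ) < Ψ₃.card := Nat.cast_pos.2 hcard
  -- The estimate depends on all the data, so the deviation inequality is applied to every triple of
  -- a step, a member of the class and a number of episodes. There are `H * |Ψ₃| * N` triples, each
  -- granted an equal share of `δ / 2`.
  set p : ℝ := δ / (2 * H * N * Ψ₃.card) with hp
  have hp0 : 0 < p := by positivity
  have hpinv : p⁻¹ = 2 * H * N * Ψ₃.card / δ := by rw [hp, inv_div]
  -- The factor is one minus the compensator, so their sum is identically one because the squared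
  -- error is at most one.
  let G : (W → Vec d) → Fin H → W → (S × A) × S → ℝ≥0∞ := fun e h w x =>
    1 - M.rewardErr h e w x.1
  let B : Fin H × (W → Vec d) × ℕ → Set Ω := fun i =>
    {ω | ENNReal.ofReal p⁻¹ ≤ ENNReal.ofReal (Real.exp (∑ τ ∈ Finset.range i.2.2,
        (alg.condMean q i.1 τ (history ctx smp τ ω)
          (fun w x => M.rewardErr i.1 i.2.1 w x.1)).toReal)) *
      ∏ τ ∈ Finset.range i.2.2, G i.2.1 i.1 (ctx τ ω) (smp τ i.1 ω)}
  have hB : ∀ i ∈ (Finset.univ : Finset (Fin H)) ×ˢ Ψ₃ ×ˢ Finset.range N,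
      Pr (B i) ≤ ENNReal.ofReal p := by
    rintro ⟨h, e, n⟩ hi
    simp only [Finset.mem_product, Finset.mem_range, Finset.mem_univ, true_and] at hi
    have hF := measurable_fst_pair (M.measurable_rewardErr h (hreal.measurable e hi.1))
    have hG : Measurable fun x : W × (S × A) × S => G e h x.1 x.2 := measurable_const.sub hF
    refine hrun.measure_expProcess_ge_le h (g := fun _ _ => G e h)
      (F := fun _ _ w x => M.rewardErr h e w x.1) (fun _ => measurable_const_hist hG)
      (fun _ => measurable_const_hist (F := fun w x => M.rewardErr h e w x.1) hF) (fun k _ D => ?_) n hi.2.le hp0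
    refine alg.condMean_le_one q h k D fun w x => ?_
    exact (tsub_add_cancel_of_le (M.rewardErr_le_one h e w x.1)).le
  have hsub := measure_le_card_mul Pr _ hB (E := {ω | ∃ n, 0 < n ∧ n < N ∧ ∃ h,
    Real.log (2 * H * N * Ψ₃.card / δ) <
      ∑ τ ∈ Finset.range n, (alg.condMean q h τ (history ctx smp τ ω) (fun w x =>
        M.rewardErr h (alg.estReward n (history ctx smp n ω) h) w x.1)).toReal}) (by
    rintro ω ⟨n, hn0, hnN, h, hlt⟩
    set e := alg.estReward n (history ctx smp n ω) h with he
    refine Set.mem_biUnion (x := (h, e, n)) (by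
      simpa using ⟨alg.estReward_mem n _ h hn0 hnN, hnN⟩) ?_
    -- Rewards are observed without noise, so the true weights have zero loss. A minimizer then has
    -- zero loss as well and reproduces every observed reward, which makes all the factors equal to
    -- one.
    have hloss : ∀ τ : Fin n, inner ℝ (M.ψ h (smp τ h ω).1.1 (smp τ h ω).1.2) (e (ctx τ ω)) =
        M.reward h (smp τ h ω).1.1 (smp τ h ω).1.2 (ctx τ ω) := by
      have h1 := alg.estReward_min n (history ctx smp n ω) h hn0 hnN (M.η h) (hreal.η_mem h)
      have h2 : M.squaredLoss (history ctx smp n ω) h (M.η h) = 0 := by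
        simp [LinearCMDP.squaredLoss, LinearCMDP.reward]
      rw [h2, ← he] at h1
      have h3 := (Finset.sum_eq_zero_iff_of_nonneg (fun τ _ => sq_nonneg _)).1
        (le_antisymm h1 (Finset.sum_nonneg fun τ _ => sq_nonneg _))
      intro τ
      have h4 := pow_eq_zero_iff (two_ne_zero) |>.1 (h3 τ (Finset.mem_univ _))
      exact sub_eq_zero.1 h4
    have hone : ∏ τ ∈ Finset.range n, G e h (ctx τ ω) (smp τ h ω) = 1 := by
      refine Finset.prod_eq_one fun τ hτ => ?_
      have h1 := hloss ⟨τ, Finset.mem_range.1 hτ⟩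
      have h2 : M.clipReward e (ctx τ ω) h (smp τ h ω).1.1 (smp τ h ω).1.2 =
          M.reward h (smp τ h ω).1.1 (smp τ h ω).1.2 (ctx τ ω) := by
        rw [LinearCMDP.clipReward, real_inner_comm, h1, min_eq_right (M.reward_le_one _ _ _ _),
          max_eq_right (M.reward_nonneg _ _ _ _)]
      simp [G, LinearCMDP.rewardErr, h2]
    change ENNReal.ofReal p⁻¹ ≤ _ * ∏ τ ∈ Finset.range n, G e h (ctx τ ω) (smp τ h ω)
    rw [hone, mul_one]
    refine ENNReal.ofReal_le_ofReal ?_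
    rw [hpinv]
    exact (Real.log_le_iff_le_exp (by positivity)).1 hlt.le)
  refine hsub.trans (ENNReal.ofReal_le_ofReal (le_of_eq ?_))
  simp only [Finset.card_product, Finset.card_univ, Fintype.card_fin, Finset.card_range,
    Nat.cast_mul, hp]
  field_simp

/-- The square root of the likelihood ratio of the weights `m`. -/
def LinearCMDP.sqrtRatio (M : LinearCMDP S W A ν H d) (h : Fin H) (m : S → W → Vec d) (w : W)
    (x : (S × A) × S) : ℝ≥0∞ :=
  (M.density h m w x.1.1 x.1.2 x.2 / M.density h (M.μ h) w x.1.1 x.1.2 x.2) ^ (1 / 2 : ℝ)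

theorem LinearCMDP.measurable_sqrtRatio (M : LinearCMDP S W A ν H d) (h : Fin H)
    {m : S → W → Vec d} (hm : Measurable fun x : S × W => m x.1 x.2) :
    Measurable fun x : W × (S × A) × S => M.sqrtRatio h m x.1 x.2 :=
  ((M.measurable_density h hm).div
    (M.measurable_density h (M.transition h).measurable)).pow_const _

/-- Given the state, the action and the context, the mean of the square-root ratio over the next
state is the Hellinger affinity, which is at most one minus the error `transErr`. Averaging over
state, action and context preserves the bound. -/
theorem Algorithm.condMean_sqrtRatio_add_le (alg : Algorithm M Ψ₂ Ψ₃ C γ₁ γ₂ δ N) (h : Fin H)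
    {m : S → W → Vec d} (hm : IsTransitionWeight ν (M.φ h) m) (n : ℕ) (D : Hist S W A H n) :
    alg.condMean q h n D (fun w x => M.sqrtRatio h m w x + M.transErr h m w x.1) ≤ 1 := by
  have hstep : ∀ w, ∫⁻ x, (M.sqrtRatio h m w x + M.transErr h m w x.1)
      ∂(M.rollout w (alg.policy n D w) h) ≤ 1 := fun w => by
    have hmeas : Measurable fun x : (S × A) × S =>
        M.sqrtRatio h m w x + M.transErr h m w x.1 :=
      (((M.measurable_sqrtRatio h hm.measurable).add (measurable_fst_pair
        (M.measurable_transErr h hm.measurable))).comp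
          (measurable_prodMk_left : Measurable fun x : (S × A) × S => (w, x)) :)
    rw [M.lintegral_rollout w _ h hmeas]
    have hone : ∀ s a, ∫⁻ s', M.density h (M.μ h) w s a s' *
        (M.sqrtRatio h m w ((s, a), s') + M.transErr h m w (s, a)) ∂ν ≤ 1 := fun s a => by
      have hd := M.measurable_density_right h (M.transition h).measurable w s a
      have hme : ∀ {m : S → W → Vec d}, IsTransitionWeight ν (M.φ h) m →
          Measurable fun s' => (inner ℝ (M.φ h s a) (m s' w) : ℝ) := fun {m} hm => by
        have h1 : Measurable fun s' => m s' w := hm.measurable.comp measurable_prodMk_right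
        exact measurable_const.inner h1
      simp only [mul_add]
      rw [lintegral_add_right _ (hd.mul_const _), lintegral_mul_const _ hd,
        M.lintegral_density h (M.transition h), one_mul]
      exact lintegral_hellinger_le (fun s' => (M.transition h).nonneg s a s' w)
        (fun s' => hm.nonneg s a s' w) (hme (M.transition h)) (hme hm)
        (M.lintegral_density h (M.transition h) w s a) (M.lintegral_density h hm w s a)
    have hK : ∀ s, (Fintype.card A : ℝ≥0∞)⁻¹ * ∑ a, ∫⁻ s', M.density h (M.μ h) w s a s' *
        (M.sqrtRatio h m w ((s, a), s') + M.transErr h m w (s, a)) ∂ν ≤ 1 := fun s => by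
      refine (mul_le_mul_right (Finset.sum_le_sum fun a _ => hone s a) _).trans ?_
      rw [Finset.sum_const, Finset.card_univ, nsmul_eq_mul, mul_one,
        ENNReal.inv_mul_cancel (by simp) (by simp)]
    exact (lintegral_mono hK).trans (by simp)
  exact (lintegral_mono hstep).trans (by simp)

theorem Algorithm.IsRun.measure_eq_zero (hrun : alg.IsRun q Pr ctx smp) (h : Fin H) {n : ℕ}
    (hn : n < N) {T : Set (W × (S × A) × S)} (hT : MeasurableSet T)
    (hT0 : ∀ w π, M.rollout w π h {x | (w, x) ∈ T} = 0) :
    Pr {ω | (ctx n ω, smp n h ω) ∈ T} = 0 := by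
  have hf : Measurable fun x : Hist S W A H n × W × (S × A) × S =>
      T.indicator (1 : W × (S × A) × S → ℝ≥0∞) x.2 :=
    (measurable_one.indicator hT).comp measurable_snd
  have h1 := hrun.law n hn h _ hf
  have h2 : ∀ w π, ∫⁻ x, T.indicator (1 : W × (S × A) × S → ℝ≥0∞) (w, x)
      ∂(M.rollout w π h) = 0 := fun w π => by
    have h3 : MeasurableSet {x | (w, x) ∈ T} := measurable_prodMk_left hT
    rw [← hT0 w π, ← lintegral_indicator_one h3]
    rfl
  simp only [h2, lintegral_zero] at h1
  have hpre : MeasurableSet {ω | (ctx n ω, smp n h ω) ∈ T} :=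
    ((hrun.measurable_ctx n).prodMk (hrun.measurable_smp n h)) hT
  rw [← lintegral_indicator_one hpre, ← h1]
  rfl

/-- Needed to form likelihood ratios: outside the corresponding null event of the run, the true
likelihood of the data is positive. -/
theorem LinearCMDP.rollout_density_eq_zero (M : LinearCMDP S W A ν H d) (h : Fin H) (w : W)
    (π : Policy S A H) :
    M.rollout w π h {x | M.density h (M.μ h) w x.1.1 x.1.2 x.2 = 0} = 0 := by
  have hd := (M.measurable_density h (M.transition h).measurable).comp
    (measurable_prodMk_left : Measurable fun x : (S × A) × S => (w, x))
  have hs : MeasurableSet {x : (S × A) × S | M.density h (M.μ h) w x.1.1 x.1.2 x.2 = 0} :=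
    (hd (measurableSet_singleton 0) :)
  rw [← lintegral_indicator_one hs, M.lintegral_rollout w π h (measurable_one.indicator hs)]
  have h3 : ∀ s a s', M.density h (M.μ h) w s a s' *
      Set.indicator {x : (S × A) × S | M.density h (M.μ h) w x.1.1 x.1.2 x.2 = 0} 1
        ((s, a), s') = 0 := fun s a s' => by
    by_cases h0 : M.density h (M.μ h) w s a s' = 0
    · rw [h0, zero_mul]
    · rw [Set.indicator_of_notMem, mul_zero]
      exact h0
  simp only [h3, lintegral_zero, Finset.sum_const_zero, mul_zero]

theorem Algorithm.IsRun.measure_density_eq_zero (hrun : alg.IsRun q Pr ctx smp) :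
    Pr {ω | ∃ n < N, ∃ h, M.density h (M.μ h) (ctx n ω) (smp n h ω).1.1 (smp n h ω).1.2
      (smp n h ω).2 = 0} = 0 := by
  have hone : ∀ n < N, ∀ h, Pr {ω | M.density h (M.μ h) (ctx n ω) (smp n h ω).1.1
      (smp n h ω).1.2 (smp n h ω).2 = 0} = 0 := by
    intro n hn h
    have hs := M.measurable_density h (M.transition h).measurable (measurableSet_singleton 0)
    exact (hrun.measure_eq_zero h hn hs (M.rollout_density_eq_zero h) :)
  have hset : {ω | ∃ n < N, ∃ h, M.density h (M.μ h) (ctx n ω) (smp n h ω).1.1 (smp n h ω).1.2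
      (smp n h ω).2 = 0} = ⋃ n ∈ Finset.range N, ⋃ h : Fin H, {ω | M.density h (M.μ h) (ctx n ω)
        (smp n h ω).1.1 (smp n h ω).1.2 (smp n h ω).2 = 0} := by
    ext ω
    simp
  rw [hset]
  refine (measure_biUnion_null_iff (Finset.countable_toSet _)).2 fun n hn => ?_
  exact measure_iUnion_null fun h => hone n (by simpa using hn) h

/-- No exception is needed for zero or infinite factors: `⊥ + ⊤ = ⊥` in `EReal` matches `0 * ∞ = 0`
in `ℝ≥0∞`. -/
theorem sum_log_eq_log_prod {ι : Type*} (s : Finset ι) (f : ι → ℝ≥0∞) :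
    ∑ i ∈ s, ENNReal.log (f i) = ENNReal.log (∏ i ∈ s, f i) := by
  classical
  induction s using Finset.induction_on with
  | empty => simp
  | insert i s hi ih => rw [Finset.sum_insert hi, Finset.prod_insert hi, ENNReal.log_mul_add, ih]

/-- With high probability the maximum likelihood estimates are accurate on the past rollouts. -/
theorem Algorithm.IsRun.measure_transErr_le (hrun : alg.IsRun q Pr ctx smp)
    (hreal : M.Realizable Ψ₂ Ψ₃) (hH : 1 ≤ H) (hN : 1 ≤ N) (hδ : 0 < δ) :
    Pr {ω | ∃ n, 0 < n ∧ n < N ∧ ∃ h, Real.log (2 * H * N * Ψ₂.card / δ) <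
      ∑ τ ∈ Finset.range n, (alg.condMean q h τ (history ctx smp τ ω) (fun w x =>
        M.transErr h (alg.estTrans n (history ctx smp n ω) h) w x.1)).toReal} ≤
      ENNReal.ofReal (δ / 2) := by
  have hcard : 0 < Ψ₂.card := Finset.card_pos.2 ⟨_, hreal.μ_mem ⟨0, hH⟩⟩
  have hH0 : (0 : ℝ) < H := Nat.cast_pos.2 hH
  have hN0 : (0 : ℝ) < N := Nat.cast_pos.2 hN
  have hk0 : (0 : ℝ) < Ψ₂.card := Nat.cast_pos.2 hcard
  set p : ℝ := δ / (2 * H * N * Ψ₂.card) with hp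
  have hp0 : 0 < p := by positivity
  have hpinv : p⁻¹ = 2 * H * N * Ψ₂.card / δ := by rw [hp, inv_div]
  let B : Fin H × (S → W → Vec d) × ℕ → Set Ω := fun i =>
    {ω | ENNReal.ofReal p⁻¹ ≤ ENNReal.ofReal (Real.exp (∑ τ ∈ Finset.range i.2.2,
        (alg.condMean q i.1 τ (history ctx smp τ ω)
          (fun w x => M.transErr i.1 i.2.1 w x.1)).toReal)) *
      ∏ τ ∈ Finset.range i.2.2, M.sqrtRatio i.1 i.2.1 (ctx τ ω) (smp τ i.1 ω)}
  have hB : ∀ i ∈ (Finset.univ : Finset (Fin H)) ×ˢ Ψ₂ ×ˢ Finset.range N,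
      Pr (B i) ≤ ENNReal.ofReal p := by
    rintro ⟨h, m, n⟩ hi
    simp only [Finset.mem_product, Finset.mem_range, Finset.mem_univ, true_and] at hi
    have hm := hreal.transition m hi.1 h
    exact hrun.measure_expProcess_ge_le h (g := fun _ _ => M.sqrtRatio h m)
      (F := fun _ _ w x => M.transErr h m w x.1)
      (fun _ => measurable_const_hist (M.measurable_sqrtRatio h hm.measurable))
      (fun _ => measurable_const_hist (F := fun w x => M.transErr h m w x.1)
        (measurable_fst_pair (M.measurable_transErr h hm.measurable)))
      (fun k _ D => alg.condMean_sqrtRatio_add_le h hm k D) n hi.2.le hp0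
  -- This null event is removed before the union bound, because dividing by the true likelihood
  -- requires it to be nonzero.
  set Z : Set Ω := {ω | ∃ n < N, ∃ h, M.density h (M.μ h) (ctx n ω) (smp n h ω).1.1
    (smp n h ω).1.2 (smp n h ω).2 = 0} with hZ
  set E : Set Ω := {ω | ∃ n, 0 < n ∧ n < N ∧ ∃ h, Real.log (2 * H * N * Ψ₂.card / δ) <
      ∑ τ ∈ Finset.range n, (alg.condMean q h τ (history ctx smp τ ω) (fun w x =>
        M.transErr h (alg.estTrans n (history ctx smp n ω) h) w x.1)).toReal} with hE
  have hsub := measure_le_card_mul Pr _ hB (E := E \ Z) (by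
    rintro ω ⟨⟨n, hn0, hnN, h, hlt⟩, hωZ⟩
    set m := alg.estTrans n (history ctx smp n ω) h with hm
    refine Set.mem_biUnion (x := (h, m, n)) (by
      simpa using ⟨alg.estTrans_mem n _ h hn0 hnN, hnN⟩) ?_
    have hpos : ∀ τ < n, M.density h (M.μ h) (ctx τ ω) (smp τ h ω).1.1 (smp τ h ω).1.2
        (smp τ h ω).2 ≠ 0 := fun τ hτ h0 => hωZ ⟨τ, hτ.trans hnN, h, h0⟩
    have hlik : ∏ τ ∈ Finset.range n, M.density h (M.μ h) (ctx τ ω) (smp τ h ω).1.1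
        (smp τ h ω).1.2 (smp τ h ω).2 ≤ ∏ τ ∈ Finset.range n, M.density h m (ctx τ ω)
          (smp τ h ω).1.1 (smp τ h ω).1.2 (smp τ h ω).2 := by
      have h1 := alg.estTrans_max n (history ctx smp n ω) h hn0 hnN (M.μ h) (hreal.μ_mem h)
      rw [LinearCMDP.logLikelihood, LinearCMDP.logLikelihood, sum_log_eq_log_prod,
        sum_log_eq_log_prod, ENNReal.log_le_log_iff] at h1
      rw [Finset.prod_range, Finset.prod_range]
      exact h1
    -- The estimate has at least the likelihood of the true weights, which belong to the class, so
    -- the product of the ratios is at least one, and so is its square root.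
    have hone : 1 ≤ ∏ τ ∈ Finset.range n, M.sqrtRatio h m (ctx τ ω) (smp τ h ω) := by
      simp only [LinearCMDP.sqrtRatio]
      rw [ENNReal.prod_rpow_of_nonneg (by norm_num), ENNReal.prod_div_distrib
        fun i _ j _ _ => Or.inr (M.density_ne_top _ _ _ _ _ _)]
      refine ENNReal.one_le_rpow ?_ (by norm_num)
      rw [ENNReal.le_div_iff_mul_le (Or.inl (Finset.prod_ne_zero_iff.2
        fun τ hτ => hpos τ (Finset.mem_range.1 hτ))) (Or.inl (ENNReal.prod_ne_top
        fun τ _ => M.density_ne_top _ _ _ _ _ _)), one_mul]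
      exact hlik
    change ENNReal.ofReal p⁻¹ ≤ _ * ∏ τ ∈ Finset.range n, M.sqrtRatio h m (ctx τ ω) (smp τ h ω)
    refine le_trans ?_ (le_mul_of_one_le_right zero_le hone)
    refine ENNReal.ofReal_le_ofReal ?_
    rw [hpinv]
    exact (Real.log_le_iff_le_exp (by positivity)).1 hlt.le)
  rw [measure_sdiff_null hrun.measure_density_eq_zero] at hsub
  refine hsub.trans (ENNReal.ofReal_le_ofReal (le_of_eq ?_))
  simp only [Finset.card_product, Finset.card_univ, Fintype.card_fin, Finset.card_range,
    Nat.cast_mul, hp]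
  field_simp

end Estimation

/-! ### Feature norms along a run and their conditional expectations -/

section Bonus

variable {S W A : Type*} [MeasurableSpace S] [MeasurableSpace W] [MeasurableSpace A]
  {ν : Measure S} {H d : ℕ}

/-- The squared norm of the features `f` with respect to the inverse of the regularized Gram matrix
of the data for step `h`. -/
def featureNorm (f : S → A → Vec d) (h : Fin H) (lam : ℝ) {n : ℕ} (D : Hist S W A H n)
    (y : S × A) : ℝ :=
  sqNormInv (gram f (fun τ => ((D τ).2 h).1) lam) (f y.1 y.2)

theorem measurable_featureNorm {f : S → A → Vec d} (hf : Measurable fun y : S × A => f y.1 y.2)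
    (h : Fin H) (lam : ℝ) (n : ℕ) :
    Measurable fun x : Hist S W A H n × (S × A) => featureNorm f h lam x.1 x.2 := by
  have hcoord : ∀ i, Measurable fun y : S × A => f y.1 y.2 i := fun i =>
    (measurable_pi_apply i).comp ((WithLp.measurable_ofLp 2 _).comp hf)
  refine measurable_sqNormInv (fun i j => ?_) (hf.comp measurable_snd)
  simp only [gram, Matrix.add_apply, Matrix.sum_apply, Matrix.vecMulVec_apply]
  refine Measurable.add_const (Finset.measurable_sum _ fun τ _ => ?_) _
  have h1 : Measurable fun x : Hist S W A H n × (S × A) => ((x.1 τ).2 h).1 :=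
    ((measurable_pi_apply h).comp ((measurable_pi_apply τ).comp measurable_fst).snd).fst
  exact ((hcoord i).comp h1).mul ((hcoord j).comp h1)

theorem measurable_featureNorm_hist {f : S → A → Vec d}
    (hf : Measurable fun y : S × A => f y.1 y.2) (h : Fin H) (lam : ℝ) {n : ℕ}
    (D : Hist S W A H n) : Measurable fun y : S × A => featureNorm f h lam D y :=
  ((measurable_featureNorm hf h lam n).comp
    (measurable_const.prodMk measurable_id : Measurable fun y : S × A => (D, y)) :)

theorem posDef_gram (f : S → A → Vec d) {n : ℕ} (x : Fin n → S × A) {lam : ℝ} (hlam : 0 < lam) :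
    (gram f x lam).PosDef :=
  posDef_sum_add_smul_one Finset.univ (fun τ => f (x τ).1 (x τ).2) hlam

theorem featureNorm_nonneg (f : S → A → Vec d) (h : Fin H) {lam : ℝ} (hlam : 0 < lam) {n : ℕ}
    (D : Hist S W A H n) (y : S × A) : 0 ≤ featureNorm f h lam D y :=
  sqNormInv_nonneg (posDef_gram f _ hlam) _

/-- The regularizers vary with the episode, whereas the elliptical potential lemma is stated for a
fixed one. Monotonicity allows each of them to be replaced by a common lower bound. -/
theorem featureNorm_antitone (f : S → A → Vec d) (h : Fin H) {lam lam' : ℝ} (hlam : 0 < lam)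
    (hle : lam ≤ lam') {n : ℕ} (D : Hist S W A H n) (y : S × A) :
    featureNorm f h lam' D y ≤ featureNorm f h lam D y := by
  refine sqNormInv_antitone (posDef_gram f _ (hlam.trans_le hle)) (posDef_gram f _ hlam) ?_ _
  rw [gram, gram, add_sub_add_left_eq_sub, ← sub_smul]
  exact Matrix.PosSemidef.one.smul (sub_nonneg.2 hle)

theorem featureNorm_le_inv {f : S → A → Vec d} (hf : ∀ s a, ‖f s a‖ ≤ 1) (h : Fin H) {lam : ℝ}
    (hlam : 0 < lam) {n : ℕ} (D : Hist S W A H n) (y : S × A) :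
    featureNorm f h lam D y ≤ lam⁻¹ := by
  refine (sqNormInv_sum_add_smul_one_le Finset.univ
    (fun τ => f ((D τ).2 h).1.1 ((D τ).2 h).1.2) hlam (f y.1 y.2)).trans ?_
  rw [inv_eq_one_div]
  exact div_le_div_of_nonneg_right (pow_le_one₀ (norm_nonneg _) (hf _ _)) hlam.le

/-- The one-step condition for the multiplicative deviation bound: with `g = exp (-y)` and `F = y /
2`, a sum of conditional means is at most twice the realized sum plus a logarithm. -/
theorem exp_neg_add_half_le {y : ℝ} (h0 : 0 ≤ y) (h1 : y ≤ 1) : Real.exp (-y) + y / 2 ≤ 1 := by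
  have h2 : Real.exp (-y) ≤ (1 + y)⁻¹ := by
    rw [Real.exp_neg]
    exact inv_anti₀ (by linarith) (by linarith [Real.add_one_le_exp y])
  have h3 : (1 + y)⁻¹ ≤ 1 - y / 2 := by
    rw [inv_le_iff_one_le_mul₀ (by linarith)]
    nlinarith
  linarith

/-- The elliptical potential lemma along the data of a run. -/
theorem sum_featureNorm_le (hd : 0 < d) {f : S → A → Vec d} (hf : ∀ s a, ‖f s a‖ ≤ 1)
    (h : Fin H) {lam : ℝ} (hlam : 1 ≤ lam) {reg : ℕ → ℝ} (hreg : ∀ n, lam ≤ reg n) {Ω : Type*}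
    (ctx : ℕ → Ω → W) (smp : ℕ → Fin H → Ω → (S × A) × S) (N : ℕ) (ω : Ω) :
    ∑ n ∈ Finset.range N, featureNorm f h (reg n) (history ctx smp n ω) (smp n h ω).1 ≤
      2 * d * Real.log (1 + N / (lam * d)) := by
  refine le_trans (Finset.sum_le_sum fun n _ => ?_) (sum_sqNormInv_le hd
    (fun n => f (smp n h ω).1.1 (smp n h ω).1.2) (fun n => hf _ _) hlam N)
  refine (featureNorm_antitone f h (zero_lt_one.trans_le hlam) (hreg n) _ _).trans (le_of_eq ?_)
  rw [featureNorm, gram, Finset.sum_range]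
  rfl

variable [SigmaFinite ν] [Fintype A] [MeasurableSingletonClass A] [Nonempty A]
  {M : LinearCMDP S W A ν H d} {Ψ₂ : Finset (S → W → Vec d)} {Ψ₃ : Finset (W → Vec d)}
  {C γ₁ γ₂ δ : ℝ} {N : ℕ}
  {q : Measure W} [IsProbabilityMeasure q] {Ω : Type*} [MeasurableSpace Ω]
  {Pr : Measure Ω} [IsProbabilityMeasure Pr] {ctx : ℕ → Ω → W}
  {smp : ℕ → Fin H → Ω → (S × A) × S} {alg : Algorithm M Ψ₂ Ψ₃ C γ₁ γ₂ δ N}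

/-- With high probability the expected squared feature norms sum up to a logarithm. -/
theorem Algorithm.IsRun.measure_featureNorm_le (hrun : alg.IsRun q Pr ctx smp) (hd : 0 < d)
    {f : S → A → Vec d} (hfm : Measurable fun y : S × A => f y.1 y.2)
    (hf : ∀ s a, ‖f s a‖ ≤ 1) (h : Fin H) {lam : ℝ} (hlam : 1 ≤ lam) {reg : ℕ → ℝ}
    (hreg : ∀ n, lam ≤ reg n) {p : ℝ} (hp : 0 < p) :
    Pr {ω | 4 * d * Real.log (1 + N / (lam * d)) + 2 / lam * Real.log p⁻¹ <
      ∑ n ∈ Finset.range N, (alg.condMean q h n (history ctx smp n ω) (fun _ x =>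
        ENNReal.ofReal (featureNorm f h (reg n) (history ctx smp n ω) x.1))).toReal} ≤
      ENNReal.ofReal p := by
  have hlam0 : 0 < lam := zero_lt_one.trans_le hlam
  have hreg0 : ∀ n, 0 < reg n := fun n => hlam0.trans_le (hreg n)
  have hU : ∀ n, Measurable fun x : (Hist S W A H n × W) × (S × A) × S =>
      featureNorm f h (reg n) x.1.1 x.2.1 := fun n =>
    ((measurable_featureNorm hfm h (reg n) n).comp (measurable_fst.fst.prodMk measurable_snd.fst :
      Measurable fun x : (Hist S W A H n × W) × (S × A) × S => (x.1.1, x.2.1)) :)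
  -- The norms are at most `1 / lam`, so they are scaled by `lam` to lie in `[0, 1]`. The conclusion
  -- `(lam / 2) ∑ E[U | past] ≤ lam ∑ U + log (1 / p)`, divided by `lam / 2` and combined with the
  -- elliptical potential bound for `∑ U`, gives the stated threshold.
  have hmain := hrun.measure_expProcess_ge_le h
    (g := fun n D _ x => ENNReal.ofReal (Real.exp (-(lam * featureNorm f h (reg n) D x.1))))
    (F := fun n D _ x => ENNReal.ofReal (lam / 2) *
      ENNReal.ofReal (featureNorm f h (reg n) D x.1))
    (fun n => (Real.measurable_exp.comp ((hU n).const_mul lam).neg).ennreal_ofReal)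
    (fun n => (hU n).ennreal_ofReal.const_mul _)
    (fun n _ D => alg.condMean_le_one q h n D fun w x => by
      have h0 := featureNorm_nonneg f h (hreg0 n) D x.1
      have h1 : lam * featureNorm f h (reg n) D x.1 ≤ 1 := by
        have h2 := (featureNorm_antitone f h hlam0 (hreg n) D x.1).trans
          (featureNorm_le_inv hf h hlam0 D x.1)
        calc lam * featureNorm f h (reg n) D x.1 ≤ lam * lam⁻¹ :=
              mul_le_mul_of_nonneg_left h2 hlam0.le
          _ = 1 := mul_inv_cancel₀ hlam0.ne'
      rw [← ENNReal.ofReal_mul (by positivity), ← ENNReal.ofReal_add (Real.exp_pos _).le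
        (by positivity), ENNReal.ofReal_le_one]
      have h3 := exp_neg_add_half_le (by positivity) h1
      linarith) N le_rfl hp
  refine (measure_mono ?_).trans hmain
  intro ω hω
  have hpull : ∀ n, alg.condMean q h n (history ctx smp n ω) (fun _ x => ENNReal.ofReal (lam / 2) *
      ENNReal.ofReal (featureNorm f h (reg n) (history ctx smp n ω) x.1)) =
      ENNReal.ofReal (lam / 2) * alg.condMean q h n (history ctx smp n ω) (fun _ x =>
        ENNReal.ofReal (featureNorm f h (reg n) (history ctx smp n ω) x.1)) := fun n => by
    refine alg.condMean_const_mul q h n (history ctx smp n ω) _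
      (F := fun _ x => ENNReal.ofReal (featureNorm f h (reg n) (history ctx smp n ω) x.1)) ?_
    exact (((measurable_featureNorm_hist hfm h (reg n) (history ctx smp n ω)).comp
      (measurable_snd.fst : Measurable fun x : W × (S × A) × S => x.2.1)).ennreal_ofReal :)
  have hpot := sum_featureNorm_le hd hf h hlam hreg ctx smp N ω
  simp only [Set.mem_ofPred_eq] at hω ⊢
  simp only [hpull, ENNReal.toReal_mul, ENNReal.toReal_ofReal (show 0 ≤ lam / 2 by positivity)]
  rw [← Finset.mul_sum, ← ENNReal.ofReal_prod_of_nonneg fun _ _ => (Real.exp_pos _).le,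
    ← Real.exp_sum, ← ENNReal.ofReal_mul (Real.exp_pos _).le, ← Real.exp_add,
    Finset.sum_neg_distrib, ← Finset.mul_sum]
  refine ENNReal.ofReal_le_ofReal ((Real.log_le_iff_le_exp (by positivity)).1 ?_)
  have h1 : lam / 2 * (4 * d * Real.log (1 + N / (lam * d)) + 2 / lam * Real.log p⁻¹) ≤ _ :=
    mul_le_mul_of_nonneg_left hω.le (by positivity)
  have h2 : lam / 2 * (4 * d * Real.log (1 + N / (lam * d)) + 2 / lam * Real.log p⁻¹) =
      lam * (2 * d * Real.log (1 + N / (lam * d))) + Real.log p⁻¹ := by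
    field_simp
    ring
  rw [h2] at h1
  have h3 := mul_le_mul_of_nonneg_left hpot hlam0.le
  linarith

end Bonus

/-! ### Model errors and bonuses bounded by expectations over rollouts -/

section Gap

variable {S W A : Type*} [MeasurableSpace S] [MeasurableSpace W] [MeasurableSpace A]
  {ν : Measure S} {H d : ℕ} [SigmaFinite ν] [Fintype A] [MeasurableSingletonClass A]

/-- This is `(a l - 1)² ≥ 0`, written with the normalization `l² / 8` of `transErr`. Being linear in
the squared error, it survives all later integrations and sums without Cauchy–Schwarz; `a` is chosen
at the end. -/
theorem ennreal_le_mul_sq_add {a : ℝ} (ha : 0 < a) (l : ℝ≥0∞) :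
    l ≤ ENNReal.ofReal (4 * a) * (l ^ 2 / 8) + ENNReal.ofReal (1 / (2 * a)) := by
  induction l with
  | top =>
    have : ENNReal.ofReal (4 * a) * (∞ ^ 2 / 8) = ∞ := by
      rw [ENNReal.top_pow two_ne_zero, ENNReal.top_div_of_ne_top (by simp), ENNReal.mul_top]
      simpa using ha
    rw [this]
    simp
  | coe x =>
    have h8 : (8 : ℝ≥0∞) = ENNReal.ofReal 8 := by simp
    rw [← ENNReal.ofReal_coe_nnreal, h8, ← ENNReal.ofReal_pow x.coe_nonneg,
      ← ENNReal.ofReal_div_of_pos (by norm_num), ← ENNReal.ofReal_mul (by positivity),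
      ← ENNReal.ofReal_add (by positivity) (by positivity)]
    refine ENNReal.ofReal_le_ofReal ?_
    have h1 : 4 * a * ((x : ℝ) ^ 2 / 8) + 1 / (2 * a) - x = (a * x - 1) ^ 2 / (2 * a) := by
      field_simp
      ring
    have h2 : 0 ≤ (a * (x : ℝ) - 1) ^ 2 / (2 * a) := by positivity
    linarith

theorem abs_le_mul_sq_add {a : ℝ} (ha : 0 < a) (x : ℝ) : |x| ≤ a / 2 * x ^ 2 + 1 / (2 * a) := by
  have h1 : a / 2 * |x| ^ 2 + 1 / (2 * a) - |x| = (a * |x| - 1) ^ 2 / (2 * a) := by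
    field_simp
    ring
  have h2 : 0 ≤ (a * |x| - 1) ^ 2 / (2 * a) := by positivity
  rw [← sq_abs x]
  linarith

/-- The coefficient `12 H a` is the weight `3H` of the `L¹` distance times `4a`; the constant
collects `1 / (2a)` from the reward and `3H / (2a)` from the transition. -/
theorem LinearCMDP.stepError_le (M : LinearCMDP S W A ν H d) (m : Fin H → S → W → Vec d)
    (e : Fin H → W → Vec d) {a : ℝ} (ha : 0 < a) (w : W) (h : Fin H) (s : S) (b : A) :
    M.stepError m (fun h s b => M.clipReward (e h) w h s b) w h s b ≤
      ENNReal.ofReal (a / 2) * M.rewardErr h (e h) w (s, b) +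
        ENNReal.ofReal (12 * H * a) * M.transErr h (m h) w (s, b) +
          ENNReal.ofReal ((1 + 3 * H) / (2 * a)) := by
  have h1 : ENNReal.ofReal |M.reward h s b w - M.clipReward (e h) w h s b| ≤
      ENNReal.ofReal (a / 2) * M.rewardErr h (e h) w (s, b) + ENNReal.ofReal (1 / (2 * a)) := by
    rw [LinearCMDP.rewardErr, ← ENNReal.ofReal_mul (by positivity),
      ← ENNReal.ofReal_add (by positivity) (by positivity)]
    exact ENNReal.ofReal_le_ofReal (abs_le_mul_sq_add ha _)
  have h2 := mul_le_mul_right (ennreal_le_mul_sq_add ha (M.l1Dist h (m h) w s b))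
    (3 * (H : ℝ≥0∞))
  have h3 : (3 * (H : ℝ≥0∞)) = ENNReal.ofReal (3 * H) := by
    rw [ENNReal.ofReal_mul (by norm_num), ENNReal.ofReal_natCast]
    simp
  have h4 : ENNReal.ofReal (12 * H * a) = 3 * (H : ℝ≥0∞) * ENNReal.ofReal (4 * a) := by
    rw [h3, ← ENNReal.ofReal_mul (by positivity)]
    congr 1
    ring
  have h5 : ENNReal.ofReal ((1 + 3 * H) / (2 * a)) = ENNReal.ofReal (1 / (2 * a)) +
      3 * (H : ℝ≥0∞) * ENNReal.ofReal (1 / (2 * a)) := by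
    rw [h3, ← ENNReal.ofReal_mul (by positivity), ← ENNReal.ofReal_add (by positivity)
      (by positivity)]
    congr 1
    ring
  rw [h4, h5]
  refine (add_le_add h1 h2).trans_eq ?_
  simp only [LinearCMDP.transErr]
  ring

variable [Nonempty A]

/-- The change of measure is valid against each of the policies `π' τ`, hence against their average.
This is the source of the factor `1 / n`, since the sum over past rollouts is only logarithmic. -/
theorem LinearCMDP.BoundedStateDensity.lintegral_expect_le_average {M : LinearCMDP S W A ν H d}
    {pmin pmax : ℝ} (hM : M.BoundedStateDensity pmin pmax) (hmin : 0 < pmin)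
    (hle : pmin ≤ pmax) (w : W) (π : Policy S A H) (π' : ℕ → Policy S A H) {n : ℕ} (hn : 0 < n)
    (h : Fin H) {g : S × A → ℝ≥0∞} (hg : Measurable g) :
    ∫⁻ s, π.expect h s (fun a => g (s, a)) ∂(M.stateLaw w π h.castSucc) ≤
      ENNReal.ofReal (pmax / pmin * Fintype.card A / n) *
        ∑ τ ∈ Finset.range n, ∫⁻ x, g x.1 ∂(M.rollout w (π' τ) h) := by
  have hn0 : (0 : ℝ) < n := Nat.cast_pos.2 hn
  have hR : 0 ≤ pmax / pmin := div_nonneg (hmin.le.trans hle) hmin.le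
  have h1 := Finset.sum_le_sum fun τ (_ : τ ∈ Finset.range n) =>
    hM.lintegral_expect_le hmin hle w π (π' τ) h hg
  rw [Finset.sum_const, Finset.card_range, nsmul_eq_mul, ← Finset.mul_sum] at h1
  have h2 := mul_le_mul_right h1 (ENNReal.ofReal (1 / n))
  have h3 : ENNReal.ofReal (1 / n) * (n : ℝ≥0∞) = 1 := by
    rw [← ENNReal.ofReal_natCast, ← ENNReal.ofReal_mul (by positivity), one_div,
      inv_mul_cancel₀ hn0.ne', ENNReal.ofReal_one]
  rw [← mul_assoc, h3, one_mul, ← mul_assoc, ← ENNReal.ofReal_natCast (Fintype.card A),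
    ← ENNReal.ofReal_mul hR, ← ENNReal.ofReal_mul (by positivity)] at h2
  refine h2.trans_eq ?_
  congr 2
  ring

variable {M : LinearCMDP S W A ν H d} {Ψ₂ : Finset (S → W → Vec d)} {Ψ₃ : Finset (W → Vec d)}
  {C γ₁ γ₂ δ : ℝ} {N : ℕ}

theorem LinearCMDP.lintegral_stepError_le {pmin pmax : ℝ}
    (hM : M.BoundedStateDensity pmin pmax) (hmin : 0 < pmin) (hle : pmin ≤ pmax)
    {m : Fin H → S → W → Vec d} (hm : ∀ h, IsTransitionWeight ν (M.φ h) (m h))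
    {e : Fin H → W → Vec d} (he : ∀ h, Measurable (e h)) {a : ℝ} (ha : 0 < a) (w : W)
    (π : Policy S A H) (π' : ℕ → Policy S A H) {n : ℕ} (hn : 0 < n) (h : Fin H) :
    ∫⁻ s, π.expect h s (M.stepError m (fun h s b => M.clipReward (e h) w h s b) w h s)
        ∂(M.stateLaw w π h.castSucc) ≤
      ENNReal.ofReal (a / 2 * (pmax / pmin * Fintype.card A / n)) *
        ∑ τ ∈ Finset.range n, ∫⁻ x, M.rewardErr h (e h) w x.1 ∂(M.rollout w (π' τ) h) +
      ENNReal.ofReal (12 * H * a * (pmax / pmin * Fintype.card A / n)) *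
        ∑ τ ∈ Finset.range n, ∫⁻ x, M.transErr h (m h) w x.1 ∂(M.rollout w (π' τ) h) +
      ENNReal.ofReal ((1 + 3 * H) / (2 * a)) := by
  have hr : Measurable (M.rewardErr h (e h) w) :=
    ((M.measurable_rewardErr h (he h)).comp
      (measurable_prodMk_left : Measurable fun y : S × A => (w, y)) :)
  have ht : Measurable (M.transErr h (m h) w) :=
    ((M.measurable_transErr h (hm h).measurable).comp
      (measurable_prodMk_left : Measurable fun y : S × A => (w, y)) :)
  have hg1 : Measurable fun y => ENNReal.ofReal (a / 2) * M.rewardErr h (e h) w y :=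
    hr.const_mul _
  have hg2 : Measurable fun y => ENNReal.ofReal (12 * H * a) * M.transErr h (m h) w y :=
    ht.const_mul _
  have hr' : Measurable fun x : (S × A) × S => M.rewardErr h (e h) w x.1 :=
    hr.comp measurable_fst
  have ht' : Measurable fun x : (S × A) × S => M.transErr h (m h) w x.1 :=
    ht.comp measurable_fst
  have h1 : ∫⁻ s, π.expect h s (M.stepError m (fun h s b => M.clipReward (e h) w h s b) w h s)
        ∂(M.stateLaw w π h.castSucc) ≤
      ∫⁻ s, (π.expect h s (fun b => ENNReal.ofReal (a / 2) * M.rewardErr h (e h) w (s, b)) +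
        π.expect h s (fun b => ENNReal.ofReal (12 * H * a) * M.transErr h (m h) w (s, b)) +
          ENNReal.ofReal ((1 + 3 * H) / (2 * a))) ∂(M.stateLaw w π h.castSucc) := by
    refine lintegral_mono fun s => ?_
    refine (π.expect_mono h s fun b => M.stepError_le m e ha w h s b).trans_eq ?_
    rw [π.expect_add h s (fun b => ENNReal.ofReal (a / 2) * M.rewardErr h (e h) w (s, b) +
      ENNReal.ofReal (12 * H * a) * M.transErr h (m h) w (s, b)), π.expect_add,
      π.expect_const]
  have hm1 : Measurable fun s => π.expect h s (fun b => ENNReal.ofReal (a / 2) *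
      M.rewardErr h (e h) w (s, b)) :=
    π.measurable_expect h fun b => hg1.comp measurable_prodMk_right
  have hm2 : Measurable fun s => π.expect h s (fun b => ENNReal.ofReal (12 * H * a) *
      M.transErr h (m h) w (s, b)) :=
    π.measurable_expect h fun b => hg2.comp measurable_prodMk_right
  rw [lintegral_add_right _ measurable_const, lintegral_add_left hm1] at h1
  refine h1.trans (add_le_add (add_le_add ?_ ?_) (by simp))
  · refine (hM.lintegral_expect_le_average hmin hle w π π' hn h hg1).trans_eq ?_
    simp only [lintegral_const_mul _ hr', ← Finset.mul_sum]
    rw [ENNReal.ofReal_mul (show 0 ≤ a / 2 by positivity)]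
    ring
  · refine (hM.lintegral_expect_le_average hmin hle w π π' hn h hg2).trans_eq ?_
    simp only [lintegral_const_mul _ ht', ← Finset.mul_sum]
    rw [ENNReal.ofReal_mul (show 0 ≤ 12 * H * a by positivity)]
    ring

/-- The coefficient of the squared feature norms in the reward bonus. -/
def bonusCoeff (C : ℝ) (K d N : ℕ) : ℝ := 25 / (2 * √K) * C * √(d * N)

theorem bonusCoeff_nonneg (hC : 0 ≤ C) (K d N : ℕ) : 0 ≤ bonusCoeff C K d N := by
  rw [bonusCoeff]
  positivity

/-- The sum of the two bonuses. -/
def LinearCMDP.bonus (M : LinearCMDP S W A ν H d) (C γ₁ γ₂ δ : ℝ) (N : ℕ) {n : ℕ}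
    (D : Hist S W A H n) (h : Fin H) (s : S) (a : A) : ℝ :=
  M.bonusTrans C γ₁ δ N D h s a + M.bonusReward C γ₂ δ N D h s a

theorem LinearCMDP.measurable_bonus (M : LinearCMDP S W A ν H d) (C γ₁ γ₂ δ : ℝ) (N : ℕ) {n : ℕ}
    (D : Hist S W A H n) (h : Fin H) (a : A) :
    Measurable fun s => M.bonus C γ₁ γ₂ δ N D h s a := by
  have h1 := (measurable_featureNorm_hist (M.measurable_φ h) h (regularizer γ₁ δ d H (n + 1))
    D).comp (measurable_prodMk_right : Measurable fun s : S => (s, a))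
  have h2 := (measurable_featureNorm_hist (M.measurable_ψ h) h (regularizer γ₂ δ d H (n + 1))
    D).comp (measurable_prodMk_right : Measurable fun s : S => (s, a))
  exact (((h1.const_mul _).min measurable_const).add ((h2.const_mul _).min measurable_const) :)

theorem LinearCMDP.bonus_nonneg (M : LinearCMDP S W A ν H d) (hC : 0 ≤ C) {n : ℕ}
    (h₁ : 0 < regularizer γ₁ δ d H (n + 1)) (h₂ : 0 < regularizer γ₂ δ d H (n + 1)) (N : ℕ)
    (D : Hist S W A H n) (h : Fin H) (s : S) (a : A) : 0 ≤ M.bonus C γ₁ γ₂ δ N D h s a := by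
  have h3 := featureNorm_nonneg (M.φ h) h h₁ D (s, a)
  have h4 := featureNorm_nonneg (M.ψ h) h h₂ D (s, a)
  refine add_nonneg (le_min (mul_nonneg (by positivity) h3) (by positivity))
    (le_min (mul_nonneg (by positivity) h4) zero_le_one)

theorem LinearCMDP.bonus_le (M : LinearCMDP S W A ν H d) {n : ℕ} (C : ℝ) (N : ℕ)
    (D : Hist S W A H n) (h : Fin H) (s : S) (a : A) :
    M.bonus C γ₁ γ₂ δ N D h s a ≤
      bonusCoeff C (Fintype.card A) d N * H *
          featureNorm (M.φ h) h (regularizer γ₁ δ d H (n + 1)) D (s, a) +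
        bonusCoeff C (Fintype.card A) d N *
          featureNorm (M.ψ h) h (regularizer γ₂ δ d H (n + 1)) D (s, a) := by
  refine add_le_add ((min_le_left _ _).trans (le_of_eq ?_)) (min_le_left _ _)
  rw [bonusCoeff, featureNorm]
  ring

/-- The caps `H` and `1` of the bonuses are dropped. The roll-in policy of the rollout is `π`
itself, so only the factor `K` is lost. -/
theorem LinearCMDP.lintegral_bonus_le (M : LinearCMDP S W A ν H d) (hC : 0 ≤ C) {n : ℕ}
    (h₁ : 0 < regularizer γ₁ δ d H (n + 1)) (h₂ : 0 < regularizer γ₂ δ d H (n + 1)) (N : ℕ)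
    (D : Hist S W A H n) (h : Fin H) (w : W) (π : Policy S A H) :
    ∫⁻ s, π.expect h s (fun a => ENNReal.ofReal (M.bonus C γ₁ γ₂ δ N D h s a))
        ∂(M.stateLaw w π h.castSucc) ≤
      ENNReal.ofReal (Fintype.card A * (bonusCoeff C (Fintype.card A) d N * H)) *
        ∫⁻ x, ENNReal.ofReal (featureNorm (M.φ h) h (regularizer γ₁ δ d H (n + 1)) D x.1)
          ∂(M.rollout w π h) +
      ENNReal.ofReal (Fintype.card A * bonusCoeff C (Fintype.card A) d N) *
        ∫⁻ x, ENNReal.ofReal (featureNorm (M.ψ h) h (regularizer γ₂ δ d H (n + 1)) D x.1)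
          ∂(M.rollout w π h) := by
  have hb := bonusCoeff_nonneg hC (Fintype.card A) d N
  have h3 := (measurable_featureNorm_hist (M.measurable_φ h) h (regularizer γ₁ δ d H (n + 1))
    D).ennreal_ofReal
  have h4 := (measurable_featureNorm_hist (M.measurable_ψ h) h (regularizer γ₂ δ d H (n + 1))
    D).ennreal_ofReal
  have h3' : Measurable fun x : (S × A) × S => ENNReal.ofReal
    (featureNorm (M.φ h) h (regularizer γ₁ δ d H (n + 1)) D x.1) := h3.comp measurable_fst
  have h4' : Measurable fun x : (S × A) × S => ENNReal.ofReal
    (featureNorm (M.ψ h) h (regularizer γ₂ δ d H (n + 1)) D x.1) := h4.comp measurable_fst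
  have hg : Measurable fun y => ENNReal.ofReal (bonusCoeff C (Fintype.card A) d N * H) *
        ENNReal.ofReal (featureNorm (M.φ h) h (regularizer γ₁ δ d H (n + 1)) D y) +
      ENNReal.ofReal (bonusCoeff C (Fintype.card A) d N) *
        ENNReal.ofReal (featureNorm (M.ψ h) h (regularizer γ₂ δ d H (n + 1)) D y) :=
    (h3.const_mul _).add (h4.const_mul _)
  refine (lintegral_mono fun s => π.expect_mono h s fun a => ?_).trans
    ((M.lintegral_expect_le_rollout w π h hg).trans_eq ?_)
  · have h5 := featureNorm_nonneg (M.φ h) h h₁ D (s, a)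
    have h6 := featureNorm_nonneg (M.ψ h) h h₂ D (s, a)
    rw [← ENNReal.ofReal_mul (by positivity), ← ENNReal.ofReal_mul hb,
      ← ENNReal.ofReal_add (by positivity) (by positivity)]
    exact ENNReal.ofReal_le_ofReal (M.bonus_le C N D h s a)
  · rw [lintegral_add_left (h3'.const_mul _), lintegral_const_mul _ h3',
      lintegral_const_mul _ h4', ENNReal.ofReal_mul (Nat.cast_nonneg _),
      ENNReal.ofReal_mul (Nat.cast_nonneg _), ENNReal.ofReal_natCast]
    ring

end Gap

/-! ### The gap of one episode -/

section EpisodeGap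

variable {S W A : Type*} [MeasurableSpace S] [MeasurableSpace W] [MeasurableSpace A]
  {ν : Measure S} {H d : ℕ} [SigmaFinite ν] [Fintype A] [MeasurableSingletonClass A] [Nonempty A]
  {M : LinearCMDP S W A ν H d} {Ψ₂ : Finset (S → W → Vec d)} {Ψ₃ : Finset (W → Vec d)}
  {C γ₁ γ₂ δ : ℝ} {N : ℕ}

theorem LinearCMDP.optimisticReward_eq (M : LinearCMDP S W A ν H d) {n : ℕ} (D : Hist S W A H n)
    (e : Fin H → W → Vec d) (w : W) :
    M.optimisticReward C γ₁ γ₂ δ N D e w = fun h s a =>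
      M.clipReward (e h) w h s a + M.bonus C γ₁ γ₂ δ N D h s a := by
  funext h s a
  rw [LinearCMDP.optimisticReward, LinearCMDP.bonus, ← add_assoc]
  rfl

/-- The sub-optimality gap in a context, in terms of the errors of the estimates on the past
rollouts and of the bonuses in the next one. -/
theorem Algorithm.ofReal_gap_le (alg : Algorithm M Ψ₂ Ψ₃ C γ₁ γ₂ δ N)
    (hreal : M.Realizable Ψ₂ Ψ₃) {pmin pmax : ℝ} (hM : M.BoundedStateDensity pmin pmax)
    (hmin : 0 < pmin) (hle : pmin ≤ pmax) (hC : 0 ≤ C) {n : ℕ}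
    (h₁ : 0 < regularizer γ₁ δ d H (n + 1)) (h₂ : 0 < regularizer γ₂ δ d H (n + 1))
    (hn0 : 0 < n) (hnN : n < N) (D : Hist S W A H n) {a : ℝ} (ha : 0 < a) (w : W)
    (π' : ℕ → Policy S A H) :
    ENNReal.ofReal (M.optValue w - M.value w (alg.policy n D w)) ≤ ∑ h,
      (2 * (ENNReal.ofReal (a / 2 * (pmax / pmin * Fintype.card A / n)) *
        ∑ τ ∈ Finset.range n, ∫⁻ x, M.rewardErr h (alg.estReward n D h) w x.1
          ∂(M.rollout w (π' τ) h) +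
      ENNReal.ofReal (12 * H * a * (pmax / pmin * Fintype.card A / n)) *
        ∑ τ ∈ Finset.range n, ∫⁻ x, M.transErr h (alg.estTrans n D h) w x.1
          ∂(M.rollout w (π' τ) h) +
      ENNReal.ofReal ((1 + 3 * H) / (2 * a))) +
      (ENNReal.ofReal (Fintype.card A * (bonusCoeff C (Fintype.card A) d N * H)) *
        ∫⁻ x, ENNReal.ofReal (featureNorm (M.φ h) h (regularizer γ₁ δ d H (n + 1)) D x.1)
          ∂(M.rollout w (alg.policy n D w) h) +
      ENNReal.ofReal (Fintype.card A * bonusCoeff C (Fintype.card A) d N) *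
        ∫⁻ x, ENNReal.ofReal (featureNorm (M.ψ h) h (regularizer γ₂ δ d H (n + 1)) D x.1)
          ∂(M.rollout w (alg.policy n D w) h))) := by
  set B : Fin H → ℝ≥0∞ := fun h =>
    ENNReal.ofReal (a / 2 * (pmax / pmin * Fintype.card A / n)) *
        ∑ τ ∈ Finset.range n, ∫⁻ x, M.rewardErr h (alg.estReward n D h) w x.1
          ∂(M.rollout w (π' τ) h) +
      ENNReal.ofReal (12 * H * a * (pmax / pmin * Fintype.card A / n)) *
        ∑ τ ∈ Finset.range n, ∫⁻ x, M.transErr h (alg.estTrans n D h) w x.1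
          ∂(M.rollout w (π' τ) h) +
      ENNReal.ofReal ((1 + 3 * H) / (2 * a)) with hB
  set E : Fin H → ℝ≥0∞ := fun h =>
    ENNReal.ofReal (Fintype.card A * (bonusCoeff C (Fintype.card A) d N * H)) *
        ∫⁻ x, ENNReal.ofReal (featureNorm (M.φ h) h (regularizer γ₁ δ d H (n + 1)) D x.1)
          ∂(M.rollout w (alg.policy n D w) h) +
      ENNReal.ofReal (Fintype.card A * bonusCoeff C (Fintype.card A) d N) *
        ∫⁻ x, ENNReal.ofReal (featureNorm (M.ψ h) h (regularizer γ₂ δ d H (n + 1)) D x.1)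
          ∂(M.rollout w (alg.policy n D w) h) with hE
  change _ ≤ ∑ h, (2 * B h + E h)
  have hm : ∀ h, IsTransitionWeight ν (M.φ h) (alg.estTrans n D h) := fun h =>
    hreal.transition _ (alg.estTrans_mem n D h hn0 hnN) h
  have he : ∀ h, Measurable (alg.estReward n D h) := fun h =>
    hreal.measurable _ (alg.estReward_mem n D h hn0 hnN)
  have hr : ∀ (h : Fin H) (b : A), Measurable fun s =>
      M.clipReward (alg.estReward n D h) w h s b := fun h b =>
    ((M.measurable_clipReward h (he h)).comp
      (measurable_const.prodMk (measurable_id.prodMk measurable_const) :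
        Measurable fun s : S => (w, (s, b))) :)
  have hβ := M.measurable_bonus C γ₁ γ₂ δ N D
  have hstep : ∀ (π : Policy S A H) h, ∫⁻ s, π.expect h s (M.stepError (alg.estTrans n D)
      (fun h s b => M.clipReward (alg.estReward n D h) w h s b) w h s)
        ∂(M.stateLaw w π h.castSucc) ≤ B h := fun π h =>
    M.lintegral_stepError_le hM hmin hle hm he ha w π π' hn0 h
  -- The model error `B h` bounds the error under every policy. It is paid once under the competitor
  -- and once under the played policy, hence the factor two; the bonuses are paid only under the
  -- played policy.
  have hmain : ∀ π, ENNReal.ofReal (M.value w π) ≤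
      ENNReal.ofReal (M.value w (alg.policy n D w)) + ∑ h, (2 * B h + E h) := fun π => by
    have hmax := alg.policy_max n D w hn0 hnN π
    rw [M.optimisticReward_eq] at hmax
    refine (M.value_le_of_truncValue_le hm hr hβ (fun h s b => M.clipReward_nonneg _ _ _ _ _)
      (M.bonus_nonneg hC h₁ h₂ N D) w hmax).trans (add_le_add le_rfl ?_)
    have h1 : M.total w π (M.stepError (alg.estTrans n D)
        (fun h s b => M.clipReward (alg.estReward n D h) w h s b) w) ≤ ∑ h, B h :=
      Finset.sum_le_sum fun h _ => hstep π h
    have h2 : M.total w (alg.policy n D w) (fun h s b => M.stepError (alg.estTrans n D)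
        (fun h s b => M.clipReward (alg.estReward n D h) w h s b) w h s b +
          ENNReal.ofReal (M.bonus C γ₁ γ₂ δ N D h s b)) ≤ ∑ h, (B h + E h) := by
      refine Finset.sum_le_sum fun h _ => ?_
      simp only [Policy.expect_add]
      rw [lintegral_add_left ((alg.policy n D w).measurable_expect h
        (M.measurable_stepError hm hr w h))]
      exact add_le_add (hstep _ h) (M.lintegral_bonus_le hC h₁ h₂ N D h w _)
    refine (add_le_add h1 h2).trans_eq ?_
    rw [← Finset.sum_add_distrib]
    refine Finset.sum_congr rfl fun h _ => ?_
    ring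
  rw [ENNReal.ofReal_sub _ (M.value_nonneg w _), tsub_le_iff_left]
  obtain ⟨π, hπ⟩ := M.exists_toGo_eq_optToGo w
  rw [M.ofReal_optValue, ← hπ, M.toGo_zero w π (M.measurable_ereward w), ← M.ofReal_value]
  exact hmain π

variable {q : Measure W} [IsProbabilityMeasure q] {Ω : Type*}

/-- Exchanges the integral over the contexts with the finite sums of the gap bound, so that
integrals over rollouts turn into the conditional means `condMean`. -/
theorem lintegral_sum_combination (q : Measure W) [IsProbabilityMeasure q] {ι κ : Type*}
    [Fintype ι] (s : Finset κ) {R T : ι → κ → W → ℝ≥0∞} {U V : ι → W → ℝ≥0∞}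
    (hR : ∀ i k, Measurable (R i k)) (hT : ∀ i k, Measurable (T i k))
    (hU : ∀ i, Measurable (U i)) (hV : ∀ i, Measurable (V i)) (c₁ c₂ c₃ c₄ c₅ : ℝ≥0∞) :
    ∫⁻ w, ∑ i, (2 * (c₁ * ∑ k ∈ s, R i k w + c₂ * ∑ k ∈ s, T i k w + c₃) +
        (c₄ * U i w + c₅ * V i w)) ∂q =
      ∑ i, (2 * (c₁ * ∑ k ∈ s, ∫⁻ w, R i k w ∂q + c₂ * ∑ k ∈ s, ∫⁻ w, T i k w ∂q + c₃) +
        (c₄ * ∫⁻ w, U i w ∂q + c₅ * ∫⁻ w, V i w ∂q)) := by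
  have hRs : ∀ i, Measurable fun w => ∑ k ∈ s, R i k w := fun i =>
    Finset.measurable_sum _ fun k _ => hR i k
  have hTs : ∀ i, Measurable fun w => ∑ k ∈ s, T i k w := fun i =>
    Finset.measurable_sum _ fun k _ => hT i k
  have hA : ∀ i, Measurable fun w => c₁ * ∑ k ∈ s, R i k w + c₂ * ∑ k ∈ s, T i k w := fun i =>
    ((hRs i).const_mul _).add ((hTs i).const_mul _)
  have hA' : ∀ i, Measurable fun w => c₁ * ∑ k ∈ s, R i k w + c₂ * ∑ k ∈ s, T i k w + c₃ :=
    fun i => (hA i).add_const _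
  have hB : ∀ i, Measurable fun w => c₄ * U i w + c₅ * V i w := fun i =>
    ((hU i).const_mul _).add ((hV i).const_mul _)
  have hAB : ∀ i, Measurable fun w => 2 * (c₁ * ∑ k ∈ s, R i k w + c₂ * ∑ k ∈ s, T i k w + c₃) +
      (c₄ * U i w + c₅ * V i w) := fun i => ((hA' i).const_mul 2).add (hB i)
  rw [lintegral_finsetSum _ fun i _ => hAB i]
  refine Finset.sum_congr rfl fun i _ => ?_
  rw [lintegral_add_left ((hA' i).const_mul 2), lintegral_const_mul 2 (hA' i),
    lintegral_add_left (hA i), lintegral_add_left ((hRs i).const_mul _),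
    lintegral_const_mul _ (hRs i), lintegral_const_mul _ (hTs i),
    lintegral_finsetSum _ (fun k _ => hR i k), lintegral_finsetSum _ (fun k _ => hT i k),
    lintegral_add_left ((hU i).const_mul _), lintegral_const_mul _ (hU i),
    lintegral_const_mul _ (hV i)]
  simp

/-- The expected sub-optimality gap of an episode. -/
theorem Algorithm.integral_gap_le (alg : Algorithm M Ψ₂ Ψ₃ C γ₁ γ₂ δ N)
    (hreal : M.Realizable Ψ₂ Ψ₃) {pmin pmax : ℝ} (hM : M.BoundedStateDensity pmin pmax)
    (hmin : 0 < pmin) (hle : pmin ≤ pmax) (hC : 0 ≤ C) {n : ℕ}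
    (h₁ : 0 < regularizer γ₁ δ d H (n + 1)) (h₂ : 0 < regularizer γ₂ δ d H (n + 1))
    (hn0 : 0 < n) (hnN : n < N) {a : ℝ} (ha : 0 < a)
    (ctx : ℕ → Ω → W) (smp : ℕ → Fin H → Ω → (S × A) × S) (ω : Ω) :
    ∫ w, (M.optValue w - M.value w (alg.policy n (history ctx smp n ω) w)) ∂q ≤ ∑ h,
      (2 * (a / 2 * (pmax / pmin * Fintype.card A / n) *
        ∑ τ ∈ Finset.range n, (alg.condMean q h τ (history ctx smp τ ω) (fun w x =>
          M.rewardErr h (alg.estReward n (history ctx smp n ω) h) w x.1)).toReal +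
      12 * H * a * (pmax / pmin * Fintype.card A / n) *
        ∑ τ ∈ Finset.range n, (alg.condMean q h τ (history ctx smp τ ω) (fun w x =>
          M.transErr h (alg.estTrans n (history ctx smp n ω) h) w x.1)).toReal +
      (1 + 3 * H) / (2 * a)) +
      (Fintype.card A * (bonusCoeff C (Fintype.card A) d N * H) *
        (alg.condMean q h n (history ctx smp n ω) (fun _ x => ENNReal.ofReal
          (featureNorm (M.φ h) h (regularizer γ₁ δ d H (n + 1))
            (history ctx smp n ω) x.1))).toReal +
      Fintype.card A * bonusCoeff C (Fintype.card A) d N *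
        (alg.condMean q h n (history ctx smp n ω) (fun _ x => ENNReal.ofReal
          (featureNorm (M.ψ h) h (regularizer γ₂ δ d H (n + 1))
            (history ctx smp n ω) x.1))).toReal)) := by
  have hb := bonusCoeff_nonneg hC (Fintype.card A) d N
  have hR : 0 ≤ pmax / pmin := div_nonneg (hmin.le.trans hle) hmin.le
  set D := history ctx smp n ω with hD
  have hm : ∀ h, IsTransitionWeight ν (M.φ h) (alg.estTrans n D h) := fun h =>
    hreal.transition _ (alg.estTrans_mem n D h hn0 hnN) h
  have he : ∀ h, Measurable (alg.estReward n D h) := fun h =>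
    hreal.measurable _ (alg.estReward_mem n D h hn0 hnN)
  have hgap0 : ∀ w, 0 ≤ M.optValue w - M.value w (alg.policy n D w) := fun w =>
    sub_nonneg.2 (M.value_le_optValue w _)
  have hintegr := M.integrable_gap q (alg.measurable_policy_context n D)
  have hRm : ∀ h τ, Measurable fun w => ∫⁻ x, M.rewardErr h (alg.estReward n D h) w x.1
      ∂(M.rollout w (alg.policy τ (history ctx smp τ ω) w) h) := fun h τ =>
    alg.measurable_lintegral_rollout_context τ (history ctx smp τ ω) h
      (F := fun w x => M.rewardErr h (alg.estReward n D h) w x.1)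
      (measurable_fst_pair (M.measurable_rewardErr h (he h)))
  have hTm : ∀ h τ, Measurable fun w => ∫⁻ x, M.transErr h (alg.estTrans n D h) w x.1
      ∂(M.rollout w (alg.policy τ (history ctx smp τ ω) w) h) := fun h τ =>
    alg.measurable_lintegral_rollout_context τ (history ctx smp τ ω) h
      (F := fun w x => M.transErr h (alg.estTrans n D h) w x.1)
      (measurable_fst_pair (M.measurable_transErr h (hm h).measurable))
  have hfeat : ∀ {f : S → A → Vec d}, (Measurable fun y : S × A => f y.1 y.2) → ∀ h lam,
      Measurable fun w => ∫⁻ x, ENNReal.ofReal (featureNorm f h lam D x.1)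
        ∂(M.rollout w (alg.policy n D w) h) := fun {f} hf h lam =>
    alg.measurable_lintegral_rollout_context n D h
      (F := fun _ x => ENNReal.ofReal (featureNorm f h lam D x.1))
      (((measurable_featureNorm_hist hf h lam D).comp
        (measurable_snd.fst : Measurable fun x : W × (S × A) × S => x.2.1)).ennreal_ofReal :)
  have hRfin : ∀ h τ, alg.condMean q h τ (history ctx smp τ ω) (fun w x =>
      M.rewardErr h (alg.estReward n D h) w x.1) ≠ ∞ := fun h τ =>
    ne_top_of_le_ne_top ENNReal.one_ne_top
      (alg.condMean_le_one q h τ _ fun w x => M.rewardErr_le_one h _ w x.1)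
  -- Finiteness comes from the Hellinger inequality, which bounds this conditional mean by one.
  have hTfin : ∀ h τ, alg.condMean q h τ (history ctx smp τ ω) (fun w x =>
      M.transErr h (alg.estTrans n D h) w x.1) ≠ ∞ := fun h τ => by
    refine ne_top_of_le_ne_top ENNReal.one_ne_top (le_trans ?_
      (alg.condMean_sqrtRatio_add_le (q := q) h (hm h) τ (history ctx smp τ ω)))
    exact lintegral_mono fun w => lintegral_mono fun x => le_add_self
  have hUfin : ∀ {f : S → A → Vec d}, (∀ s a, ‖f s a‖ ≤ 1) → ∀ h {lam : ℝ}, 0 < lam →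
      alg.condMean q h n D (fun _ x => ENNReal.ofReal (featureNorm f h lam D x.1)) ≠ ∞ :=
    fun {f} hf h {lam} hlam => by
    have hc : ∀ w, ∫⁻ x, ENNReal.ofReal (featureNorm f h lam D x.1)
        ∂(M.rollout w (alg.policy n D w) h) ≤ ENNReal.ofReal lam⁻¹ := fun w => by
      have := M.isProbabilityMeasure_rollout w (alg.policy n D w) h
      refine (lintegral_mono (g := fun _ => ENNReal.ofReal lam⁻¹) fun (x : (S × A) × S) =>
        ENNReal.ofReal_le_ofReal (featureNorm_le_inv hf h hlam D x.1)).trans ?_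
      simp
    refine ne_top_of_le_ne_top (ENNReal.ofReal_ne_top (r := lam⁻¹))
      ((lintegral_mono hc).trans ?_)
    simp
  have hkey : ENNReal.ofReal (∫ w, (M.optValue w - M.value w (alg.policy n D w)) ∂q) ≤ ∑ h,
      (2 * (ENNReal.ofReal (a / 2 * (pmax / pmin * Fintype.card A / n)) *
        ∑ τ ∈ Finset.range n, alg.condMean q h τ (history ctx smp τ ω) (fun w x =>
          M.rewardErr h (alg.estReward n D h) w x.1) +
      ENNReal.ofReal (12 * H * a * (pmax / pmin * Fintype.card A / n)) *
        ∑ τ ∈ Finset.range n, alg.condMean q h τ (history ctx smp τ ω) (fun w x =>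
          M.transErr h (alg.estTrans n D h) w x.1) +
      ENNReal.ofReal ((1 + 3 * H) / (2 * a))) +
      (ENNReal.ofReal (Fintype.card A * (bonusCoeff C (Fintype.card A) d N * H)) *
        alg.condMean q h n D (fun _ x => ENNReal.ofReal
          (featureNorm (M.φ h) h (regularizer γ₁ δ d H (n + 1)) D x.1)) +
      ENNReal.ofReal (Fintype.card A * bonusCoeff C (Fintype.card A) d N) *
        alg.condMean q h n D (fun _ x => ENNReal.ofReal
          (featureNorm (M.ψ h) h (regularizer γ₂ δ d H (n + 1)) D x.1)))) := by
    rw [ofReal_integral_eq_lintegral_ofReal hintegr (Filter.Eventually.of_forall hgap0)]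
    -- The comparison policies are those of the past episodes at the same context `w`; the density
    -- bounds compare policies only within one context.
    refine (lintegral_mono fun w => alg.ofReal_gap_le hreal hM hmin hle hC h₁ h₂ hn0 hnN D ha w
      (fun τ => alg.policy τ (history ctx smp τ ω) w)).trans_eq ?_
    exact lintegral_sum_combination q (Finset.range n) hRm hTm
      (fun h => hfeat (M.measurable_φ h) h (regularizer γ₁ δ d H (n + 1)))
      (fun h => hfeat (M.measurable_ψ h) h (regularizer γ₂ δ d H (n + 1))) _ _ _ _ _
  refine (ENNReal.ofReal_le_ofReal_iff (Finset.sum_nonneg fun h _ => by positivity)).1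
    (hkey.trans_eq ?_)
  rw [ENNReal.ofReal_sum_of_nonneg fun h _ => by positivity]
  refine Finset.sum_congr rfl fun h _ => ?_
  rw [ENNReal.ofReal_add (by positivity) (by positivity),
    ENNReal.ofReal_mul (show (0 : ℝ) ≤ 2 by norm_num), ENNReal.ofReal_add (by positivity)
      (by positivity), ENNReal.ofReal_add (by positivity) (by positivity),
    ENNReal.ofReal_add (by positivity) (by positivity),
    ENNReal.ofReal_mul (by positivity) (q := ∑ τ ∈ Finset.range n, _),
    ENNReal.ofReal_mul (by positivity) (q := ∑ τ ∈ Finset.range n, _),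
    ENNReal.ofReal_mul (by positivity) (q := ENNReal.toReal _),
    ENNReal.ofReal_mul (by positivity) (q := ENNReal.toReal _),
    ENNReal.ofReal_sum_of_nonneg fun τ _ => ENNReal.toReal_nonneg,
    ENNReal.ofReal_sum_of_nonneg fun τ _ => ENNReal.toReal_nonneg,
    ENNReal.ofReal_toReal (hUfin (M.norm_φ_le h) h h₁),
    ENNReal.ofReal_toReal (hUfin (M.norm_ψ_le h) h h₂)]
  simp only [fun τ => ENNReal.ofReal_toReal (hRfin h τ), fun τ => ENNReal.ofReal_toReal (hTfin h τ),
    ENNReal.ofReal_ofNat]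

end EpisodeGap

/-! ### Summation over the episodes and numerical constants -/

section Arithmetic

/-- By `1 / √(N + 1) ≤ 2 (√(N + 1) - √N)`. The term of index zero is `1 / 0 = 0`. -/
theorem sum_one_div_sqrt_le (N : ℕ) : ∑ n ∈ Finset.range N, 1 / √(n : ℝ) ≤ 2 * √(N : ℝ) := by
  have hsucc : ∀ N : ℕ, ∑ n ∈ Finset.range (N + 1), 1 / √(n : ℝ) ≤ 2 * √(N : ℝ) := by
    intro N
    induction N with
    | zero => simp
    | succ N ih =>
      rw [Finset.sum_range_succ]
      refine (add_le_add ih le_rfl).trans ?_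
      have h1 : (0 : ℝ) < √((N + 1 : ℕ) : ℝ) := Real.sqrt_pos.2 (by positivity)
      have h2 : √((N + 1 : ℕ) : ℝ) ^ 2 = N + 1 := by
        rw [Real.sq_sqrt (by positivity)]
        push_cast
        ring
      have h3 : √(N : ℝ) ^ 2 = N := Real.sq_sqrt (by positivity)
      rw [← le_sub_iff_add_le', div_le_iff₀ h1]
      nlinarith [sq_nonneg (√((N + 1 : ℕ) : ℝ) - √(N : ℝ))]
  cases N with
  | zero => simp
  | succ N =>
    refine (hsucc N).trans (mul_le_mul_of_nonneg_left (Real.sqrt_le_sqrt ?_) (by norm_num))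
    push_cast
    linarith

/-- In the first episode there are no data and the policy is arbitrary, so it is charged the trivial
bound `B`; the term `1 / √0` vanishes there. -/
theorem sum_gap_le {gap β : ℕ → ℝ} {N : ℕ} {B c : ℝ} (hB : 0 ≤ B) (hβ : ∀ n, 0 ≤ β n) (hc : 0 ≤ c)
    (h0 : gap 0 ≤ B) (hgap : ∀ n, 0 < n → n < N → gap n ≤ c * (1 / √(n : ℝ)) + β n) :
    ∑ n ∈ Finset.range N, gap n ≤ B + c * (2 * √(N : ℝ)) + ∑ n ∈ Finset.range N, β n := by
  have h1 : ∀ n ∈ Finset.range N, gap n ≤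
      (if n = 0 then B else 0) + (c * (1 / √(n : ℝ)) + β n) := by
    intro n hn
    rcases Nat.eq_zero_or_pos n with rfl | hpos
    · simpa using h0.trans (le_add_of_nonneg_right (hβ 0))
    · rw [if_neg hpos.ne', zero_add]
      exact hgap n hpos (Finset.mem_range.1 hn)
  refine (Finset.sum_le_sum h1).trans ?_
  rw [Finset.sum_add_distrib, Finset.sum_add_distrib, ← Finset.mul_sum, ← add_assoc]
  refine add_le_add (add_le_add ?_ (mul_le_mul_of_nonneg_left (sum_one_div_sqrt_le N) hc)) le_rfl
  rw [Finset.sum_ite_eq']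
  split_ifs <;> simp [hB]

/-- Here `m`, `k`, `D` stand for `√n`, `√K`, `√d`, and `m / (6 C k D)` is the chosen value of the
parameter `a`. With it the quadratic terms and the constant term are all of order `1 / √n`. -/
theorem episode_error_le {C k D m r t L₂ L₃ : ℝ} (H : ℕ) (hC : 0 < C) (hk : 0 < k) (hD : 0 < D)
    (hm : 0 < m) (hr : r ≤ L₃) (ht : t ≤ L₂) :
    2 * (m / (6 * C * (k * D)) / 2 * (C ^ 2 * k ^ 2 / m ^ 2) * r +
      12 * H * (m / (6 * C * (k * D))) * (C ^ 2 * k ^ 2 / m ^ 2) * t +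
      (1 + 3 * H) / (2 * (m / (6 * C * (k * D))))) ≤
    C * k * (L₃ / (6 * D) + 4 * H * L₂ / D + 6 * (1 + 3 * H) * D) * (1 / m) := by
  have h1 : C * k * (L₃ / (6 * D) + 4 * H * L₂ / D + 6 * (1 + 3 * H) * D) * (1 / m) =
    2 * (m / (6 * C * (k * D)) / 2 * (C ^ 2 * k ^ 2 / m ^ 2) * L₃ +
      12 * H * (m / (6 * C * (k * D))) * (C ^ 2 * k ^ 2 / m ^ 2) * L₂ +
      (1 + 3 * H) / (2 * (m / (6 * C * (k * D))))) := by
    field_simp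
    ring
  rw [h1]
  gcongr

theorem regularizer_one_le {γ δ : ℝ} (hγ : 0 ≤ γ) (hδ : 0 < δ) {H : ℕ} (hH : 1 ≤ H) (d : ℕ) {n : ℕ}
    (hn : 1 ≤ n) : regularizer γ δ d H 1 ≤ regularizer γ δ d H n := by
  have hH0 : (0 : ℝ) < H := Nat.cast_pos.2 hH
  have hn1 : (1 : ℝ) ≤ n := Nat.one_le_cast.2 hn
  rw [regularizer, regularizer]
  refine mul_le_mul_of_nonneg_left (Real.log_le_log (by simp; positivity) ?_) (by positivity)
  refine div_le_div_of_nonneg_right ?_ hδ.le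
  refine mul_le_mul_of_nonneg_right ?_ hH0.le
  simpa using hn1

theorem half_le_log_two_mul_div {δ : ℝ} (hδ : 0 < δ) (hδ1 : δ < 1) {x : ℝ} (hx : 1 ≤ x) :
    1 / 2 ≤ Real.log (2 * x / δ) := by
  have h1 : (2 : ℝ) ≤ 2 * x / δ := by
    rw [le_div_iff₀ hδ]
    nlinarith
  have h2 := Real.log_le_log (by norm_num) h1
  linarith [Real.log_two_gt_d9]

/-- The bound on the gap is trivial if there are few episodes. -/
theorem le_gapBound_of_le {C γ₁ γ₂ δ : ℝ} {H d K N k₂ k₃ : ℕ} (hC : 1 ≤ C) (hγ₁ : 0 ≤ γ₁)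
    (hγ₂ : 0 ≤ γ₂) (hδ : 0 < δ) (hδ1 : δ < 1) (hH : 1 ≤ H) (hd : 1 ≤ d) (hK : 1 ≤ K) (hN : 1 ≤ N)
    (hk₂ : 1 ≤ k₂) (hk₃ : 1 ≤ k₃)
    (hle : (N : ℝ) ≤ min (regularizer γ₁ δ d H 1) (regularizer γ₂ δ d H 1)) :
    (H : ℝ) ≤ gapBound C γ₁ γ₂ δ H d K N k₂ k₃ := by
  set lam := min (regularizer γ₁ δ d H 1) (regularizer γ₂ δ d H 1) with hlam
  have hC0 : 0 < C := zero_lt_one.trans_le hC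
  have hH1 : (1 : ℝ) ≤ H := Nat.one_le_cast.2 hH
  have hd1 : (1 : ℝ) ≤ d := Nat.one_le_cast.2 hd
  have hK1 : (1 : ℝ) ≤ K := Nat.one_le_cast.2 hK
  have hN1 : (1 : ℝ) ≤ N := Nat.one_le_cast.2 hN
  have hk21 : (1 : ℝ) ≤ k₂ := Nat.one_le_cast.2 hk₂
  have hk31 : (1 : ℝ) ≤ k₃ := Nat.one_le_cast.2 hk₃
  have hlam0 : 0 < lam := by linarith
  have hL₂ : 1 / 2 ≤ Real.log (2 * H * N * k₂ / δ) := by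
    have h1 : (1 : ℝ) ≤ H * N * k₂ :=
      one_le_mul_of_one_le_of_one_le (one_le_mul_of_one_le_of_one_le hH1 hN1) hk21
    have := half_le_log_two_mul_div hδ hδ1 h1
    rwa [show (2 : ℝ) * H * N * k₂ = 2 * (H * N * k₂) by ring]
  have hL₃ : 1 / 2 ≤ Real.log (2 * H * N * k₃ / δ) := by
    have h1 : (1 : ℝ) ≤ H * N * k₃ :=
      one_le_mul_of_one_le_of_one_le (one_le_mul_of_one_le_of_one_le hH1 hN1) hk31
    have := half_le_log_two_mul_div hδ hδ1 h1
    rwa [show (2 : ℝ) * H * N * k₃ = 2 * (H * N * k₃) by ring]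
  have hr1 : lam ≤ regularizer γ₁ δ d H N :=
    (min_le_left _ _).trans (regularizer_one_le hγ₁ hδ hH d hN)
  have hr2 : lam ≤ regularizer γ₂ δ d H N :=
    (min_le_right _ _).trans (regularizer_one_le hγ₂ hδ hH d hN)
  have hfirst : 0 ≤ 912 * C * (H : ℝ) ^ 2 * √((d : ℝ) ^ 3 * K / N) *
      Real.log (1 + N / (lam * d)) := by
    have : 0 ≤ Real.log (1 + N / (lam * d)) :=
      Real.log_nonneg (le_add_of_nonneg_right (by positivity))
    positivity
  have hx : 0 < √((K : ℝ) / (d * N)) := Real.sqrt_pos.2 (by positivity)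
  -- The product under the root is `K lam / N`, at least one because there are few episodes.
  have hprod : 1 ≤ √((K : ℝ) / (d * N)) * √(lam * d) := by
    rw [← Real.sqrt_mul (by positivity), Real.one_le_sqrt]
    have h1 : (K : ℝ) / (d * N) * (lam * d) = K * (lam / N) := by
      field_simp
    rw [h1]
    exact one_le_mul_of_one_le_of_one_le hK1 ((one_le_div (by linarith)).2 hle)
  have hsq : √(lam * d) ^ 2 = lam * d := Real.sq_sqrt (by positivity)
  -- The bracket is at least a multiple of `C² + lam d`, so the inequality of the means gives `C
  -- √(lam d)`. This case is where the regularizers in the bound are needed.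
  have hbr : C * √(lam * d) ≤ 2 * regularizer γ₂ δ d H N * d +
      C ^ 2 * Real.log (2 * H * N * k₃ / δ) + 4 * regularizer γ₁ δ d H N * d +
        8 * C ^ 2 * Real.log (2 * H * N * k₂ / δ) := by
    have h1 : lam * d ≤ regularizer γ₂ δ d H N * d :=
      mul_le_mul_of_nonneg_right hr2 (by positivity)
    have h2 : lam * d ≤ regularizer γ₁ δ d H N * d :=
      mul_le_mul_of_nonneg_right hr1 (by positivity)
    have h3 : C ^ 2 * (1 / 2) ≤ C ^ 2 * Real.log (2 * H * N * k₃ / δ) :=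
      mul_le_mul_of_nonneg_left hL₃ (by positivity)
    have h4 : C ^ 2 * (1 / 2) ≤ C ^ 2 * Real.log (2 * H * N * k₂ / δ) :=
      mul_le_mul_of_nonneg_left hL₂ (by positivity)
    nlinarith [sq_nonneg (C - √(lam * d)), sq_nonneg C, sq_nonneg (√(lam * d))]
  rw [gapBound, ← hlam]
  refine le_trans ?_ (le_add_of_nonneg_left hfirst)
  calc (H : ℝ) ≤ (H : ℝ) ^ 2 * 1 := by nlinarith
    _ ≤ (H : ℝ) ^ 2 * (√((K : ℝ) / (d * N)) * √(lam * d)) :=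
      mul_le_mul_of_nonneg_left hprod (by positivity)
    _ = (H : ℝ) ^ 2 / C * √((K : ℝ) / (d * N)) * (C * √(lam * d)) := by
      field_simp
    _ ≤ _ := mul_le_mul_of_nonneg_left hbr (by positivity)

set_option maxHeartbeats 400000 in
/-- The sum of the contributions to the gap is at most the bound if there are many episodes. -/
theorem le_gapBound_of_lt {C γ₁ γ₂ δ P : ℝ} {H d K N k₂ k₃ : ℕ} (hC : 1 ≤ C) (hγ₁ : 100 ≤ γ₁)
    (hγ₂ : 100 ≤ γ₂) (hδ : 0 < δ) (hδ1 : δ < 1) (hH : 1 ≤ H) (hd : 1 ≤ d) (hK : 1 ≤ K)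
    (hN : 1 ≤ N) (hk₃ : 1 ≤ k₃)
    (hlt : min (regularizer γ₁ δ d H 1) (regularizer γ₂ δ d H 1) < (N : ℝ))
    (hP : P = 4 * d * Real.log (1 + N / (min (regularizer γ₁ δ d H 1)
      (regularizer γ₂ δ d H 1) * d)) + 2 / min (regularizer γ₁ δ d H 1)
      (regularizer γ₂ δ d H 1) * Real.log (δ / (4 * H))⁻¹) :
    1 / (N : ℝ) * (H + H * (C * √K * (Real.log (2 * H * N * k₃ / δ) / (6 * √d) +
      4 * H * Real.log (2 * H * N * k₂ / δ) / √d + 6 * (1 + 3 * H) * √d)) * (2 * √N) +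
      H * (K * (bonusCoeff C K d N * H) * P + K * bonusCoeff C K d N * P)) ≤
    gapBound C γ₁ γ₂ δ H d K N k₂ k₃ := by
  set lam := min (regularizer γ₁ δ d H 1) (regularizer γ₂ δ d H 1) with hlam
  have hC0 : 0 < C := zero_lt_one.trans_le hC
  have hH1 : (1 : ℝ) ≤ H := Nat.one_le_cast.2 hH
  have hd1 : (1 : ℝ) ≤ d := Nat.one_le_cast.2 hd
  have hK1 : (1 : ℝ) ≤ K := Nat.one_le_cast.2 hK
  have hN1 : (1 : ℝ) ≤ N := Nat.one_le_cast.2 hN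
  have hk31 : (1 : ℝ) ≤ k₃ := Nat.one_le_cast.2 hk₃
  have hLH := half_le_log_two_mul_div hδ hδ1 hH1
  set LH := Real.log (2 * H / δ) with hLHdef
  have hreg : ∀ γ : ℝ, 100 ≤ γ → 100 * (d * LH) ≤ regularizer γ δ d H 1 := fun γ hγ => by
    rw [regularizer, Nat.cast_one, mul_one, mul_assoc]
    exact mul_le_mul_of_nonneg_right hγ (by positivity)
  have hlam100 : 100 * (d * LH) ≤ lam := le_min (hreg γ₁ hγ₁) (hreg γ₂ hγ₂)
  have hdLH : LH ≤ d * LH := le_mul_of_one_le_left (by linarith) hd1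
  have hlam0 : 0 < lam := by linarith
  set ell := Real.log (1 + N / (lam * d)) with hell
  -- Since `N > lam`, `ell ≥ log (1 + 1 / d) ≥ 1 / (d + 1)`.
  have hdell : 1 / 2 ≤ d * ell := by
    have h1 : 1 / (d : ℝ) ≤ N / (lam * d) := by
      rw [div_le_div_iff₀ (by linarith) (by positivity)]
      nlinarith
    have h2 := Real.one_sub_inv_le_log_of_pos (show 0 < 1 + (N : ℝ) / (lam * d) by positivity)
    have h3 : (1 + (N : ℝ) / (lam * d))⁻¹ ≤ (1 + 1 / (d : ℝ))⁻¹ :=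
      inv_anti₀ (by positivity) (by linarith)
    have h4 : 1 - (1 + 1 / (d : ℝ))⁻¹ = 1 / (d + 1) := by
      field_simp
      ring
    have h5 : 1 / ((d : ℝ) + 1) ≤ ell := by linarith
    have h6 := mul_le_mul_of_nonneg_left h5 (show (0 : ℝ) ≤ d by positivity)
    have h7 : 1 / 2 ≤ (d : ℝ) * (1 / (d + 1)) := by
      rw [mul_one_div, div_le_div_iff₀ (by norm_num) (by positivity)]
      linarith
    linarith
  -- The lower bound `100` on the coefficients gives `lam ≥ 100 LH`, while `log (4H / δ) ≤ 2 LH`;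
  -- the deviation term is thus at most `4 / 100`.
  have hP2 : P ≤ 4 * (d * ell) + 1 / 25 := by
    have h1 : Real.log (δ / (4 * H))⁻¹ ≤ 2 * LH := by
      have h2 : (δ / (4 * (H : ℝ)))⁻¹ = 2 * (2 * H / δ) := by
        rw [inv_div]
        ring
      rw [h2, Real.log_mul (by norm_num) (by positivity)]
      have h3 : Real.log 2 ≤ LH := Real.log_le_log (by norm_num) (by
        rw [le_div_iff₀ hδ]
        nlinarith)
      linarith
    have h2 : 2 / lam * Real.log (δ / (4 * H))⁻¹ ≤ 2 / lam * (2 * LH) :=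
      mul_le_mul_of_nonneg_left h1 (by positivity)
    have h3 : 2 / lam * (2 * LH) ≤ 1 / 25 := by
      rw [div_mul_eq_mul_div, div_le_div_iff₀ hlam0 (by norm_num)]
      linarith
    rw [hP]
    linarith
  have hL₃ : 0 ≤ Real.log (2 * H * N * k₃ / δ) := by
    have h1 : (1 : ℝ) ≤ H * N * k₃ :=
      one_le_mul_of_one_le_of_one_le (one_le_mul_of_one_le_of_one_le hH1 hN1) hk31
    have := half_le_log_two_mul_div hδ hδ1 h1
    rw [show (2 : ℝ) * H * N * k₃ = 2 * (H * N * k₃) by ring]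
    linarith
  have hr1 : 0 ≤ regularizer γ₁ δ d H N := hlam0.le.trans ((min_le_left _ _).trans
    (regularizer_one_le (by linarith) hδ hH d hN))
  have hr2 : 0 ≤ regularizer γ₂ δ d H N := hlam0.le.trans ((min_le_right _ _).trans
    (regularizer_one_le (by linarith) hδ hH d hN))
  rw [gapBound, ← hlam, ← hell]
  set L₂ := Real.log (2 * H * N * k₂ / δ) with hL₂def
  set L₃ := Real.log (2 * H * N * k₃ / δ) with hL₃def
  obtain ⟨D, hD, hDd⟩ : ∃ D : ℝ, 1 ≤ D ∧ D = √(d : ℝ) := ⟨_, Real.one_le_sqrt.2 hd1, rfl⟩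
  obtain ⟨k, hk, hkK⟩ : ∃ k : ℝ, 1 ≤ k ∧ k = √(K : ℝ) := ⟨_, Real.one_le_sqrt.2 hK1, rfl⟩
  obtain ⟨m, hm, hmN⟩ : ∃ m : ℝ, 1 ≤ m ∧ m = √(N : ℝ) := ⟨_, Real.one_le_sqrt.2 hN1, rfl⟩
  have hD2 : (d : ℝ) = D ^ 2 := by rw [hDd, Real.sq_sqrt (by positivity)]
  have hk2 : (K : ℝ) = k ^ 2 := by rw [hkK, Real.sq_sqrt (by positivity)]
  have hm2 : (N : ℝ) = m ^ 2 := by rw [hmN, Real.sq_sqrt (by positivity)]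
  have hs1 : √((d : ℝ) ^ 3 * K / N) = d * D * (k / m) := by
    rw [hD2, hk2, hm2, show (D ^ 2) ^ 3 * k ^ 2 / m ^ 2 = (D ^ 2 * D * (k / m)) ^ 2 by
      field_simp, Real.sqrt_sq (by positivity)]
  have hs2 : √((K : ℝ) / (d * N)) = k / m / D := by
    rw [hD2, hk2, hm2, show k ^ 2 / (D ^ 2 * m ^ 2) = (k / m / D) ^ 2 by
      field_simp, Real.sqrt_sq (by positivity)]
  have hs3 : bonusCoeff C K d N = 25 / 2 * C * D * m / k := by
    rw [bonusCoeff, Real.sqrt_mul (by positivity), ← hDd, ← hkK, ← hmN]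
    field_simp
  rw [hs1, hs2, hs3, ← hDd, ← hkK, ← hmN]
  -- the common factor of all the terms
  set q := C * (H : ℝ) ^ 2 * (k / m) with hq
  have hq0 : 0 < q := by positivity
  have hA : 1 / (N : ℝ) * H ≤ q * D := by
    rw [hm2, hq]
    have h1 : 1 / m ^ 2 * (H : ℝ) = H / m * (1 / m) := by field_simp
    have h2 : C * (H : ℝ) ^ 2 * (k / m) * D = H / m * (C * H * k * D) := by ring
    rw [h1, h2]
    refine mul_le_mul_of_nonneg_left ?_ (by positivity)
    refine ((div_le_one (by linarith)).2 hm).trans ?_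
    exact one_le_mul_of_one_le_of_one_le (one_le_mul_of_one_le_of_one_le
      (one_le_mul_of_one_le_of_one_le hC hH1) hk) hD
  have hB : 1 / (N : ℝ) * (H * (C * k * (L₃ / (6 * D) + 4 * H * L₂ / D + 6 * (1 + 3 * H) * D)) *
      (2 * m)) ≤ q * (L₃ / D + 8 * (L₂ / D) + 48 * D) := by
    have h1 : 1 / (N : ℝ) * (H * (C * k * (L₃ / (6 * D) + 4 * H * L₂ / D +
        6 * (1 + 3 * H) * D)) * (2 * m)) =
        C * H * (k / m) * (L₃ / D / 3 + H * (8 * (L₂ / D)) + (12 + 36 * H) * D) := by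
      rw [hm2]
      field_simp
      ring
    have h2 : q * (L₃ / D + 8 * (L₂ / D) + 48 * D) =
        C * H * (k / m) * (H * (L₃ / D + 8 * (L₂ / D) + 48 * D)) := by
      rw [hq]
      ring
    rw [h1, h2]
    refine mul_le_mul_of_nonneg_left ?_ (by positivity)
    have h3 : 0 ≤ L₃ / D := by positivity
    have h4 := mul_nonneg (sub_nonneg.2 hH1) h3
    have h5 := mul_nonneg (sub_nonneg.2 hH1) (zero_le_one.trans hD)
    have h6 : (H : ℝ) * (L₃ / D + 8 * (L₂ / D) + 48 * D) - (L₃ / D / 3 + H * (8 * (L₂ / D)) +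
        (12 + 36 * H) * D) = (H - 1) * (L₃ / D) + 2 / 3 * (L₃ / D) + 12 * ((H - 1) * D) := by
      ring
    linarith only [h3, h4, h5, h6]
  have hbon : 1 / (N : ℝ) * (H * (K * (25 / 2 * C * D * m / k * H) * P +
      K * (25 / 2 * C * D * m / k) * P)) ≤ q * D * (100 * (d * ell) + 1) := by
    have h1 : 1 / (N : ℝ) * (H * (K * (25 / 2 * C * D * m / k * H) * P +
        K * (25 / 2 * C * D * m / k) * P)) =
        C * H * (k / m) * D * (25 / 2 * (H + 1) * P) := by
      rw [hm2, hk2]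
      field_simp
    have h2 : q * D * (100 * (d * ell) + 1) =
        C * H * (k / m) * D * (H * (100 * (d * ell) + 1)) := by
      rw [hq]
      ring
    rw [h1, h2]
    refine mul_le_mul_of_nonneg_left ?_ (by positivity)
    have h3 : 25 / 2 * ((H : ℝ) + 1) * P ≤
        25 / 2 * ((H : ℝ) + 1) * (4 * (d * ell) + 1 / 25) :=
      mul_le_mul_of_nonneg_left hP2 (by positivity)
    have h4 : 25 / 2 * ((H : ℝ) + 1) * (4 * (d * ell) + 1 / 25) ≤
        25 / 2 * (2 * H) * (4 * (d * ell) + 1 / 25) :=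
      mul_le_mul_of_nonneg_right (by linarith) (by linarith)
    linarith
  -- The regularizer terms are nonnegative and are discarded: in this case only the logarithm and
  -- the class sizes are needed.
  have hR : q * (L₃ / D + 8 * (L₂ / D)) + 912 * (q * D * (d * ell)) ≤
      912 * C * (H : ℝ) ^ 2 * (d * D * (k / m)) * ell + (H : ℝ) ^ 2 / C * (k / m / D) *
      (2 * regularizer γ₂ δ d H N * d + C ^ 2 * L₃ + 4 * regularizer γ₁ δ d H N * d +
        8 * C ^ 2 * L₂) := by
    have h1 : (H : ℝ) ^ 2 / C * (k / m / D) * (C ^ 2 * L₃ + 8 * C ^ 2 * L₂) =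
        q * (L₃ / D + 8 * (L₂ / D)) := by
      rw [hq]
      field_simp
    have h2 : (H : ℝ) ^ 2 / C * (k / m / D) * (C ^ 2 * L₃ + 8 * C ^ 2 * L₂) ≤
        (H : ℝ) ^ 2 / C * (k / m / D) * (2 * regularizer γ₂ δ d H N * d + C ^ 2 * L₃ +
          4 * regularizer γ₁ δ d H N * d + 8 * C ^ 2 * L₂) := by
      refine mul_le_mul_of_nonneg_left ?_ (by positivity)
      have h3 : 0 ≤ regularizer γ₂ δ d H N * d := by positivity
      have h4 : 0 ≤ regularizer γ₁ δ d H N * d := by positivity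
      linarith
    have h5 : 912 * C * (H : ℝ) ^ 2 * (d * D * (k / m)) * ell = 912 * (q * D * (d * ell)) := by
      rw [hq]
      ring
    linarith
  refine le_trans ?_ hR
  -- Apart from the class terms, the contributions sum to `q D (50 + 100 d ell)`, which is at most
  -- `200 q D d ell` and so well below the available `912`.
  have hqD : q * D * (1 / 2) ≤ q * D * (d * ell) := mul_le_mul_of_nonneg_left hdell (by positivity)
  have hqD0 : 0 ≤ q * D := by positivity
  rw [mul_add, mul_add]
  linarith

end Arithmetic


/-! ### The gap bound on the good event and the probability of that event -/

section GoodEvent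

variable {S W A : Type*} [MeasurableSpace S] [MeasurableSpace W] [MeasurableSpace A]
  {ν : Measure S} {H d : ℕ} [SigmaFinite ν] [Fintype A] [MeasurableSingletonClass A] [Nonempty A]
  {M : LinearCMDP S W A ν H d} {Ψ₂ : Finset (S → W → Vec d)} {Ψ₃ : Finset (W → Vec d)}
  {C γ₁ γ₂ δ : ℝ} {N : ℕ} {q : Measure W} [IsProbabilityMeasure q] {Ω : Type*}

/-- In dimension zero the transition density vanishes identically and could not integrate to one. -/
theorem LinearCMDP.dim_pos [Nonempty W] (M : LinearCMDP S W A ν H d) (hH : 1 ≤ H) : 0 < d := by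
  rcases Nat.eq_zero_or_pos d with rfl | hd
  · obtain ⟨w⟩ := ‹Nonempty W›
    obtain ⟨a⟩ := ‹Nonempty A›
    have h1 := (M.transition ⟨0, hH⟩).lintegral_eq_one M.s₁ a w
    simp [PiLp.inner_apply] at h1
  · exact hd

theorem Algorithm.integral_gap_le_horizon (alg : Algorithm M Ψ₂ Ψ₃ C γ₁ γ₂ δ N) (n : ℕ)
    (D : Hist S W A H n) :
    ∫ w, (M.optValue w - M.value w (alg.policy n D w)) ∂q ≤ H := by
  refine (integral_mono (M.integrable_gap q (alg.measurable_policy_context n D))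
    (integrable_const (H : ℝ)) fun w => ?_).trans_eq (by simp)
  show M.optValue w - M.value w (alg.policy n D w) ≤ H
  linarith [M.optValue_le w, M.value_nonneg w (alg.policy n D w)]

theorem Algorithm.avgGap_le_horizon (alg : Algorithm M Ψ₂ Ψ₃ C γ₁ γ₂ δ N) (hN : 1 ≤ N)
    (ctx : ℕ → Ω → W) (smp : ℕ → Fin H → Ω → (S × A) × S) (ω : Ω) :
    alg.avgGap q ctx smp ω ≤ H := by
  have hN0 : (0 : ℝ) < N := Nat.cast_pos.2 hN
  rw [Algorithm.avgGap, one_div, inv_mul_le_iff₀ hN0]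
  refine (Finset.sum_le_sum fun n _ =>
    alg.integral_gap_le_horizon (q := q) n (history ctx smp n ω)).trans_eq ?_
  simp

/-- The bound on the average gap holds as soon as the estimation errors and the feature norms are
small along the data of the run. -/
theorem Algorithm.avgGap_le_gapBound (alg : Algorithm M Ψ₂ Ψ₃ C γ₁ γ₂ δ N)
    (hreal : M.Realizable Ψ₂ Ψ₃) {pmin pmax : ℝ} (hM : M.BoundedStateDensity pmin pmax)
    (hmin : 0 < pmin) (hle : pmin ≤ pmax) (hC : 1 ≤ C) (hC2 : C ^ 2 = pmax / pmin)
    (hγ₁ : 100 ≤ γ₁) (hγ₂ : 100 ≤ γ₂) (hδ : 0 < δ) (hδ1 : δ < 1) (hH : 1 ≤ H) (hd : 1 ≤ d)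
    (hN : 1 ≤ N) {lam : ℝ} (hlam : lam = min (regularizer γ₁ δ d H 1) (regularizer γ₂ δ d H 1))
    (ctx : ℕ → Ω → W) (smp : ℕ → Fin H → Ω → (S × A) × S) (ω : Ω)
    (hr : ∀ n, 0 < n → n < N → ∀ h, ∑ τ ∈ Finset.range n, (alg.condMean q h τ
      (history ctx smp τ ω) (fun w x => M.rewardErr h
        (alg.estReward n (history ctx smp n ω) h) w x.1)).toReal ≤
      Real.log (2 * H * N * Ψ₃.card / δ))
    (ht : ∀ n, 0 < n → n < N → ∀ h, ∑ τ ∈ Finset.range n, (alg.condMean q h τ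
      (history ctx smp τ ω) (fun w x => M.transErr h
        (alg.estTrans n (history ctx smp n ω) h) w x.1)).toReal ≤
      Real.log (2 * H * N * Ψ₂.card / δ))
    (hφ : ∀ h, ∑ n ∈ Finset.range N, (alg.condMean q h n (history ctx smp n ω) (fun _ x =>
      ENNReal.ofReal (featureNorm (M.φ h) h (regularizer γ₁ δ d H (n + 1))
        (history ctx smp n ω) x.1))).toReal ≤
      4 * d * Real.log (1 + N / (lam * d)) + 2 / lam * Real.log (δ / (4 * H))⁻¹)
    (hψ : ∀ h, ∑ n ∈ Finset.range N, (alg.condMean q h n (history ctx smp n ω) (fun _ x =>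
      ENNReal.ofReal (featureNorm (M.ψ h) h (regularizer γ₂ δ d H (n + 1))
        (history ctx smp n ω) x.1))).toReal ≤
      4 * d * Real.log (1 + N / (lam * d)) + 2 / lam * Real.log (δ / (4 * H))⁻¹) :
    alg.avgGap q ctx smp ω ≤
      gapBound C γ₁ γ₂ δ H d (Fintype.card A) N Ψ₂.card Ψ₃.card := by
  have hk₂ : 1 ≤ Ψ₂.card := Finset.card_pos.2 ⟨_, hreal.μ_mem ⟨0, hH⟩⟩
  have hk₃ : 1 ≤ Ψ₃.card := Finset.card_pos.2 ⟨_, hreal.η_mem ⟨0, hH⟩⟩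
  have hK : 1 ≤ Fintype.card A := Fintype.card_pos
  have hC0 : 0 < C := zero_lt_one.trans_le hC
  have hH1 : (1 : ℝ) ≤ H := Nat.one_le_cast.2 hH
  have hd1 : (1 : ℝ) ≤ d := Nat.one_le_cast.2 hd
  have hK1 : (1 : ℝ) ≤ Fintype.card A := Nat.one_le_cast.2 hK
  have hN1 : (1 : ℝ) ≤ N := Nat.one_le_cast.2 hN
  have hk31 : (1 : ℝ) ≤ Ψ₃.card := Nat.one_le_cast.2 hk₃
  have hk21 : (1 : ℝ) ≤ Ψ₂.card := Nat.one_le_cast.2 hk₂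
  -- With few episodes the claimed bound already exceeds `H`, which bounds every gap, so the
  -- concentration estimates are needed only in the other case.
  rcases le_or_gt (N : ℝ) (min (regularizer γ₁ δ d H 1) (regularizer γ₂ δ d H 1)) with hNl | hNl
  · exact (alg.avgGap_le_horizon hN ctx smp ω).trans (le_gapBound_of_le hC (by linarith)
      (by linarith) hδ hδ1 hH hd hK hN hk₂ hk₃ hNl)
  have hLH := half_le_log_two_mul_div hδ hδ1 hH1
  have hreg : ∀ γ : ℝ, 100 ≤ γ → ∀ n : ℕ, 0 < regularizer γ δ d H (n + 1) := fun γ hγ n => by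
    refine lt_of_lt_of_le ?_ (regularizer_one_le (by linarith) hδ hH d (Nat.le_add_left 1 n))
    rw [regularizer, Nat.cast_one, mul_one]
    positivity
  have hlog : ∀ k : ℝ, 1 ≤ k → 0 ≤ Real.log (2 * H * N * k / δ) := fun k hk => by
    have h1 : (1 : ℝ) ≤ H * N * k :=
      one_le_mul_of_one_le_of_one_le (one_le_mul_of_one_le_of_one_le hH1 hN1) hk
    have := half_le_log_two_mul_div hδ hδ1 h1
    rw [show (2 : ℝ) * H * N * k = 2 * (H * N * k) by ring]
    linarith
  have hL₂ := hlog _ hk21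
  have hL₃ := hlog _ hk31
  have hb := bonusCoeff_nonneg hC0.le (Fintype.card A) d N
  obtain ⟨P, hP⟩ : ∃ P, P = 4 * d * Real.log (1 + N / (lam * d)) +
      2 / lam * Real.log (δ / (4 * H))⁻¹ := ⟨_, rfl⟩
  rw [← hP] at hφ hψ
  set L₂ := Real.log (2 * H * N * Ψ₂.card / δ) with hL₂def
  set L₃ := Real.log (2 * H * N * Ψ₃.card / δ) with hL₃def
  set K := Fintype.card A with hKdef
  set U : Fin H → ℕ → ℝ := fun h n => (alg.condMean q h n (history ctx smp n ω) (fun _ x =>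
      ENNReal.ofReal (featureNorm (M.φ h) h (regularizer γ₁ δ d H (n + 1))
        (history ctx smp n ω) x.1))).toReal with hU
  set V : Fin H → ℕ → ℝ := fun h n => (alg.condMean q h n (history ctx smp n ω) (fun _ x =>
      ENNReal.ofReal (featureNorm (M.ψ h) h (regularizer γ₂ δ d H (n + 1))
        (history ctx smp n ω) x.1))).toReal with hV
  have hU0 : ∀ h n, 0 ≤ U h n := fun h n => ENNReal.toReal_nonneg
  have hV0 : ∀ h n, 0 ≤ V h n := fun h n => ENNReal.toReal_nonneg
  set β : ℕ → ℝ := fun n => ∑ h, (K * (bonusCoeff C K d N * H) * U h n +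
    K * bonusCoeff C K d N * V h n) with hβ
  have hβ0 : ∀ n, 0 ≤ β n := fun n => Finset.sum_nonneg fun h _ =>
    add_nonneg (mul_nonneg (by positivity) (hU0 h n)) (mul_nonneg (by positivity) (hV0 h n))
  set c : ℝ := C * √K * (L₃ / (6 * √d) + 4 * H * L₂ / √d + 6 * (1 + 3 * H) * √d) with hc
  have hc0 : 0 ≤ c := by positivity
  have hgap : ∀ n, 0 < n → n < N →
      ∫ w, (M.optValue w - M.value w (alg.policy n (history ctx smp n ω) w)) ∂q ≤
        H * c * (1 / √(n : ℝ)) + β n := by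
    intro n hn hnN
    have hn0 : (0 : ℝ) < n := Nat.cast_pos.2 hn
    have hsn : 0 < √(n : ℝ) := Real.sqrt_pos.2 hn0
    have hsd : 0 < √(d : ℝ) := Real.sqrt_pos.2 (by linarith)
    have hsK : 0 < √(K : ℝ) := Real.sqrt_pos.2 (by linarith)
    refine (alg.integral_gap_le (q := q) hreal hM hmin hle hC0.le (hreg γ₁ hγ₁ n) (hreg γ₂ hγ₂ n)
      hn hnN (a := √(n : ℝ) / (6 * C * (√(K : ℝ) * √(d : ℝ)))) (by positivity)
      ctx smp ω).trans ?_
    rw [Finset.sum_add_distrib]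
    refine add_le_add ?_ le_rfl
    have h1 : pmax / pmin * (K : ℝ) / n = C ^ 2 * √(K : ℝ) ^ 2 / √(n : ℝ) ^ 2 := by
      rw [hC2, Real.sq_sqrt (by linarith), Real.sq_sqrt hn0.le]
    rw [h1]
    refine (Finset.sum_le_sum fun h _ => episode_error_le H hC0 hsK hsd hsn (hr n hn hnN h)
      (ht n hn hnN h)).trans_eq ?_
    rw [Finset.sum_const, Finset.card_univ, Fintype.card_fin, nsmul_eq_mul, ← hc]
    ring
  have hβsum : ∑ n ∈ Finset.range N, β n ≤
      H * (K * (bonusCoeff C K d N * H) * P + K * bonusCoeff C K d N * P) := by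
    rw [hβ, Finset.sum_comm]
    have h1 : ∀ h : Fin H, ∑ n ∈ Finset.range N, (K * (bonusCoeff C K d N * H) * U h n +
        K * bonusCoeff C K d N * V h n) ≤
        K * (bonusCoeff C K d N * H) * P + K * bonusCoeff C K d N * P := fun h => by
      rw [Finset.sum_add_distrib, ← Finset.mul_sum, ← Finset.mul_sum]
      exact add_le_add (mul_le_mul_of_nonneg_left (hφ h) (by positivity))
        (mul_le_mul_of_nonneg_left (hψ h) (by positivity))
    refine (Finset.sum_le_sum fun h _ => h1 h).trans_eq ?_
    rw [Finset.sum_const, Finset.card_univ, Fintype.card_fin, nsmul_eq_mul]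
  have hsum := sum_gap_le (gap := fun n => ∫ w, (M.optValue w -
    M.value w (alg.policy n (history ctx smp n ω) w)) ∂q) (B := H) (Nat.cast_nonneg H) hβ0
    (mul_nonneg (Nat.cast_nonneg H) hc0) (alg.integral_gap_le_horizon 0 _) hgap
  rw [hlam] at hP
  refine le_trans ?_ (le_gapBound_of_lt (k₂ := Ψ₂.card) hC hγ₁ hγ₂ hδ hδ1 hH hd hK hN hk₃ hNl hP)
  rw [Algorithm.avgGap]
  refine mul_le_mul_of_nonneg_left ?_ (by positivity)
  exact hsum.trans (add_le_add le_rfl hβsum)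

variable [MeasurableSpace Ω] {Pr : Measure Ω} [IsProbabilityMeasure Pr] {ctx : ℕ → Ω → W}
  {smp : ℕ → Fin H → Ω → (S × A) × S}

/-- The failure probability is `δ / 2` for each of the two estimation events and `H * δ / (4H) = δ /
4` for each of the two families of feature norms, in total `3δ / 2`. -/
theorem Algorithm.IsRun.measure_avgGap_le {alg : Algorithm M Ψ₂ Ψ₃ C γ₁ γ₂ δ N}
    (hrun : alg.IsRun q Pr ctx smp) (hreal : M.Realizable Ψ₂ Ψ₃) {pmin pmax : ℝ}
    (hM : M.BoundedStateDensity pmin pmax) (hmin : 0 < pmin) (hle : pmin ≤ pmax) (hC : 1 ≤ C)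
    (hC2 : C ^ 2 = pmax / pmin) (hγ₁ : 100 ≤ γ₁) (hγ₂ : 100 ≤ γ₂) (hδ : 0 < δ) (hδ1 : δ < 1)
    (hH : 1 ≤ H) (hN : 1 ≤ N) :
    ENNReal.ofReal (1 - 3 * δ / 2) ≤ Pr {ω | alg.avgGap q ctx smp ω ≤
      gapBound C γ₁ γ₂ δ H d (Fintype.card A) N Ψ₂.card Ψ₃.card} := by
  have hW : Nonempty W := q.nonempty_of_neZero
  have hd : 0 < d := M.dim_pos hH
  have hH1 : (1 : ℝ) ≤ H := Nat.one_le_cast.2 hH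
  have hd1 : (1 : ℝ) ≤ d := Nat.one_le_cast.2 hd
  have hLH := half_le_log_two_mul_div hδ hδ1 hH1
  have hdL : 1 / 2 ≤ d * Real.log (2 * H / δ) := by nlinarith
  have hreg : ∀ γ : ℝ, 100 ≤ γ → 1 ≤ regularizer γ δ d H 1 := fun γ hγ => by
    rw [regularizer, Nat.cast_one, mul_one, mul_assoc]
    nlinarith
  obtain ⟨lam, hlam⟩ : ∃ lam, lam = min (regularizer γ₁ δ d H 1) (regularizer γ₂ δ d H 1) :=
    ⟨_, rfl⟩
  have hlam1 : 1 ≤ lam := hlam ▸ le_min (hreg γ₁ hγ₁) (hreg γ₂ hγ₂)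
  have hp : 0 < δ / (4 * H) := by positivity
  have hφ : ∀ h, _ := fun h => hrun.measure_featureNorm_le hd (M.measurable_φ h) (M.norm_φ_le h) h
    hlam1 (reg := fun n => regularizer γ₁ δ d H (n + 1)) (fun n => hlam ▸ (min_le_left _ _).trans
      (regularizer_one_le (by linarith) hδ hH d (Nat.le_add_left 1 n))) hp
  have hψ : ∀ h, _ := fun h => hrun.measure_featureNorm_le hd (M.measurable_ψ h) (M.norm_ψ_le h) h
    hlam1 (reg := fun n => regularizer γ₂ δ d H (n + 1)) (fun n => hlam ▸ (min_le_right _ _).trans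
      (regularizer_one_le (by linarith) hδ hH d (Nat.le_add_left 1 n))) hp
  have hφU := measure_le_card_mul Pr Finset.univ (fun h _ => hφ h) subset_rfl
  have hψU := measure_le_card_mul Pr Finset.univ (fun h _ => hψ h) subset_rfl
  have hr := hrun.measure_rewardErr_le hreal hH hN hδ
  have ht := hrun.measure_transErr_le hreal hH hN hδ
  set G := {ω | alg.avgGap q ctx smp ω ≤
      gapBound C γ₁ γ₂ δ H d (Fintype.card A) N Ψ₂.card Ψ₃.card} with hG
  have hcard : ((Finset.univ : Finset (Fin H)).card : ℝ) * (δ / (4 * H)) = δ / 4 := by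
    rw [Finset.card_univ, Fintype.card_fin]
    field_simp
  rw [hcard] at hφU hψU
  have hbad := (measure_union_le _ _).trans (add_le_add ((measure_union_le _ _).trans
    (add_le_add hr ht)) ((measure_union_le _ _).trans (add_le_add hφU hψU)))
  rw [← ENNReal.ofReal_add (by positivity) (by positivity),
    ← ENNReal.ofReal_add (by positivity) (by positivity),
    ← ENNReal.ofReal_add (by positivity) (by positivity)] at hbad
  have hGc : Pr Gᶜ ≤ ENNReal.ofReal (δ / 2 + δ / 2 + (δ / 4 + δ / 4)) := by
    refine le_trans (measure_mono fun ω hω => ?_) hbad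
    by_contra hcon
    refine hω ?_
    simp only [Set.mem_union, Set.mem_ofPred_eq, Set.mem_iUnion, Finset.mem_univ, exists_prop,
      true_and, not_or, not_exists, not_and, not_lt] at hcon
    exact alg.avgGap_le_gapBound hreal hM hmin hle hC hC2 hγ₁ hγ₂ hδ hδ1 hH hd hN hlam ctx smp ω
      hcon.1.1 hcon.1.2 hcon.2.1 hcon.2.2
  -- Subadditivity alone passes to the complement, so measurability of the event is not required.
  have h1 : (1 : ℝ≥0∞) ≤ Pr G + Pr Gᶜ := by
    rw [← measure_univ (μ := Pr), ← Set.union_compl_self G]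
    exact measure_union_le _ _
  rw [ENNReal.ofReal_sub _ (by positivity), ENNReal.ofReal_one, tsub_le_iff_right]
  refine h1.trans (add_le_add le_rfl (hGc.trans_eq ?_))
  congr 1
  ring

end GoodEvent


/-! ### Inversion of the bound into a number of episodes -/

section EpisodeCount

theorem mul_sqrt_eq_sqrt {a : ℝ} (ha : 0 ≤ a) (x : ℝ) : a * √x = √(a ^ 2 * x) := by
  rw [Real.sqrt_mul (sq_nonneg a), Real.sqrt_sq ha]

/-- Writing `n = u⁴ X Y²` gives `√(X / n) = 1 / (u² Y)` and `log n ≤ 4u + 3Y`. The claim becomes `a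
(5Y + 4u) < u² Y`, which follows from `u ≥ 10a`, since the left side is at most `9 a u Y`. -/
theorem sqrt_div_mul_log_lt_one {a X Y n : ℝ} (ha : 1 ≤ a) (hX : 1 ≤ X) (hY : 1 ≤ Y)
    (hXY : Real.log X ≤ Y) (hn : (10 * a) ^ 4 * X * Y ^ 2 ≤ n) :
    √(X / n) * (a * (2 * Y + Real.log n)) < 1 := by
  obtain ⟨u, hu0, hu⟩ : ∃ u : ℝ, 0 ≤ u ∧ u ^ 4 = n / (X * Y ^ 2) := by
    have h0 : 0 ≤ n / (X * Y ^ 2) := div_nonneg (le_trans (by positivity) hn) (by positivity)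
    refine ⟨√√(n / (X * Y ^ 2)), Real.sqrt_nonneg _, ?_⟩
    rw [show (4 : ℕ) = 2 * 2 by norm_num, pow_mul, Real.sq_sqrt (Real.sqrt_nonneg _),
      Real.sq_sqrt h0]
  have hnu : n = u ^ 4 * X * Y ^ 2 := by
    rw [hu]
    field_simp
  have hua : 10 * a ≤ u := by
    refine le_of_pow_le_pow_left₀ (n := 4) (by norm_num) hu0 ?_
    rw [hu, le_div_iff₀ (by positivity)]
    linarith
  have hu1 : 0 < u := by linarith
  have hsqrt : √(X / n) = 1 / (u ^ 2 * Y) := by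
    rw [hnu, show X / (u ^ 4 * X * Y ^ 2) = (1 / (u ^ 2 * Y)) ^ 2 by
      field_simp, Real.sqrt_sq (by positivity)]
  have hlog : Real.log n ≤ 4 * u + 3 * Y := by
    rw [hnu, Real.log_mul (by positivity) (by positivity), Real.log_mul (by positivity)
      (by positivity), Real.log_pow, Real.log_pow]
    push_cast
    linarith [Real.log_le_self hu0, Real.log_le_self (zero_le_one.trans hY)]
  rw [hsqrt, div_mul_eq_mul_div, one_mul, div_lt_one (by positivity)]
  have h1 : a * (2 * Y + Real.log n) ≤ a * (5 * Y + 4 * u) :=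
    mul_le_mul_of_nonneg_left (by linarith) (by linarith)
  have h2 : a * Y ≤ a * u * Y := by
    have : a * Y * 1 ≤ a * Y * u := mul_le_mul_of_nonneg_left (by linarith) (by positivity)
    linarith
  have h3 : a * u * 1 ≤ a * u * Y := mul_le_mul_of_nonneg_left hY (by positivity)
  have h4 : 10 * a * (u * Y) ≤ u * (u * Y) := mul_le_mul_of_nonneg_right hua (by positivity)
  have h5 : 0 < a * u * Y := by positivity
  linarith

set_option maxHeartbeats 1000000 in
/-- The bound on the gap is less than `ε` if there are sufficiently many episodes. -/
theorem gapBound_lt {C γ₁ γ₂ δ ε : ℝ} {H d K N k₂ k₃ : ℕ} (hC : 1 ≤ C) (hγ₁ : 100 ≤ γ₁)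
    (hγ₂ : 100 ≤ γ₂) (hδ : 0 < δ) (hδ1 : δ < 1) (hH : 1 ≤ H) (hd : 1 ≤ d) (hK : 1 ≤ K) (hN : 1 ≤ N)
    (hk₂ : 1 ≤ k₂) (hk₃ : 1 ≤ k₃) (hε : 0 < ε) (hεH : ε ≤ H) {X Y : ℝ}
    (hX : X = (H : ℝ) ^ 4 * (d : ℝ) ^ 3 * K / ε ^ 2 * C ^ 2)
    (hY : Y = Real.log (k₂ * k₃ / δ ^ 2) + Real.log (2 + X))
    (hNX : (10 * (921 + 4 * γ₁ + 2 * γ₂)) ^ 4 * X * Y ^ 2 ≤ N) :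
    gapBound C γ₁ γ₂ δ H d K N k₂ k₃ < ε := by
  have hC0 : 0 < C := zero_lt_one.trans_le hC
  have hH1 : (1 : ℝ) ≤ H := Nat.one_le_cast.2 hH
  have hd1 : (1 : ℝ) ≤ d := Nat.one_le_cast.2 hd
  have hK1 : (1 : ℝ) ≤ K := Nat.one_le_cast.2 hK
  have hN1 : (1 : ℝ) ≤ N := Nat.one_le_cast.2 hN
  have hk21 : (1 : ℝ) ≤ k₂ := Nat.one_le_cast.2 hk₂
  have hk31 : (1 : ℝ) ≤ k₃ := Nat.one_le_cast.2 hk₃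
  -- This is where `ε ≤ H` enters. It allows `log H` to be absorbed into `log (2 + X)`, so that the
  -- number of episodes need not mention `log H` separately.
  have hHX : (H : ℝ) ≤ X := by
    have h1 : (1 : ℝ) ≤ (d : ℝ) ^ 3 * K * C ^ 2 := one_le_mul_of_one_le_of_one_le
      (one_le_mul_of_one_le_of_one_le (one_le_pow₀ hd1) hK1) (one_le_pow₀ hC)
    have h2 : 1 ≤ (H : ℝ) ^ 2 / ε ^ 2 :=
      (one_le_div (by positivity)).2 (pow_le_pow_left₀ hε.le hεH 2)
    have h3 := one_le_mul_of_one_le_of_one_le h1 h2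
    calc (H : ℝ) ≤ (H : ℝ) ^ 2 * 1 := by nlinarith
      _ ≤ (H : ℝ) ^ 2 * ((d : ℝ) ^ 3 * K * C ^ 2 * ((H : ℝ) ^ 2 / ε ^ 2)) :=
        mul_le_mul_of_nonneg_left h3 (by positivity)
      _ = X := by
        rw [hX]
        ring
  have hX1 : 1 ≤ X := hH1.trans hHX
  have hlogk₂ := Real.log_nonneg hk21
  have hlogk₃ := Real.log_nonneg hk31
  have hlogδ := Real.log_nonpos hδ.le hδ1.le
  have hlogclass : Real.log (k₂ * k₃ / δ ^ 2) =
      Real.log k₂ + Real.log k₃ - 2 * Real.log δ := by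
    rw [Real.log_div (by positivity) (by positivity), Real.log_mul (by positivity) (by positivity),
      Real.log_pow]
    push_cast
    ring
  have hlogX : 1 ≤ Real.log (2 + X) := by
    rw [Real.le_log_iff_exp_le (by linarith)]
    linarith [Real.exp_one_lt_d9]
  have hlogXX : Real.log X ≤ Real.log (2 + X) := Real.log_le_log (by linarith) (by linarith)
  have hlogH : Real.log H ≤ Real.log (2 + X) := Real.log_le_log (by linarith) (by linarith)
  have hY1 : 1 ≤ Y := by linarith
  have hlog2 : Real.log 2 ≤ 1 := by linarith [Real.log_two_lt_d9]
  -- All the logarithms of the bound are reduced to the single quantity `2 Y + log N`; one copy of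
  -- `Y` absorbs the class sizes, `1 / δ` and `H`, the other the constant `log 2`.
  have hlogk : ∀ k : ℝ, 1 ≤ k → Real.log k ≤ Real.log k₂ + Real.log k₃ →
      Real.log (2 * H * N * k / δ) ≤ 2 * Y + Real.log N := fun k hk hle => by
    rw [Real.log_div (by positivity) hδ.ne', Real.log_mul (by positivity) (by positivity),
      Real.log_mul (by positivity) (by positivity), Real.log_mul (by positivity) (by positivity)]
    linarith
  have hL₂ := hlogk k₂ hk21 (by linarith)
  have hL₃ := hlogk k₃ hk31 (by linarith)
  have hL : Real.log (2 * N * H / δ) ≤ 2 * Y + Real.log N := by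
    have := hlogk 1 le_rfl (by rw [Real.log_one]; linarith)
    rwa [mul_one, show (2 : ℝ) * H * N = 2 * N * H by ring] at this
  have hZ : 0 ≤ 2 * Y + Real.log N := by linarith [Real.log_nonneg hN1]
  have hell : Real.log (1 + N / (min (regularizer γ₁ δ d H 1) (regularizer γ₂ δ d H 1) * d)) ≤
      2 * Y + Real.log N := by
    have hLH := half_le_log_two_mul_div hδ hδ1 hH1
    have hdL : 1 / 2 ≤ d * Real.log (2 * H / δ) := by nlinarith
    have hreg : ∀ γ : ℝ, 100 ≤ γ → 1 ≤ regularizer γ δ d H 1 := fun γ hγ => by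
      rw [regularizer, Nat.cast_one, mul_one, mul_assoc]
      nlinarith
    have h1 : 1 ≤ min (regularizer γ₁ δ d H 1) (regularizer γ₂ δ d H 1) * d :=
      one_le_mul_of_one_le_of_one_le (le_min (hreg γ₁ hγ₁) (hreg γ₂ hγ₂)) hd1
    have h2 : (N : ℝ) / (min (regularizer γ₁ δ d H 1) (regularizer γ₂ δ d H 1) * d) ≤ N :=
      div_le_self (by linarith) h1
    have h3 : 0 ≤ (N : ℝ) / (min (regularizer γ₁ δ d H 1) (regularizer γ₂ δ d H 1) * d) :=
      div_nonneg (by linarith) (by linarith)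
    have h4 : Real.log (1 + N / (min (regularizer γ₁ δ d H 1) (regularizer γ₂ δ d H 1) * d)) ≤
        Real.log (2 * N) := Real.log_le_log (by linarith) (by linarith)
    rw [Real.log_mul (by norm_num) (by linarith)] at h4
    linarith
  have hs1 : C * (H : ℝ) ^ 2 * √((d : ℝ) ^ 3 * K / N) = ε * √(X / N) := by
    rw [mul_sqrt_eq_sqrt (show 0 ≤ C * (H : ℝ) ^ 2 by positivity), mul_sqrt_eq_sqrt hε.le, hX]
    congr 1
    field_simp
  have hs2 : (H : ℝ) ^ 2 / C * √((K : ℝ) / (d * N)) = ε * √(X / N) / (C ^ 2 * d ^ 2) := by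
    have h1 : √((d : ℝ) ^ 3 * K / N) = d ^ 2 * √((K : ℝ) / (d * N)) := by
      rw [mul_sqrt_eq_sqrt (show 0 ≤ (d : ℝ) ^ 2 by positivity)]
      congr 1
      field_simp
    rw [← hs1, h1]
    field_simp
  set Z := 2 * Y + Real.log N with hZdef
  set r := ε * √(X / N) with hr
  have hr0 : 0 ≤ r := by positivity
  -- The factor `C² d²` cancels against the prefactor in `hs2`. The constant `9` is `1 + 8` from the
  -- class terms, and together with `912` it gives the `921` in the number of episodes.
  have hterm : 2 * regularizer γ₂ δ d H N * d + C ^ 2 * Real.log (2 * H * N * k₃ / δ) +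
      4 * regularizer γ₁ δ d H N * d + 8 * C ^ 2 * Real.log (2 * H * N * k₂ / δ) ≤
      C ^ 2 * d ^ 2 * ((9 + 4 * γ₁ + 2 * γ₂) * Z) := by
    have hC2 : 1 ≤ C ^ 2 := one_le_pow₀ hC
    have hd2 : (1 : ℝ) ≤ (d : ℝ) ^ 2 := one_le_pow₀ hd1
    have hregN : ∀ γ : ℝ, 100 ≤ γ →
        regularizer γ δ d H N * d ≤ C ^ 2 * d ^ 2 * (γ * Z) := fun γ hγ => by
      have h1 : γ * d ^ 2 * Real.log (2 * N * H / δ) ≤ γ * d ^ 2 * Z :=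
        mul_le_mul_of_nonneg_left hL (by positivity)
      have h2 : 1 * (γ * d ^ 2 * Z) ≤ C ^ 2 * (γ * d ^ 2 * Z) :=
        mul_le_mul_of_nonneg_right hC2 (by positivity)
      rw [regularizer]
      linarith
    have hcl : ∀ L, L ≤ Z → C ^ 2 * L ≤ C ^ 2 * d ^ 2 * Z := fun L hLZ => by
      have h1 : C ^ 2 * L ≤ C ^ 2 * Z := mul_le_mul_of_nonneg_left hLZ (by positivity)
      have h2 : C ^ 2 * Z * 1 ≤ C ^ 2 * Z * d ^ 2 := mul_le_mul_of_nonneg_left hd2 (by positivity)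
      linarith
    linarith [hregN γ₁ hγ₁, hregN γ₂ hγ₂, hcl _ hL₂, hcl _ hL₃]
  rw [gapBound, hs2, show 912 * C * (H : ℝ) ^ 2 * √((d : ℝ) ^ 3 * K / N) = 912 * r by
    rw [← hs1]; ring]
  have h1 := mul_le_mul_of_nonneg_left hell (show 0 ≤ 912 * r by positivity)
  have h2 := mul_le_mul_of_nonneg_left hterm (show 0 ≤ r / (C ^ 2 * d ^ 2) by positivity)
  have h3 : r / (C ^ 2 * d ^ 2) * (C ^ 2 * d ^ 2 * ((9 + 4 * γ₁ + 2 * γ₂) * Z)) =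
      r * ((9 + 4 * γ₁ + 2 * γ₂) * Z) := by
    field_simp
  have hmain := sqrt_div_mul_log_lt_one (a := 921 + 4 * γ₁ + 2 * γ₂) (by linarith) hX1 hY1
    (by linarith) hNX
  have h4 := mul_lt_mul_of_pos_left hmain hε
  rw [← hZdef, ← mul_assoc, ← hr, mul_one] at h4
  refine lt_of_le_of_lt (add_le_add h1 h2) (lt_of_eq_of_lt ?_ h4)
  rw [h3]
  ring

end EpisodeCount

end ContextualMDP

end

/-! ### The main theorem -/

theorem theorem2 :
    ∃ γ₀ : ℝ, 0 < γ₀ ∧ ∀ γ₁ γ₂ : ℝ, γ₀ ≤ γ₁ → γ₀ ≤ γ₂ → ∃ c : ℝ, 0 < c ∧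
      ∀ (S : Type*) (W : Type*) (A : Type*) (Ω : Type*)
        [MeasurableSpace S] [MeasurableSpace W]
        [Fintype A] [Nonempty A] [MeasurableSpace A] [MeasurableSingletonClass A]
        [MeasurableSpace Ω]
        (ν : MeasureTheory.Measure S) [MeasureTheory.SigmaFinite ν]
        (q : MeasureTheory.Measure W) [MeasureTheory.IsProbabilityMeasure q]
        (Pr : MeasureTheory.Measure Ω) [MeasureTheory.IsProbabilityMeasure Pr]
        (H d N : ℕ) (M : ContextualMDP.LinearCMDP S W A ν H d)
        (Ψ₂ : Finset (S → W → ContextualMDP.Vec d)) (Ψ₃ : Finset (W → ContextualMDP.Vec d))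
        (pmin pmax δ : ℝ)
        (alg : ContextualMDP.Algorithm M Ψ₂ Ψ₃ (√(pmax / pmin)) γ₁ γ₂ δ N)
        (ctx : ℕ → Ω → W) (smp : ℕ → Fin H → Ω → (S × A) × S),
        1 ≤ H → 1 ≤ N → 0 < pmin → pmin ≤ pmax → 0 < δ → δ < 1 →
        M.Realizable Ψ₂ Ψ₃ →
        M.BoundedStateDensity pmin pmax →
        alg.IsRun q Pr ctx smp →
        (∀ n < N, ∀ D : ContextualMDP.Hist S W A H n,
          MeasureTheory.Integrable (fun w => M.optValue w - M.value w (alg.policy n D w)) q) ∧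
        ENNReal.ofReal (1 - 3 * δ / 2) ≤
          Pr {ω | alg.avgGap q ctx smp ω ≤
            ContextualMDP.gapBound (√(pmax / pmin)) γ₁ γ₂ δ H d (Fintype.card A) N
              Ψ₂.card Ψ₃.card} ∧
        ∀ ε : ℝ, 0 < ε →
          c * ContextualMDP.episodeScale pmin pmax ε H d (Fintype.card A) *
              (Real.log (Ψ₂.card * Ψ₃.card / δ ^ 2) +
                Real.log (2 + ContextualMDP.episodeScale pmin pmax ε H d (Fintype.card A))) ^ 2
            ≤ N →
          ENNReal.ofReal (1 - 3 * δ / 2) ≤ Pr {ω | alg.avgGap q ctx smp ω < ε} := by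
  refine ⟨100, by norm_num, fun γ₁ γ₂ hγ₁ hγ₂ => ⟨(10 * (921 + 4 * γ₁ + 2 * γ₂)) ^ 4,
    by positivity, ?_⟩⟩
  intro S W A Ω _ _ _ _ _ _ _ ν _ q _ Pr _ H d N M Ψ₂ Ψ₃ pmin pmax δ alg ctx smp hH hN hmin hle
    hδ hδ1 hreal hM hrun
  have hratio : 1 ≤ pmax / pmin := (one_le_div hmin).2 hle
  have hC : 1 ≤ √(pmax / pmin) := Real.one_le_sqrt.2 hratio
  have hC2 : √(pmax / pmin) ^ 2 = pmax / pmin := Real.sq_sqrt (zero_le_one.trans hratio)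
  have hprob := hrun.measure_avgGap_le hreal hM hmin hle hC hC2 hγ₁ hγ₂ hδ hδ1 hH hN
  refine ⟨fun n _ D => M.integrable_gap q (alg.measurable_policy_context n D), hprob,
    fun ε hε hNX => ?_⟩
  -- For `ε > H` the average gap, never above `H`, is below `ε` with certainty.
  rcases le_or_gt ε (H : ℝ) with hεH | hεH
  · have : Nonempty W := q.nonempty_of_neZero
    have hlt := ContextualMDP.gapBound_lt hC hγ₁ hγ₂ hδ hδ1 hH (M.dim_pos hH) Fintype.card_pos hN
      (Finset.card_pos.2 ⟨_, hreal.μ_mem ⟨0, hH⟩⟩) (Finset.card_pos.2 ⟨_, hreal.η_mem ⟨0, hH⟩⟩)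
      hε hεH (by rw [hC2, ContextualMDP.episodeScale]) rfl hNX
    exact hprob.trans (MeasureTheory.measure_mono fun ω hω => lt_of_le_of_lt hω hlt)
  · have huniv : {ω | alg.avgGap q ctx smp ω < ε} = Set.univ := Set.eq_univ_of_forall fun ω =>
      lt_of_le_of_lt (alg.avgGap_le_horizon hN ctx smp ω) hεH
    rw [huniv, MeasureTheory.measure_univ, ← ENNReal.ofReal_one]
    exact ENNReal.ofReal_le_ofReal (by linarith)
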